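/- Let $r\neq 2$ and $\ell\neq r$ be primes, let $n\ge 4$, and let $V$ be a vector space over $\mathbb F_\ell$ of dimension $2g=n(r-1)$ with a nondegenerate alternating form $B$; write $\mathrm{Sp}_{2g}(\ell)=\mathrm{Sp}(V,B)$. Let $\zeta_r\in\mathrm{Sp}_{2g}(\ell)$ be an element of order $r$ with characteristic polynomial $\Phi_r(x)^n=(x^{r-1}+\dots+x+1)^n$, and let $C=C_{\mathrm{Sp}_{2g}(\ell)}(\zeta_r)$ be its centraliser. Let $i$ be the order of $\ell$ modulo $r$. For a monic irreducible polynomial $\phi$ with $\phi(0)\ne 0$ let $\bar\phi$ be the monic polynomial whose roots are the inverses of the roots of $\phi$. Choose monic irreducible $\phi_1,\dots,\phi_t\in\mathbb F_\ell[x]$ with $$\Phi_r=\prod_{j=1}^t\phi_j\bar\phi_j \ \ (i\text{ odd}),\qquad \Phi_r=\prod_{j=1}^t\phi_j\ \ (i\text{ even}).$$ Put $U_j=\ker\phi_j(\zeta_r)$, regarded as an $n$-dimensional vector space over the field $F_j=\mathbb F_\ell[x]/(\phi_j)\cong\mathbb F_{\ell^i}$ with $x$ acting as $\zeta_r$. If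 $i$ is odd put $G_j=\mathrm{GL}_{F_j}(U_j)\cong \mathrm{GL}_n(\ell^i)$. If $i$ is even let $h_j:U_j\times U_j\to F_j$ be the form determined by $\mathrm{Tr}_{F_j/\mathbb F_\ell}(a\,h_j(v,w))=B(av,w)$ for all $a\in F_j$ (a nondegenerate skew-hermitian form with respect to the involution of $F_j$, hence a scalar multiple of a hermitian form), and let $G_j=\mathrm{GU}(U_j,h_j)\cong\mathrm{GU}_n(\ell^{i/2})$ be its group of $F_j$-linear isometries. Restriction to the $U_j$ gives projections $\pi_j:C\to G_j$ and the standard isomorphism $(\pi_j)_j: C\cong G_1\times\dots\times G_t$. Let $S_j=[G_j,G_j]$. Let $H$ be a subgroup of $C$ such that $\pi_j(H)\supseteq S_j$ for every $j$. Suppose that there is an element $\tau\in H$ such that, all eigenvalues being counted with multiplicity, - for every $j$, the $F_j$-linear map $\pi_j(\tau)$ of $U_j$ has exactly one eigenvalue different from $1$, and this eigenvalue has order $r$, i.e. its characteristic polynomial is $(x-1)^{n-1}(x-\alpha_j)$ with $\alpha_j\in F_j^*$ of order $r$; - as an element of $\mathrm{Sp}_{2g}(\ell)$, the eigenvalues of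 $\tau$ different from $1$ are exactly the $r-1$ primitive $r$-th roots of unity in $\overline{\mathbb F}_\ell$, each once, i.e. its characteristic polynomial is $(x-1)^{(n-1)(r-1)}\,\Phi_r(x)$. Then $H\supseteq S_1\times\dots\times S_t$; that is, $H$ contains every $c\in C$ with $\pi_j(c)\in S_j$ for all $j$, and for all $(s_1,\dots,s_t)\in S_1\times\dots\times S_t$ there is $h\in H$ with $\pi_j(h)=s_j$ for all $j$. -/

import Mathlib

open Polynomial

namespace SympCentraliser

section General

variable {K : Type*} [Field K] {V : Type*} [AddCommGroup V] [Module K V]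

/-- The isometry group of a bilinear form `B` on `V`; it is the symplectic group `Sp(V, B)` when `B`
is alternating and nondegenerate. -/
def Sp (B : LinearMap.BilinForm K V) : Subgroup (V ≃ₗ[K] V) where
  carrier := {g | ∀ v w, B (g v) (g w) = B v w}
  one_mem' := fun _ _ => rfl
  mul_mem' := fun {a b} ha hb v w => (ha (b v) (b w)).trans (hb v w)
  inv_mem' := fun {a} ha v w => by
    have h := ha (a⁻¹ v) (a⁻¹ w)
    rw [← LinearEquiv.mul_apply, ← LinearEquiv.mul_apply, mul_inv_cancel] at h
    exact h.symm

/-- The monic polynomial whose roots are the inverses of the roots of `φ`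
(for `φ` with nonzero constant coefficient). -/
noncomputable def recip (φ : K[X]) : K[X] := C (φ.coeff 0)⁻¹ * φ.reverse

/-- `U_φ = ker φ(z)`. For `φ` irreducible and `z` semisimple this is the sum of the eigenspaces
of `z` (over an algebraic closure) whose eigenvalues are the roots of `φ`. -/
noncomputable def block (z : V ≃ₗ[K] V) (φ : K[X]) : Submodule K V :=
  LinearMap.ker (aeval (z : Module.End K V) φ)

theorem commute_aeval {g z : Module.End K V} (h : Commute g z) (p : K[X]) :
    Commute g (aeval z p) := by
  induction p using Polynomial.induction_on' with
  | add p q hp hq => rw [map_add]; exact hp.add_right hq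
  | monomial n a =>
    rw [aeval_monomial]
    exact Commute.mul_right (Algebra.commutes a g).symm (h.pow_right n)

/-- Everything that commutes with `z` preserves `U_φ`. -/
theorem mem_block_of_commute (z : V ≃ₗ[K] V) (φ : K[X]) {g : Module.End K V}
    (hg : Commute g (z : Module.End K V)) : ∀ v ∈ block z φ, g v ∈ block z φ := by
  intro v hv
  have h := LinearMap.congr_fun (commute_aeval hg φ).eq v
  simp only [Module.End.mul_apply] at h
  rw [block, LinearMap.mem_ker] at hv ⊢
  rw [← h, hv, map_zero]

/-- The restriction of `z` to `U_φ`. -/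
noncomputable def zBlock (z : V ≃ₗ[K] V) (φ : K[X]) : Module.End K (block z φ) :=
  LinearMap.restrict (z : Module.End K V) (mem_block_of_commute z φ (Commute.refl _))

theorem coe_aeval_zBlock (z : V ≃ₗ[K] V) (φ p : K[X]) (v : block z φ) :
    ((aeval (zBlock z φ) p v : block z φ) : V) = aeval (z : Module.End K V) p v := by
  induction p using Polynomial.induction_on' with
  | add p q hp hq => simp [hp, hq]
  | monomial n a =>
    have h : ∀ m : ℕ, (((zBlock z φ ^ m) v : block z φ) : V) =
        ((z : Module.End K V) ^ m) (v : V) := by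
      intro m
      induction m with
      | zero => rfl
      | succ m ih => rw [pow_succ', pow_succ', Module.End.mul_apply, Module.End.mul_apply, ← ih]; rfl
    simp [aeval_monomial, Module.algebraMap_end_apply, h]

/-- The action of `K[X]/(φ)` on `U_φ`, the class of `X` acting as `z`. -/
noncomputable def blockAction (z : V ≃ₗ[K] V) (φ : K[X]) :
    AdjoinRoot φ →+* Module.End K (block z φ) :=
  Ideal.Quotient.lift (Ideal.span {φ}) (aeval (zBlock z φ) : K[X] →ₐ[K] _).toRingHom (by
    intro p hp
    obtain ⟨q, rfl⟩ := Ideal.mem_span_singleton'.1 hp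
    ext v
    have hv : aeval (z : Module.End K V) φ (v : V) = 0 := v.2
    change ((aeval (zBlock z φ) (q * φ) v : block z φ) : V) = 0
    rw [coe_aeval_zBlock, map_mul, Module.End.mul_apply, hv, map_zero])

/-- `U_φ` as a vector space over the field `K[X]/(φ)` (`φ` irreducible). -/
noncomputable instance blockModule (z : V ≃ₗ[K] V) (φ : K[X]) :
    Module (AdjoinRoot φ) (block z φ) :=
  Module.compHom (block z φ) (blockAction z φ)

theorem mk_smul_coe (z : V ≃ₗ[K] V) (φ p : K[X]) (v : block z φ) :
    ((AdjoinRoot.mk φ p • v : block z φ) : V) = aeval (z : Module.End K V) p v :=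
  coe_aeval_zBlock z φ p v

instance blockIsScalarTower (z : V ≃ₗ[K] V) (φ : K[X]) :
    IsScalarTower K (AdjoinRoot φ) (block z φ) where
  smul_assoc c a v := by
    obtain ⟨p, rfl⟩ := AdjoinRoot.mk_surjective a
    ext
    rw [AdjoinRoot.smul_mk, mk_smul_coe, Submodule.coe_smul, mk_smul_coe]
    simp

instance blockFinite [Module.Finite K V] (z : V ≃ₗ[K] V) (φ : K[X]) :
    Module.Finite (AdjoinRoot φ) (block z φ) :=
  Module.Finite.of_restrictScalars_finite K (AdjoinRoot φ) (block z φ)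

theorem commute_of_mem_centralizer {B : LinearMap.BilinForm K V} {ζ : Sp B}
    (g : Subgroup.centralizer {ζ}) :
    Commute (((g : Sp B) : V ≃ₗ[K] V) : Module.End K V) ((ζ : V ≃ₗ[K] V) : Module.End K V) := by
  have h : ζ * (g : Sp B) = g * ζ := Subgroup.mem_centralizer_iff.1 g.2 ζ rfl
  ext v
  exact (LinearEquiv.congr_fun (congrArg Subtype.val h) v).symm

/-- An element of the centraliser of `ζ` restricts to a `K[X]/(φ)`-linear map of `U_φ`. -/
noncomputable def restrictLin {B : LinearMap.BilinForm K V} (ζ : Sp B) (φ : K[X])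
    (g : Subgroup.centralizer {ζ}) :
    block (ζ : V ≃ₗ[K] V) φ →ₗ[AdjoinRoot φ] block (ζ : V ≃ₗ[K] V) φ where
  toFun v := ⟨((g : Sp B) : V ≃ₗ[K] V) v,
    mem_block_of_commute _ φ (commute_of_mem_centralizer g) v v.2⟩
  map_add' v w := by ext; simp
  map_smul' a v := by
    obtain ⟨p, rfl⟩ := AdjoinRoot.mk_surjective a
    ext
    simp only [RingHom.id_apply, mk_smul_coe]
    exact LinearMap.congr_fun (commute_aeval (commute_of_mem_centralizer g) p).eq (v : V)

/-- The projection `C_{Sp(V, B)}(ζ) → GL(U_φ)` given by restriction to `U_φ`, where `U_φ` is viewed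
as a vector space over `K[X]/(φ)`. -/
noncomputable def proj {B : LinearMap.BilinForm K V} (ζ : Sp B) (φ : K[X]) :
    Subgroup.centralizer {ζ} →*
      (block (ζ : V ≃ₗ[K] V) φ ≃ₗ[AdjoinRoot φ] block (ζ : V ≃ₗ[K] V) φ) where
  toFun g := LinearEquiv.ofLinearMap (restrictLin ζ φ g) (restrictLin ζ φ g⁻¹)
    (by ext v; exact LinearEquiv.congr_fun
          (mul_inv_cancel (((g : Sp B) : V ≃ₗ[K] V))) (v : V))
    (by ext v; exact LinearEquiv.congr_fun
          (inv_mul_cancel (((g : Sp B) : V ≃ₗ[K] V))) (v : V))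
  map_one' := rfl
  map_mul' _ _ := rfl

theorem proj_apply_coe {B : LinearMap.BilinForm K V} (ζ : Sp B) (φ : K[X])
    (g : Subgroup.centralizer {ζ}) (v : block (ζ : V ≃ₗ[K] V) φ) :
    (proj ζ φ g v : V) = ((g : Sp B) : V ≃ₗ[K] V) v := rfl

end General

section Unitary

variable {K : Type*} [Field K] [Finite K] {V : Type*} [AddCommGroup V] [Module K V]

instance adjoinRootFinite (φ : K[X]) [Fact (Irreducible φ)] : Module.Finite K (AdjoinRoot φ) :=
  (AdjoinRoot.powerBasis (Fact.out : Irreducible φ).ne_zero).finite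

/-- The form `h : U_φ × U_φ → F`, `F = K[X]/(φ)`, determined by
`Tr_{F/K} (h(v, w) a) = B(a v, w)` for all `a ∈ F`; in particular `B = Tr_{F/K} ∘ h` on `U_φ`.
When `B` is symplectic, `z` is an isometry of `B` and the roots of `φ` are permuted by inversion
(but not fixed), `h` is `F`-linear in `v`, conjugate-linear in `w`, and skew-hermitian for the
involution of `F` that inverts the class of `X`. For `μ ≠ 0` with conjugate `-μ` the form `μ h` is
hermitian and has the same isometry group as `h`. -/
noncomputable def blockForm (B : LinearMap.BilinForm K V) (z : V ≃ₗ[K] V) (φ : K[X])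
    [Fact (Irreducible φ)] (v w : block z φ) : AdjoinRoot φ :=
  ((Algebra.traceForm K (AdjoinRoot φ)).toDual (traceForm_nondegenerate K (AdjoinRoot φ))).symm
    { toFun := fun a => B ((a • v : block z φ) : V) (w : V)
      map_add' := fun a b => by simp [add_smul]
      map_smul' := fun c a => by simp }

theorem trace_blockForm_mul (B : LinearMap.BilinForm K V) (z : V ≃ₗ[K] V) (φ : K[X])
    [Fact (Irreducible φ)] (v w : block z φ) (a : AdjoinRoot φ) :
    Algebra.trace K (AdjoinRoot φ) (blockForm B z φ v w * a) =
      B ((a • v : block z φ) : V) (w : V) :=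
  LinearMap.BilinForm.apply_toDual_symm_apply
    (hB := traceForm_nondegenerate K (AdjoinRoot φ)) _ a

/-- The unitary group `GU(U_φ, h)`: the `K[X]/(φ)`-linear isometries of `h`. -/
noncomputable def unitaryBlockGroup (B : LinearMap.BilinForm K V) (z : V ≃ₗ[K] V) (φ : K[X])
    [Fact (Irreducible φ)] : Subgroup (block z φ ≃ₗ[AdjoinRoot φ] block z φ) where
  carrier := {g | ∀ v w, blockForm B z φ (g v) (g w) = blockForm B z φ v w}
  one_mem' := fun _ _ => rfl
  mul_mem' := fun {a b} ha hb v w => (ha (b v) (b w)).trans (hb v w)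
  inv_mem' := fun {a} ha v w => by
    have h := ha (a⁻¹ v) (a⁻¹ w)
    rw [← LinearEquiv.mul_apply, ← LinearEquiv.mul_apply, mul_inv_cancel] at h
    exact h.symm

end Unitary

/-- The least `i ≥ 1` such that `ℓ ^ i ≡ 1 (mod r)`, i.e. the inertia degree of `ℓ` in `ℚ(ζ_r)`. -/
noncomputable def inertiaDeg (r ℓ : ℕ) : ℕ := orderOf (ℓ : ZMod r)

/-- The factor `G_j` of the centraliser belonging to `φ = φ_j`: the general linear group
`GL(U_φ) ≅ GL_n(ℓ^i)` if `i` is odd, the unitary group `GU(U_φ, h) ≅ GU_n(ℓ^{i/2})` if `i` is even. -/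
noncomputable def factorGroup (r : ℕ) {ℓ : ℕ} [Fact ℓ.Prime] {V : Type*} [AddCommGroup V]
    [Module (ZMod ℓ) V] (B : LinearMap.BilinForm (ZMod ℓ) V) (z : V ≃ₗ[ZMod ℓ] V)
    (φ : (ZMod ℓ)[X]) [Fact (Irreducible φ)] :
    Subgroup (block z φ ≃ₗ[AdjoinRoot φ] block z φ) :=
  if Odd (inertiaDeg r ℓ) then ⊤ else unitaryBlockGroup B z φ

/-- The commutator subgroup `S_j` of `G_j`. -/
noncomputable def factorCommutator (r : ℕ) {ℓ : ℕ} [Fact ℓ.Prime] {V : Type*} [AddCommGroup V]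
    [Module (ZMod ℓ) V] (B : LinearMap.BilinForm (ZMod ℓ) V) (z : V ≃ₗ[ZMod ℓ] V)
    (φ : (ZMod ℓ)[X]) [Fact (Irreducible φ)] :
    Subgroup (block z φ ≃ₗ[AdjoinRoot φ] block z φ) :=
  ⁅factorGroup r B z φ, factorGroup r B z φ⁆

end SympCentraliser

set_option linter.unusedSectionVars false

/-! The argument is a Goursat argument driven by the eigenvalues of `τ`. Since `τ` need not be
semisimple, it is first replaced by a power `τ ^ ℓ ^ e` with `ℓ ^ e ≥ n - 1` and `ℓ ^ e ≡ 1` modulo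
`r`; this kills the unipotent part, keeps every `α_j`, and makes each projection a homology
(`isHomology_pow`).

For a set `A` of indices, the image in `G_j` of the elements of `H` that are trivial on all factors
in `A` is normalised by `S_j` and by the homology. Such a subgroup is either scalar or contains
`S_j`. This is proved by transvections for `GL_n` (`isHomologyFactor_commutator`) and by
quasi-reflections for `GU_n` (`IsHermitian.isHomologyFactor_unitaryGroup`).

Suppose that for `j ≠ k` the elements trivial on `U_k` act on `U_j` by scalars. Then the same holds
with `j` and `k` exchanged, so the two images of `H` are isomorphic modulo scalars. A root subgroup
of `S_j`, on which a product `t` of two commuting conjugate homologies acts as multiplication by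
`α_j`, is transported to an elementary abelian unipotent group on `U_k`. There `t` has only the
eigenvalues `1` and `α_k`, so conjugation by `t` has only ratios of these as eigenvalues. Hence
`α_k` or its inverse is conjugate to `α_j` over the prime field (`root_minpoly_of_unipotent`).

This contradicts the characteristic polynomial of `τ` on `V`, in which each primitive `r`-th root of
unity is a simple root: `U_j` already exhausts the kernel of the minimal polynomial of `α_j` at `τ`,
while `U_k` and its dual block would contribute further vectors (`aeval_minpoly_ne_zero`). So any
two factors are independent, and commutators upgrade pairwise independence to full independence
(`exists_of_isHomologyFactor`). -/

namespace SympCentraliser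

/-! ### Homotheties and homologies. -/

section Homology

variable {F U : Type*} [Field F] [AddCommGroup U] [Module F U]

/-- `x` acts as a scalar. -/
def IsHomothety (x : U ≃ₗ[F] U) : Prop := ∃ z : F, ∀ v, x v = z • v

/-- `a` is a homology with nontrivial eigenvalue `α`: it fixes a hyperplane pointwise and multiplies
a complementary vector by `α`. -/
def IsHomology (α : F) (a : U ≃ₗ[F] U) : Prop :=
  ∃ (f : Module.Dual F U) (p : U), f p = α - 1 ∧ ∀ x, a x = x + f x • p

theorem IsHomothety.commute {x : U ≃ₗ[F] U} (hx : IsHomothety x) (y : U ≃ₗ[F] U) :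
    Commute x y := by
  obtain ⟨z, hz⟩ := hx
  ext v
  simp [LinearEquiv.mul_apply, hz]

theorem IsHomothety.eq_one_of_apply_eq {x : U ≃ₗ[F] U} (hx : IsHomothety x) {v : U} (hv : v ≠ 0)
    (h : x v = v) : x = 1 := by
  obtain ⟨z, hz⟩ := hx
  have h1 : (z - 1) • v = 0 := by rw [sub_smul, one_smul, ← hz, h, sub_self]
  have h2 : z = 1 := by
    rcases smul_eq_zero.1 h1 with h2 | h2
    · exact sub_eq_zero.1 h2
    · exact absurd h2 hv
  ext w
  rw [hz, h2, one_smul, LinearEquiv.coe_one, id]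

theorem ne_zero_of_dual_apply_eq {α : F} {f : Module.Dual F U} {p : U} (hα : α ≠ 1)
    (hf : f p = α - 1) : p ≠ 0 := by
  rintro rfl
  rw [map_zero] at hf
  exact hα (sub_eq_zero.1 hf.symm)

theorem IsHomology.conj {α : F} {a : U ≃ₗ[F] U} (ha : IsHomology α a) (g : U ≃ₗ[F] U) :
    IsHomology α (g * a * g⁻¹) := by
  obtain ⟨f, p, hf, ha⟩ := ha
  refine ⟨f.comp (g⁻¹ : U ≃ₗ[F] U).toLinearMap, g p, ?_, fun x => ?_⟩
  · have : (g⁻¹ : U ≃ₗ[F] U) (g p) = p := by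
      rw [← LinearEquiv.mul_apply, inv_mul_cancel]; rfl
    simp [hf]
  · have : g ((g⁻¹ : U ≃ₗ[F] U) x) = x := by
      rw [← LinearEquiv.mul_apply, mul_inv_cancel]; rfl
    simp only [LinearEquiv.mul_apply, ha, map_add, map_smul, this]
    rfl

theorem exists_ne_zero_of_two_duals [Module.Finite F U] (hU : 3 ≤ Module.finrank F U)
    (f g : Module.Dual F U) : ∃ v, v ≠ 0 ∧ f v = 0 ∧ g v = 0 := by
  have h : LinearMap.ker (f.prod g) ≠ ⊥ := by
    apply LinearMap.ker_ne_bot_of_finrank_lt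
    simp only [Module.finrank_prod, Module.finrank_self]
    omega
  obtain ⟨v, hv, hv0⟩ := Submodule.exists_mem_ne_zero_of_ne_bot h
  exact ⟨v, hv0, congrArg Prod.fst hv, congrArg Prod.snd hv⟩

/-- In dimension at least three the two fixed hyperplanes share a nonzero vector. The commutator
fixes it, so a scalar commutator is trivial. -/
theorem IsHomology.commute_of_isHomothety [Module.Finite F U] (hU : 3 ≤ Module.finrank F U)
    {α β : F} {a b : U ≃ₗ[F] U} (ha : IsHomology α a) (hb : IsHomology β b)
    (h : IsHomothety (a * b * a⁻¹ * b⁻¹)) : Commute a b := by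
  obtain ⟨f, p, -, ha⟩ := ha
  obtain ⟨f', p', -, hb⟩ := hb
  obtain ⟨v, hv0, hv, hv'⟩ := exists_ne_zero_of_two_duals hU f f'
  have hav : a v = v := by simp [ha, hv]
  have hbv : b v = v := by simp [hb, hv']
  have inv_fix : ∀ c : U ≃ₗ[F] U, c v = v → c⁻¹ v = v := fun c hc => by
    conv_lhs => rw [← hc]
    rw [← LinearEquiv.mul_apply, inv_mul_cancel]; rfl
  have h1 := h.eq_one_of_apply_eq hv0 (by
    simp only [LinearEquiv.mul_apply, inv_fix a hav, inv_fix b hbv, hav, hbv])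
  exact mul_inv_eq_iff_eq_mul.1 (mul_inv_eq_one.1 h1)

/-- The product of two distinct commuting homologies satisfies the same quadratic equation as the
homologies themselves. -/
theorem IsHomology.mul_quadratic {α : F} (hα : α ≠ 1) {a b : U ≃ₗ[F] U} (ha : IsHomology α a)
    (hb : IsHomology α b) (hab : Commute a b) (hne : a ≠ b) (x : U) :
    (a * b) ((a * b) x) - (1 + α) • (a * b) x + α • x = 0 := by
  obtain ⟨f, p, hf, ha'⟩ := ha
  obtain ⟨f', p', hf', hb'⟩ := hb
  have hp : p ≠ 0 := ne_zero_of_dual_apply_eq hα hf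
  have hp' : p' ≠ 0 := ne_zero_of_dual_apply_eq hα hf'
  have hα0 : α - 1 ≠ 0 := sub_ne_zero.2 hα
  have hcomm : ∀ y, (f' y * f p') • p = (f y * f' p) • p' := fun y => by
    have h := LinearEquiv.congr_fun hab.eq y
    simp only [LinearEquiv.mul_apply, ha', hb', map_add, map_smul, smul_eq_mul, add_smul] at h
    have h2 : y + f' y • p' + (f y • p + (f' y * f p') • p) - (y + f y • p + f' y • p') =
      y + f y • p + (f' y • p' + (f y * f' p) • p') - (y + f y • p + f' y • p') := by rw [h]
    have e1 : y + f' y • p' + (f y • p + (f' y * f p') • p) - (y + f y • p + f' y • p') =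
      (f' y * f p') • p := by abel
    have e2 : y + f y • p + (f' y • p' + (f y * f' p) • p') - (y + f y • p + f' y • p') =
      (f y * f' p) • p' := by abel
    rw [← e1, h2, e2]
  -- If `f p' ≠ 0`, then `hcomm` makes `p` and `p'` proportional and `f`, `f'` inversely so, which
  -- gives `a = b`.
  have h0 : f p' = 0 := by
    by_contra hne0
    apply hne
    obtain ⟨c, hc⟩ : ∃ c : F, p = c • p' := by
      refine ⟨(f' p' * f p')⁻¹ * (f p' * f' p), ?_⟩
      rw [mul_smul, ← hcomm p', smul_smul, inv_mul_cancel₀, one_smul]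
      exact mul_ne_zero (hf' ▸ hα0) hne0
    have hfc : c * f p' = α - 1 := by rw [← hf, hc, map_smul, smul_eq_mul]
    have hfc' : f' p = c * (α - 1) := by rw [hc, map_smul, smul_eq_mul, hf']
    ext y
    rw [ha', hb']
    have h1 := hcomm y
    rw [hfc', hc, smul_smul] at h1
    have h2 := smul_left_injective F hp' h1
    have h3 : f' y = f y * c := by
      apply mul_right_cancel₀ hα0
      have h2' : f' y * f p' * c = f y * (c * (α - 1)) := h2
      rw [← hfc, ← mul_assoc, ← mul_assoc]
      rw [← hfc] at h2'
      linear_combination h2'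
    rw [h3, hc, smul_smul]
  have h0' : f' p = 0 := by
    have h1 := hcomm p
    rw [h0, mul_zero, zero_smul, hf] at h1
    rcases smul_eq_zero.1 h1.symm with h2 | h2
    · exact (mul_eq_zero.1 h2).resolve_left hα0
    · exact absurd h2 hp'
  simp only [LinearEquiv.mul_apply, ha', hb', map_add, map_smul, h0, h0', hf, hf', smul_eq_mul,
    mul_zero, add_zero]
  module

end Homology

/-! ### Eigenvalues of conjugation on a unipotent group. -/

section Transfer

variable {ℓ : ℕ} [Fact ℓ.Prime] {F₁ F U : Type*} [Field F₁] [Algebra (ZMod ℓ) F₁] [Field F]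
  [Algebra (ZMod ℓ) F] [AddCommGroup U] [Module F U]

/-- Iterating gives `w (p(α) c) = p(β) • w c` for every polynomial `p` over the prime field; take
`p` to be the minimal polynomial of `α`. -/
theorem root_minpoly_of_semilinear {α : F₁} {β : F} (w : F₁ →+ U) (hw : w ≠ 0)
    (h : ∀ c, w (α * c) = β • w c) : aeval β (minpoly (ZMod ℓ) α) = 0 := by
  have hk : ∀ (k : ZMod ℓ) (c : F₁), w (algebraMap _ F₁ k * c) = algebraMap _ F k • w c := by
    intro k c
    obtain ⟨m, rfl⟩ := ZMod.natCast_zmod_surjective k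
    rw [map_natCast, map_natCast, ← nsmul_eq_mul, map_nsmul, Nat.cast_smul_eq_nsmul]
  have key : ∀ (p : (ZMod ℓ)[X]) (c : F₁), w (aeval α p * c) = aeval β p • w c := by
    intro p
    induction p using Polynomial.induction_on' with
    | add p q hp hq => intro c; rw [map_add, add_mul, map_add, hp, hq, map_add, add_smul]
    | monomial n k =>
      have hn : ∀ (m : ℕ) (c : F₁), w (α ^ m * c) = β ^ m • w c := by
        intro m
        induction m with
        | zero => intro c; simp
        | succ m ih => intro c; rw [pow_succ, mul_assoc, ih, h, smul_smul, pow_succ]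
      intro c
      rw [aeval_monomial, aeval_monomial, mul_assoc, hk, hn, smul_smul]
  obtain ⟨c, hc⟩ : ∃ c, w c ≠ 0 := by
    by_contra! hcon
    exact hw (AddMonoidHom.ext hcon)
  have h1 := key (minpoly (ZMod ℓ) α) c
  rw [minpoly.aeval, zero_mul, map_zero] at h1
  exact (smul_eq_zero.1 h1.symm).resolve_right hc

/-- Commuting nilpotent operators on the nonzero quotient `W / W₁` have a common nonzero kernel
vector. -/
theorem exists_apply_mem_of_commuting {ι R W : Type*} [Ring R] [AddCommGroup W] [Module R W]
    [Finite ι] (X : ι → Module.End R W) (hX : ∀ i j, Commute (X i) (X j)) (W₁ : Submodule R W)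
    (hW₁ : ∀ i, ∀ v ∈ W₁, X i v ∈ W₁) (hnil : ∀ i, IsNilpotent (X i)) (h : W₁ ≠ ⊤) :
    ∃ v ∉ W₁, ∀ i, X i v ∈ W₁ := by
  classical
  cases nonempty_fintype ι
  suffices h : ∀ T : Finset ι, ∃ v ∉ W₁, ∀ i ∈ T, X i v ∈ W₁ by
    obtain ⟨v, hv, hT⟩ := h Finset.univ
    exact ⟨v, hv, fun i => hT i (Finset.mem_univ i)⟩
  intro T
  induction T using Finset.induction_on with
  | empty =>
    obtain ⟨v, -, hv⟩ := SetLike.exists_of_lt (lt_top_iff_ne_top.2 h)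
    exact ⟨v, hv, by simp⟩
  | insert i T _ ih =>
    obtain ⟨v, hv, hT⟩ := ih
    obtain ⟨N, hN⟩ := hnil i
    have hex : ∃ k, (X i ^ k) v ∈ W₁ := ⟨N, by rw [hN]; exact W₁.zero_mem⟩
    -- `X i ^ m` is the last power that keeps `v` outside `W₁`. The operators treated earlier still
    -- send the new vector into `W₁`, because they commute with `X i`.
    obtain ⟨m, hm⟩ : ∃ m, Nat.find hex = m + 1 := by
      refine Nat.exists_eq_succ_of_ne_zero fun h0 => hv ?_
      have := Nat.find_spec hex
      rwa [h0] at this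
    refine ⟨(X i ^ m) v, fun hmem => Nat.find_min hex (m := m) (by omega) hmem, ?_⟩
    intro j hj
    rw [Finset.mem_insert] at hj
    rcases hj with rfl | hj
    · have := Nat.find_spec hex
      rwa [hm, pow_succ'] at this
    · have h1 : X j ((X i ^ m) v) = (X i ^ m) (X j v) :=
        LinearMap.congr_fun ((hX j i).pow_right m).eq v
      rw [h1]
      have : ∀ k, (X i ^ k) (X j v) ∈ W₁ := by
        intro k
        induction k with
        | zero => exact hT j hj
        | succ k ih => rw [pow_succ']; exact hW₁ i _ ih
      exact this m

/-- An elementary abelian group of unipotent maps that is normalised by `t`, where `t` has only the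
eigenvalues `1` and `β`, and on which `t` acts like multiplication by `α` on `F₁`: the eigenvalues
of `t` on it are ratios of eigenvalues of `t`. -/
theorem root_minpoly_of_unipotent [Finite F₁] {α : F₁} {β : F} (hα : α ≠ 1) (hβ : β ≠ 1)
    (hβ0 : β ≠ 0) (t : U ≃ₗ[F] U) (ht : ∀ x, t (t x) - (1 + β) • t x + β • x = 0)
    (u : F₁ → U ≃ₗ[F] U) (hadd : ∀ c d, u (c + d) = u c * u d) (hpow : ∀ c, u c ^ ℓ = 1)
    (hconj : ∀ c, t * u c * t⁻¹ = u (α * c)) (hne : ∃ c, u c ≠ 1) :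
    aeval β (minpoly (ZMod ℓ) α) = 0 ∨ aeval β⁻¹ (minpoly (ZMod ℓ) α) = 0 := by
  have hconj' : ∀ c v, t (u c v) = u (α * c) (t v) := fun c v => by
    rw [← hconj]
    simp only [LinearEquiv.mul_apply]
    congr 2
    rw [← LinearEquiv.mul_apply, inv_mul_cancel]; rfl
  have hucomm : ∀ c d, Commute (u c) (u d) := fun c d => by
    rw [Commute, SemiconjBy, ← hadd, ← hadd, add_comm]
  let X : F₁ → Module.End F U := fun c => (u c : Module.End F U) - 1
  have hXapp : ∀ c v, X c v = u c v - v := fun c v => rfl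
  have hXcomm : ∀ c d, Commute (X c) (X d) := fun c d => by
    have h1 : Commute (u c : Module.End F U) (u d : Module.End F U) :=
      LinearMap.ext fun v => LinearEquiv.congr_fun (hucomm c d).eq v
    exact (h1.sub_left (Commute.one_left _)).sub_right (Commute.one_right _)
  have : CharP F ℓ := charP_of_injective_algebraMap (algebraMap (ZMod ℓ) F).injective ℓ
  have hnil : ∀ c, IsNilpotent (X c) := by
    intro c
    refine ⟨ℓ, ?_⟩
    have hc : ∀ m : ℕ, ((u c : Module.End F U)) ^ m = ((u c ^ m : U ≃ₗ[F] U) : Module.End F U) := by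
      intro m
      induction m with
      | zero => rfl
      | succ m ih => rw [pow_succ, pow_succ, ih]; rfl
    have : ExpChar F ℓ := ExpChar.prime Fact.out
    have h2 : ((Polynomial.X : F[X]) - 1) ^ ℓ = Polynomial.X ^ ℓ - 1 := by
      rw [sub_pow_char, one_pow]
    have h3 := congrArg (aeval (u c : Module.End F U)) h2
    simp only [map_pow, map_sub, map_one, aeval_X] at h3
    rw [h3, hc, hpow]
    exact sub_self _
  -- `W₁` is the space of common fixed vectors, and `W₂` below is the next layer, which all `X c`
  -- send into `W₁`. Both are stable under `t`, and `W₂` is strictly larger than `W₁`.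
  let W₁ : Submodule F U := ⨅ c, LinearMap.ker (X c)
  have hmem : ∀ v, v ∈ W₁ ↔ ∀ c, X c v = 0 := fun v => by simp [W₁, Submodule.mem_iInf]
  have hW₁ : ∀ c, ∀ v ∈ W₁, X c v ∈ W₁ := fun c v hv => by
    rw [(hmem v).1 hv c]; exact W₁.zero_mem
  have hα0 : α ≠ 0 := by
    rintro rfl
    obtain ⟨c, hc⟩ := hne
    have h0 : u 0 = 1 := by
      have := hadd 0 0
      rwa [add_zero, left_eq_mul] at this
    have := hconj c
    rw [zero_mul, h0] at this
    exact hc (conj_eq_one_iff.1 this)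
  have ht1 : ∀ v, v ∈ W₁ → t v ∈ W₁ := fun v hv => by
    rw [hmem] at hv ⊢
    intro c
    have h1 : t (X (α⁻¹ * c) v) = X c (t v) := by
      rw [hXapp, map_sub, hconj', mul_inv_cancel_left₀ hα0, hXapp]
    rw [← h1, hv, map_zero]
  have hWtop : W₁ ≠ ⊤ := fun htop => by
    obtain ⟨c, hc⟩ := hne
    apply hc
    ext v
    have : v ∈ W₁ := htop ▸ Submodule.mem_top
    exact sub_eq_zero.1 ((hmem v).1 this c)
  obtain ⟨v, hv, hvX⟩ := exists_apply_mem_of_commuting X hXcomm W₁ hW₁ hnil hWtop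
  -- eigenvectors
  let W₂ : Submodule F U := ⨅ c, W₁.comap (X c)
  have hmem₂ : ∀ v, v ∈ W₂ ↔ ∀ c, X c v ∈ W₁ := fun v => by simp [W₂, Submodule.mem_iInf]
  have ht2 : ∀ v, v ∈ W₂ → t v ∈ W₂ := fun v hv => by
    rw [hmem₂] at hv ⊢
    intro c
    have h1 : t (X (α⁻¹ * c) v) = X c (t v) := by
      rw [hXapp, map_sub, hconj', mul_inv_cancel_left₀ hα0, hXapp]
    rw [← h1]
    exact ht1 _ (hv _)
  have hv2 : v ∈ W₂ := (hmem₂ v).2 hvX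
  -- the eigenvector step
  have step : ∀ (μ : F) (x : U), x ∈ W₂ → x ∉ W₁ → t x = μ • x →
      ∃ w : F₁ →+ U, w ≠ 0 ∧ ∀ c, t (w c) = μ • w (α * c) := by
    intro μ x hx2 hx1 hxt
    have hx2' := (hmem₂ x).1 hx2
    refine ⟨AddMonoidHom.mk' (fun c => X c x) ?_, ?_, ?_⟩
    · intro c d
      -- On `W₂` the products `X c * X d` vanish, so `c ↦ X c x` is additive.
      have h1 := (hmem _).1 (hx2' d) c
      rw [hXapp, hXapp, map_sub] at h1
      rw [hXapp, hXapp, hXapp, hadd, LinearEquiv.mul_apply]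
      have h2 : u c (u d x) = u c x + (u d x - x) := by
        rw [← sub_eq_zero, ← h1]; abel
      rw [h2]; abel
    · intro h0
      exact hx1 ((hmem x).2 fun c => DFunLike.congr_fun h0 c)
    · intro c
      change t (X c x) = μ • X (α * c) x
      rw [hXapp, map_sub, hconj', hxt, map_smul, hXapp, smul_sub]
  -- consequences of a semi-linear map
  have concl : ∀ (γ : F) (w : F₁ →+ U), w ≠ 0 →
      (∀ c, w (α * (α * c)) - (γ + 1) • w (α * c) + γ • w c = 0) →
      aeval γ (minpoly (ZMod ℓ) α) = 0 := by
    intro γ w hw0 hq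
    -- With `A` for multiplication by `α` on `F₁`, the hypothesis reads `(A - γ)(A - 1) w = 0`.
    -- Since `α ≠ 1`, every element of `F₁` is a multiple of `α - 1`, and the second factor can be
    -- cancelled.
    refine root_minpoly_of_semilinear w hw0 fun c => ?_
    have hfix : ∀ c, w (α * (α * c)) - γ • w (α * c) = w (α * c) - γ • w c := fun c => by
      rw [← sub_eq_zero, ← hq c]; module
    have h1 : ∀ c, w (α * ((α - 1) * c)) - γ • w ((α - 1) * c) = 0 := fun c => by
      have : α * ((α - 1) * c) = α * (α * c) - α * c := by ring
      rw [this, map_sub]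
      have : (α - 1) * c = α * c - c := by ring
      rw [this, map_sub, smul_sub, ← sub_eq_zero.2 (hfix c)]
      abel
    have h2 := h1 ((α - 1)⁻¹ * c)
    rw [mul_inv_cancel_left₀ (sub_ne_zero.2 hα)] at h2
    exact sub_eq_zero.1 h2
  -- As `(t - 1)(t - β) = 0`, the vectors `t v - v` and `t v - β v` satisfy the eigenvector
  -- equations for `β` and `1`. Their difference is `(β - 1) v`, so they cannot both lie in `W₁`.
  -- The two cases produce the ratios `β⁻¹` and `β`.
  by_cases hA : t v - β • v ∈ W₁
  · right
    have hx1 : t v - v ∉ W₁ := fun h => hv (by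
      have h2 := W₁.sub_mem h hA
      have h3 : t v - v - (t v - β • v) = (β - 1) • v := by module
      rw [h3] at h2
      exact (W₁.smul_mem_iff (sub_ne_zero.2 hβ)).1 h2)
    obtain ⟨w, hw0, hw⟩ := step β (t v - v) (W₂.sub_mem (ht2 v hv2) hv2) hx1 (by
      rw [map_sub, ← sub_eq_zero, ← ht v]; module)
    refine concl β⁻¹ w hw0 fun c => ?_
    have h1 := ht (w c)
    rw [hw, map_smul, hw] at h1
    have h2 : (β * β) • (w (α * (α * c)) - (β⁻¹ + 1) • w (α * c) + β⁻¹ • w c) = 0 := by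
      rw [smul_add, smul_sub, smul_smul, smul_smul, ← h1]
      have e1 : β * β * (β⁻¹ + 1) = (1 + β) * β := by field_simp
      have e2 : β * β * β⁻¹ = β := by field_simp
      rw [e1, e2]; module
    exact (smul_eq_zero.1 h2).resolve_left (mul_ne_zero hβ0 hβ0)
  · left
    obtain ⟨w, hw0, hw⟩ := step 1 (t v - β • v)
      (W₂.sub_mem (ht2 v hv2) (W₂.smul_mem _ hv2)) hA (by
      rw [map_sub, map_smul, ← sub_eq_zero, ← ht v]; module)
    refine concl β w hw0 fun c => ?_
    have h1 := ht (w c)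
    rw [hw, one_smul, hw, one_smul] at h1
    rw [add_comm β 1, h1]

end Transfer

/-! ### What is needed of a single factor. -/

section Factor

variable {F U : Type*} [Field F] [AddCommGroup U] [Module F U]

/-- The properties of a classical group `G` and a homology `a` in it that are used in the
proof that subdirect products are full: the normal subgroup theorem, non-commutativity, and a root
subgroup `u` on which a product `t` of two conjugates of `a` acts by multiplication by `α`. -/
structure IsHomologyFactor (G : Subgroup (U ≃ₗ[F] U)) (a : U ≃ₗ[F] U) (α : F) : Prop where
  le_of_normalized : ∀ N ≤ G, (∀ s ∈ ⁅G, G⁆, ∀ x ∈ N, s * x * s⁻¹ ∈ N) →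
    (∀ x ∈ N, a * x * a⁻¹ ∈ N) → (∃ x ∈ N, ¬ IsHomothety x) → ⁅G, G⁆ ≤ N
  exists_commutator : ∃ x ∈ ⁅G, G⁆, ∃ y ∈ ⁅G, G⁆, ¬ IsHomothety (x * y * x⁻¹ * y⁻¹)
  -- The two non-scalarity clauses survive passage to another factor modulo scalars: the first keeps
  -- the two homologies distinct there, the second keeps the transported root group nontrivial.
  exists_root : ∃ g ∈ ⁅G, G⁆, ∃ u : F → U ≃ₗ[F] U, (∀ c, u c ∈ ⁅G, G⁆) ∧
    (∀ c d, u (c + d) = u c * u d) ∧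
    Commute a (g * a * g⁻¹) ∧ ¬ IsHomothety (a * (g * a * g⁻¹)⁻¹) ∧
    (∀ c, a * (g * a * g⁻¹) * u c * (a * (g * a * g⁻¹))⁻¹ = u (α * c)) ∧
    ∃ c, ¬ IsHomothety (u (α * c) * (u c)⁻¹)

theorem map_one_of_add {u : F → U ≃ₗ[F] U} (h : ∀ c d, u (c + d) = u c * u d) : u 0 = 1 := by
  have := h 0 0
  rwa [add_zero, left_eq_mul] at this

theorem map_pow_of_add {u : F → U ≃ₗ[F] U} (h : ∀ c d, u (c + d) = u c * u d) (m : ℕ) (c : F) :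
    u c ^ m = u (m * c) := by
  induction m with
  | zero => simp [map_one_of_add h]
  | succ m ih => rw [pow_succ, ih, ← h]; push_cast; ring_nf

theorem IsHomothety.pow_apply {x : U ≃ₗ[F] U} {z : F} (h : ∀ v, x v = z • v) (m : ℕ) (v : U) :
    (x ^ m) v = z ^ m • v := by
  induction m with
  | zero => simp
  | succ m ih => rw [pow_succ', LinearEquiv.mul_apply, ih, map_smul, h, smul_smul, pow_succ]

/-- In characteristic `ℓ`, `z ^ ℓ = 1` means `(z - 1) ^ ℓ = 0`. This makes lifts of order dividing
`ℓ` unique modulo scalars. -/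
theorem IsHomothety.eq_one_of_pow_char [Nontrivial U] {ℓ : ℕ} [Fact ℓ.Prime] [CharP F ℓ]
    {x : U ≃ₗ[F] U} (hx : IsHomothety x) (h : x ^ ℓ = 1) : x = 1 := by
  obtain ⟨z, hz⟩ := hx
  obtain ⟨v, hv⟩ := exists_ne (0 : U)
  have h1 := IsHomothety.pow_apply hz ℓ v
  rw [h, LinearEquiv.coe_one, id] at h1
  have h2 : (z ^ ℓ - 1) • v = 0 := by rw [sub_smul, ← h1, one_smul, sub_self]
  have h3 := (smul_eq_zero.1 h2).resolve_right hv
  have : ExpChar F ℓ := ExpChar.prime Fact.out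
  have h4 : (z - 1) ^ ℓ = 0 := by rw [sub_pow_char, one_pow, h3]
  have h5 : z = 1 := sub_eq_zero.1 (pow_eq_zero_iff (Fact.out : ℓ.Prime).ne_zero |>.1 h4)
  ext w
  rw [hz, h5, one_smul]; rfl

theorem IsHomothety.pow_card_sub_one [Finite F] [Nontrivial U] {x : U ≃ₗ[F] U}
    (hx : IsHomothety x) : x ^ (Nat.card F - 1) = 1 := by
  have := Fintype.ofFinite F
  obtain ⟨z, hz⟩ := hx
  have hz0 : z ≠ 0 := by
    rintro rfl
    obtain ⟨v, hv⟩ := exists_ne (0 : U)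
    have := hz v
    rw [zero_smul] at this
    exact hv ((LinearEquiv.map_eq_zero_iff x).1 this)
  ext v
  rw [IsHomothety.pow_apply hz, Nat.card_eq_fintype_card, FiniteField.pow_card_sub_one_eq_one z hz0,
    one_smul]; rfl

end Factor

/-! ### The Goursat argument. -/

section Goursat

variable {ℓ : ℕ} [Fact ℓ.Prime] {ι H : Type*} [Group H] {F U : ι → Type*} [∀ j, Field (F j)]
  [∀ j, Finite (F j)] [∀ j, Algebra (ZMod ℓ) (F j)] [∀ j, AddCommGroup (U j)]
  [∀ j, Module (F j) (U j)] [∀ j, Module.Finite (F j) (U j)]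

/-- The elements `π_j(x)` with `x ∈ H` in the kernels of all `π_k`, `k ∈ A`. -/
def partialKernel (π : ∀ j, H →* (U j ≃ₗ[F j] U j)) (j : ι) (A : Set ι) :
    Subgroup (U j ≃ₗ[F j] U j) :=
  (⨅ k ∈ A, (π k).ker).map (π j)

theorem mem_partialKernel {π : ∀ j, H →* (U j ≃ₗ[F j] U j)} {j : ι} {A : Set ι}
    {y : U j ≃ₗ[F j] U j} :
    y ∈ partialKernel π j A ↔ ∃ x, (∀ k ∈ A, π k x = 1) ∧ π j x = y := by
  simp [partialKernel, Subgroup.mem_iInf, MonoidHom.mem_ker]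

theorem conj_mem_partialKernel {π : ∀ j, H →* (U j ≃ₗ[F j] U j)} {j : ι} {A : Set ι}
    {y : U j ≃ₗ[F j] U j} (hy : y ∈ partialKernel π j A) (x : H) :
    π j x * y * (π j x)⁻¹ ∈ partialKernel π j A := by
  rw [mem_partialKernel] at hy ⊢
  obtain ⟨z, hz, rfl⟩ := hy
  exact ⟨x * z * x⁻¹, fun k hk => by simp [hz k hk], by simp⟩

variable {π : ∀ j, H →* (U j ≃ₗ[F j] U j)} {G : ∀ j, Subgroup (U j ≃ₗ[F j] U j)} {τ : H}
  {α : ∀ j, F j}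

/-- The partial kernel is normalised by the whole image of `H`, which contains `S_j` and the
homology, so the normal subgroup theorem applies. -/
theorem IsHomologyFactor.le_partialKernel {j : ι} (hS : IsHomologyFactor (G j) (π j τ) (α j))
    (hG : ∀ x, π j x ∈ G j) (hH : ∀ s ∈ ⁅G j, G j⁆, ∃ x, π j x = s) {A : Set ι}
    (h : ∃ x ∈ partialKernel π j A, ¬ IsHomothety x) : ⁅G j, G j⁆ ≤ partialKernel π j A := by
  refine hS.le_of_normalized _ (fun y hy => ?_) (fun s hs x hx => ?_)
    (fun x hx => conj_mem_partialKernel hx τ) h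
  · obtain ⟨x, -, rfl⟩ := mem_partialKernel.1 hy
    exact hG x
  obtain ⟨y, rfl⟩ := hH s hs
  exact conj_mem_partialKernel hx y

/-- Two factors whose homologies have unrelated eigenvalues are independent. -/
theorem exists_not_isHomothety_pair {j k : ι}
    (hSj : IsHomologyFactor (G j) (π j τ) (α j)) (hSk : IsHomologyFactor (G k) (π k τ) (α k))
    (hGk : ∀ x, π k x ∈ G k)
    (hHj : ∀ s ∈ ⁅G j, G j⁆, ∃ x, π j x = s) (hHk : ∀ s ∈ ⁅G k, G k⁆, ∃ x, π k x = s)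
    (haj : α j ≠ 1) (hak : α k ≠ 1) (hak0 : α k ≠ 0)
    (hτ : IsHomology (α k) (π k τ)) (hrank : 3 ≤ Module.finrank (F k) (U k))
    (h1 : aeval (α k) (minpoly (ZMod ℓ) (α j)) ≠ 0)
    (h2 : aeval (α k)⁻¹ (minpoly (ZMod ℓ) (α j)) ≠ 0) :
    ∃ x ∈ partialKernel π j {k}, ¬ IsHomothety x := by
  by_contra! hj
  have hNj : ∀ x, π k x = 1 → IsHomothety (π j x) := fun x hx =>
    hj _ (mem_partialKernel.2 ⟨x, by simpa using hx, rfl⟩)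
  -- Otherwise the elements trivial on `U j` cover `S_k`. The `k`-component of a commutator can then
  -- be removed without changing its `j`-component, and a commutator that is nonscalar on `U j`
  -- contradicts `hNj`.
  have hNk : ∀ x, π j x = 1 → IsHomothety (π k x) := by
    intro x hx
    by_contra hcon
    have hle := hSk.le_partialKernel hGk hHk (A := {j})
      ⟨_, mem_partialKernel.2 ⟨x, by simpa using hx, rfl⟩, hcon⟩
    obtain ⟨s, hs, s', hs', hss⟩ := hSj.exists_commutator
    obtain ⟨y, rfl⟩ := hHj s hs
    obtain ⟨y', rfl⟩ := hHj s' hs'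
    obtain ⟨z, hz, hz'⟩ := mem_partialKernel.1
      (hle (Subgroup.commutator_mem_commutator (hGk y) (hGk y')))
    have hzj : π j z = 1 := hz j rfl
    apply hss
    have := hNj (y * y' * y⁻¹ * y'⁻¹ * z⁻¹) (by
      simp only [map_mul, map_inv, hz', commutatorElement_def, mul_inv_cancel])
    simpa [hzj] using this
  have : Nontrivial (U k) := Module.nontrivial_of_finrank_pos (R := F k) (by omega)
  have : CharP (F k) ℓ := charP_of_injective_algebraMap (algebraMap (ZMod ℓ) (F k)).injective ℓ
  have : CharP (F j) ℓ := charP_of_injective_algebraMap (algebraMap (ZMod ℓ) (F j)).injective ℓ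
  obtain ⟨g, hg, u, huS, hadd, hcom, hnh, hconj, c₀, hc₀⟩ := hSj.exists_root
  obtain ⟨x, rfl⟩ := hHj g hg
  -- the lift of the root subgroup
  have hlift : ∀ c, ∃ y, π j y = u c ∧ π k y ^ ℓ = 1 := by
    intro c
    obtain ⟨y, hy⟩ := hHj _ (huS c)
    have hy1 : π j (y ^ ℓ) = 1 := by
      rw [map_pow, hy, map_pow_of_add hadd, CharP.cast_eq_zero, zero_mul, map_one_of_add hadd]
    have hy2 := (hNk _ hy1).pow_card_sub_one
    have hq : ℓ ∣ Nat.card (F k) := by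
      have := Fintype.ofFinite (F k)
      rw [Nat.card_eq_fintype_card, ← CharP.cast_eq_zero_iff (F k) ℓ, Nat.cast_card_eq_zero]
    obtain ⟨m, hm⟩ := hq
    have hm0 : 0 < ℓ * m := hm ▸ Nat.card_pos
    -- With `q = |F_k|`, the power `q - 1` kills the scalar `π k (y ^ ℓ)`, while `(q - 1) ^ 2 ≡ 1`
    -- modulo `ℓ` leaves `u c` unchanged.
    refine ⟨y ^ ((Nat.card (F k) - 1) * (Nat.card (F k) - 1)), ?_, ?_⟩
    · rw [map_pow, hy, map_pow_of_add hadd, hm]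
      push_cast [Nat.cast_sub (show 1 ≤ ℓ * m from hm0)]
      simp
    · rw [map_pow, ← pow_mul, mul_comm, pow_mul, pow_mul, ← map_pow (π k) y, hy2, one_pow]
  choose y hyj hyk using hlift
  -- Two lifts differ on `U k` by a scalar, whose `ℓ`-th power is `1`. Uniqueness is what transports
  -- the relations of the root subgroup from `U j` to `U k`.
  have huniq : ∀ z z', π j z = π j z' → π k z ^ ℓ = 1 → π k z' ^ ℓ = 1 → π k z = π k z' := by
    intro z z' hzz hz hz'
    have h3 := hNk (z * z'⁻¹) (by rw [map_mul, map_inv, hzz, mul_inv_cancel])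
    have h4 : π k z = π k (z * z'⁻¹) * π k z' := by simp
    have h5 := h3.eq_one_of_pow_char (ℓ := ℓ) (by
      rw [h4, (h3.commute _).mul_pow, hz', mul_one] at hz
      exact hz)
    rw [h4, h5, one_mul]
  have hycomm : ∀ c d, Commute (π k (y c)) (π k (y d)) := by
    intro c d
    have h3 := hNk (y c * y d * (y c)⁻¹ * (y d)⁻¹) (by
      simp only [map_mul, map_inv, hyj]
      rw [← hadd, add_comm, hadd]; group)
    have h4 : π k (y c) * π k (y d) * (π k (y c))⁻¹ =
        π k (y c * y d * (y c)⁻¹ * (y d)⁻¹) * π k (y d) := by simp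
    have h5 := h3.eq_one_of_pow_char (ℓ := ℓ) (by
      have h6 := congrArg (· ^ ℓ) h4
      simp only [conj_pow, hyk, mul_one, mul_inv_cancel, (h3.commute _).mul_pow] at h6
      exact h6.symm)
    rw [h5, one_mul] at h4
    exact mul_inv_eq_iff_eq_mul.1 h4
  -- the lift of the torus element
  have hb : IsHomology (α k) (π k (x * τ * x⁻¹)) := by
    simpa using hτ.conj (π k x)
  have hab : Commute (π k τ) (π k (x * τ * x⁻¹)) := by
    refine hτ.commute_of_isHomothety hrank hb ?_
    have := hNk (τ * (x * τ * x⁻¹) * τ⁻¹ * (x * τ * x⁻¹)⁻¹) (by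
      rw [map_mul, map_mul, map_mul, map_inv, map_inv, mul_inv_eq_one, mul_inv_eq_iff_eq_mul]
      simpa using hcom.eq)
    simpa using this
  have hne : π k τ ≠ π k (x * τ * x⁻¹) := by
    intro heq
    apply hnh
    have := hNj (τ * (x * τ * x⁻¹)⁻¹) (by rw [map_mul, map_inv, ← heq, mul_inv_cancel])
    simpa using this
  have hquad := hτ.mul_quadratic hak hb hab hne
  rw [← map_mul] at hquad
  -- The lifted root group and the lifted torus element satisfy on `U k` the same addition and
  -- conjugation laws as on `U j`, now with `α k` as the only nontrivial eigenvalue of the torus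
  -- element.
  rcases root_minpoly_of_unipotent (ℓ := ℓ) haj hak hak0 (π k (τ * (x * τ * x⁻¹))) hquad
    (fun c => π k (y c)) (fun c d => by
      rw [← map_mul]
      refine huniq _ _ ?_ (hyk _) ?_
      · rw [map_mul, hyj, hyj, hyj, hadd]
      · rw [map_mul, (hycomm c d).mul_pow, hyk, hyk, mul_one]) hyk (fun c => by
      rw [← map_inv, ← map_mul, ← map_mul]
      refine huniq _ _ ?_ ?_ (hyk _)
      · rw [hyj, ← hconj, ← hyj]; simp
      · rw [map_mul, map_mul, map_inv, conj_pow, hyk, mul_one, mul_inv_cancel]) (by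
      by_contra! hcon
      apply hc₀
      have := hNj (y (α j * c₀) * (y c₀)⁻¹) (by rw [map_mul, map_inv, hcon, hcon]; simp)
      simpa [hyj] using this) with h | h
  · exact h1 h
  · exact h2 h

/-- A subdirect product of factors whose homologies have unrelated eigenvalues contains each of the
factors. -/
theorem exists_of_isHomologyFactor [Finite ι] (hS : ∀ j, IsHomologyFactor (G j) (π j τ) (α j))
    (hG : ∀ j, ∀ x, π j x ∈ G j) (hH : ∀ j, ∀ s ∈ ⁅G j, G j⁆, ∃ x, π j x = s)
    (ha : ∀ j, α j ≠ 1) (ha0 : ∀ j, α j ≠ 0)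
    (hτ : ∀ j, IsHomology (α j) (π j τ)) (hrank : ∀ j, 3 ≤ Module.finrank (F j) (U j))
    (h1 : ∀ j k, j ≠ k → aeval (α k) (minpoly (ZMod ℓ) (α j)) ≠ 0)
    (h2 : ∀ j k, j ≠ k → aeval (α k)⁻¹ (minpoly (ZMod ℓ) (α j)) ≠ 0)
    (j : ι) (s : U j ≃ₗ[F j] U j) (hs : s ∈ ⁅G j, G j⁆) :
    ∃ x, π j x = s ∧ ∀ k, k ≠ j → π k x = 1 := by
  classical
  cases nonempty_fintype ι
  suffices h : ∀ A : Finset ι, j ∉ A → ⁅G j, G j⁆ ≤ partialKernel π j A by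
    obtain ⟨x, hx, hx'⟩ := mem_partialKernel.1 (h (Finset.univ.erase j) (by simp) hs)
    exact ⟨x, hx', fun k hk => hx k (by simpa using hk)⟩
  intro A
  induction A using Finset.induction_on with
  | empty =>
    intro _ s hs
    obtain ⟨x, hx⟩ := hH j s hs
    exact mem_partialKernel.2 ⟨x, by simp, hx⟩
  | insert k A _ ih =>
    intro hj
    rw [Finset.mem_insert, not_or] at hj
    obtain ⟨s, hs, s', hs', hss⟩ := (hS j).exists_commutator
    obtain ⟨x, hx, rfl⟩ := mem_partialKernel.1 (ih hj.2 hs)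
    obtain ⟨x', hx', rfl⟩ := mem_partialKernel.1 ((hS j).le_partialKernel (hG j) (hH j)
      (exists_not_isHomothety_pair (hS j) (hS k) (hG k) (hH j) (hH k) (ha j) (ha k) (ha0 k)
        (hτ k) (hrank k) (h1 j k hj.1) (h2 j k hj.1)) hs')
    -- `x` is trivial on the factors in `A` and `x'` on the factor `k`, so their commutator is
    -- trivial on all of them. One nonscalar commutator suffices, and perfectness of `S_j` is not
    -- needed.
    refine (hS j).le_partialKernel (hG j) (hH j) ⟨_, mem_partialKernel.2
      ⟨x * x' * x⁻¹ * x'⁻¹, fun i hi => ?_, rfl⟩, by simpa using hss⟩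
    simp only [map_mul, map_inv]
    rw [Finset.mem_coe, Finset.mem_insert] at hi
    rcases hi with rfl | hi
    · rw [hx' i rfl]; simp
    · rw [hx i hi]; simp

end Goursat

/-! ### The normal subgroup theorem and root subgroups for the general linear group. -/

section GeneralLinear

variable {F U : Type*} [Field F] [AddCommGroup U] [Module F U]

theorem exists_dual_pair {v w : U} (h : LinearIndependent F ![v, w]) (a c : F) :
    ∃ b : Module.Dual F U, b v = a ∧ b w = c := by
  have hv : v ∉ Submodule.span F {w} := fun hm => by
    obtain ⟨x, hx⟩ := Submodule.mem_span_singleton.1 hm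
    exact (linearIndependent_fin2.1 h).2 x hx
  have hw : w ∉ Submodule.span F {v} := fun hm => by
    obtain ⟨x, hx⟩ := Submodule.mem_span_singleton.1 hm
    exact (linearIndependent_fin2.1 (LinearIndependent.pair_symm_iff.1 h)).2 x hx
  obtain ⟨f₁, h1, h1'⟩ := Submodule.exists_le_ker_of_notMem hv
  obtain ⟨f₂, h2, h2'⟩ := Submodule.exists_le_ker_of_notMem hw
  have h3 : f₁ w = 0 := h1' (Submodule.mem_span_singleton_self w)
  have h4 : f₂ v = 0 := h2' (Submodule.mem_span_singleton_self v)
  exact ⟨(a / f₁ v) • f₁ + (c / f₂ w) • f₂, by simp [h4, h1], by simp [h3, h2]⟩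

theorem exists_dual_ne_zero_of_card_lt [Module.Finite F U] (s : Finset U)
    (hs : s.card < Module.finrank F U) : ∃ f : Module.Dual F U, f ≠ 0 ∧ ∀ x ∈ s, f x = 0 := by
  have hlt : Submodule.span F (s : Set U) < ⊤ := by
    apply Submodule.lt_top_of_finrank_lt_finrank
    exact (finrank_span_finset_le_card s).trans_lt hs
  obtain ⟨f, hf0, hf⟩ := Submodule.exists_le_ker_of_lt_top _ hlt
  exact ⟨f, hf0, fun x hx => hf (Submodule.subset_span hx)⟩

theorem exists_dual_ne_zero_of_pair [Module.Finite F U] (hU : 3 ≤ Module.finrank F U) (v w : U) :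
    ∃ f : Module.Dual F U, f ≠ 0 ∧ f v = 0 ∧ f w = 0 := by
  classical
  obtain ⟨f, hf0, hf⟩ := exists_dual_ne_zero_of_card_lt (F := F) {v, w}
    (Finset.card_le_two.trans_lt hU)
  exact ⟨f, hf0, hf v (by simp), hf w (by simp)⟩

theorem exists_linearIndependent_of_not_isHomothety {g : U ≃ₗ[F] U} (hg : ¬ IsHomothety g) :
    ∃ v, LinearIndependent F ![v, g v] := by
  by_contra! h
  obtain ⟨a, ha⟩ := LinearMap.exists_eq_smul_id_of_forall_notLinearIndependent
    (f := g.toLinearMap) h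
  exact hg ⟨a, fun v => LinearMap.congr_fun ha v⟩

theorem inv_apply_self (g : U ≃ₗ[F] U) (x : U) : (g⁻¹ : U ≃ₗ[F] U) (g x) = x := by
  rw [← LinearEquiv.mul_apply, inv_mul_cancel]; rfl

theorem apply_inv_self (g : U ≃ₗ[F] U) (x : U) : g ((g⁻¹ : U ≃ₗ[F] U) x) = x := by
  rw [← LinearEquiv.mul_apply, mul_inv_cancel]; rfl

/-- The transvection `x ↦ x + f(x) v`. -/
abbrev transv {f : Module.Dual F U} {v : U} (h : f v = 0) : U ≃ₗ[F] U := LinearEquiv.transvection h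

theorem transv_apply {f : Module.Dual F U} {v : U} (h : f v = 0) (x : U) :
    transv h x = x + f x • v := rfl

theorem not_isHomothety_transv {f : Module.Dual F U} {v : U} (h : f v = 0) (hf : f ≠ 0)
    (hv : v ≠ 0) : ¬ IsHomothety (transv h) := by
  intro hs
  have h1 := hs.eq_one_of_apply_eq hv (by rw [transv_apply, h, zero_smul, add_zero])
  apply hf
  ext x
  have h2 := LinearEquiv.congr_fun h1 x
  rw [transv_apply, LinearEquiv.coe_one, id, add_eq_left] at h2
  exact (smul_eq_zero.1 h2).resolve_right hv

/-- A dilation multiplying `v` by `α` rescales the transvection with vector `(α - 1)⁻¹ v`, and their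
commutator is the given transvection. -/
theorem transv_mem_commutator {α : F} (hα : α ≠ 1) (hα0 : α ≠ 0) {f : Module.Dual F U} {v : U}
    (h : f v = 0) : transv h ∈ ⁅(⊤ : Subgroup (U ≃ₗ[F] U)), (⊤ : Subgroup (U ≃ₗ[F] U))⁆ := by
  by_cases hv : v = 0
  · subst hv
    have : transv h = 1 := by ext x; simp
    rw [this]; exact one_mem _
  obtain ⟨g, hg⟩ := Module.Projective.exists_dual_eq_one F hv
  have hu : IsUnit (1 + g ((α - 1) • v)) := by
    rw [map_smul, hg, smul_eq_mul, mul_one, add_sub_cancel]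
    exact hα0.isUnit
  have h' : f ((α - 1)⁻¹ • v) = 0 := by simp [h]
  have hd := fun x => LinearEquiv.dilatransvection.apply (h := hu) (x := x)
  have key : LinearEquiv.dilatransvection hu * transv h' * (LinearEquiv.dilatransvection hu)⁻¹ *
      (transv h')⁻¹ = transv h := by
    rw [mul_inv_eq_iff_eq_mul, mul_inv_eq_iff_eq_mul]
    ext x
    simp only [LinearEquiv.mul_apply, hd, transv_apply, map_add, map_smul, h, hg, smul_eq_mul]
    have e : f x • v = (f x * (α - 1)⁻¹ * (α - 1)) • v := by
      rw [inv_mul_cancel_right₀ (sub_ne_zero.2 hα)]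
    rw [e]
    module
  rw [← key]
  exact Subgroup.commutator_mem_commutator (Subgroup.mem_top _) (Subgroup.mem_top _)

section Normal

variable {N : Subgroup (U ≃ₗ[F] U)}
  (hN : ∀ (f : Module.Dual F U) (v : U) (h : f v = 0), ∀ x ∈ N, transv h * x * (transv h)⁻¹ ∈ N)

include hN

/-- For `b v = 1` and `b c = 0`, the commutator of `x ↦ x + b(x) c` with `x ↦ x + f(x) v` is `x ↦ x
+ f(x) c`. -/
theorem transv_mem_of_left_eq_of_notMem {f : Module.Dual F U} {v c : U} (hv : f v = 0)
    (hmem : transv hv ∈ N) (hc : f c = 0) (hvc : LinearIndependent F ![v, c]) :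
    transv hc ∈ N := by
  obtain ⟨b, hbv, hbc⟩ := exists_dual_pair hvc 1 0
  have key : transv hbc * transv hv * (transv hbc)⁻¹ * (transv hv)⁻¹ = transv hc := by
    rw [mul_inv_eq_iff_eq_mul, mul_inv_eq_iff_eq_mul]
    ext x
    simp only [LinearEquiv.mul_apply, transv_apply, map_add, map_smul, hv, hbv, hc]
    module
  rw [← key]
  exact N.mul_mem (hN _ _ hbc _ hmem) (N.inv_mem hmem)

/-- If `c` is proportional to `v`, a detour through a vector `w` of `ker f` independent of `v`
reduces to the independent case; dimension three provides `w`. -/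
theorem transv_mem_of_left_eq [Module.Finite F U] (hU : 3 ≤ Module.finrank F U)
    {f : Module.Dual F U} {v c : U} (hv : f v = 0) (hv0 : v ≠ 0)
    (hmem : transv hv ∈ N) (hc : f c = 0) : transv hc ∈ N := by
  by_cases hc0 : c = 0
  · subst hc0
    have : transv hc = 1 := by ext x; simp
    rw [this]; exact one_mem _
  by_cases hvc : LinearIndependent F ![v, c]
  · exact transv_mem_of_left_eq_of_notMem hN hv hmem hc hvc
  obtain ⟨g, hg⟩ := Module.Projective.exists_dual_eq_one F hv0
  obtain ⟨w, hw0, hw, hgw⟩ := exists_ne_zero_of_two_duals hU f g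
  have hvw : LinearIndependent F ![v, w] := by
    rw [linearIndependent_fin2]
    refine ⟨hw0, fun a ha => ?_⟩
    have ha' : a • w = v := ha
    have : g v = 0 := by rw [← ha', map_smul, hgw, smul_zero]
    exact one_ne_zero (hg.symm.trans this)
  have h1 := transv_mem_of_left_eq_of_notMem hN hv hmem hw hvw
  refine transv_mem_of_left_eq_of_notMem hN hw h1 hc ?_
  rw [LinearIndependent.pair_symm_iff, linearIndependent_fin2]
  refine ⟨hw0, fun a ha => ?_⟩
  have ha' : a • w = c := ha
  apply hvc
  have ha0 : a ≠ 0 := by rintro rfl; rw [zero_smul] at ha'; exact hc0 ha'.symm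
  rw [linearIndependent_fin2]
  refine ⟨hc0, fun b hb => ?_⟩
  have hb' : b • c = v := hb
  have hgv : g v = 0 := by rw [← hb', ← ha', map_smul, map_smul, hgw, smul_zero, smul_zero]
  exact one_ne_zero (hg.symm.trans hgv)

/-- Here the vector is kept and the functional varies. Unless `b` is a multiple of `f`, there is `c`
with `b c = 0` and `f c = 1`, and a commutator with `x ↦ x + b(x) c` replaces `f` by `b`. -/
theorem transv_mem_of_right_eq [Module.Finite F U] (hU : 3 ≤ Module.finrank F U)
    {f b : Module.Dual F U} {v : U} (hv : f v = 0) (hf0 : f ≠ 0) (hv0 : v ≠ 0)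
    (hmem : transv hv ∈ N) (hb : b v = 0) : transv hb ∈ N := by
  by_cases hker : LinearMap.ker b ≤ LinearMap.ker f
  · by_cases hb0 : b = 0
    · subst hb0
      have : transv hb = 1 := by ext x; simp
      rw [this]; exact one_mem _
    obtain ⟨y, hy⟩ : ∃ y, b y ≠ 0 := by
      by_contra! hcon
      exact hb0 (LinearMap.ext hcon)
    have hfy : f y ≠ 0 := by
      intro h0
      apply hf0
      ext x
      have h1 : x - (b x / b y) • y ∈ LinearMap.ker b := by simp [hy]
      have h2 := hker h1
      simpa [h0] using h2
    have hfb : ∀ x, b x = b y / f y * f x := by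
      intro x
      have h1 : x - (b x / b y) • y ∈ LinearMap.ker b := by simp [hy]
      have h2 : f x - b x / b y * f y = 0 := by simpa using hker h1
      field_simp
      field_simp at h2
      linear_combination -h2
    have h1 : f ((b y / f y) • v) = 0 := by simp [hv]
    have h2 := transv_mem_of_left_eq hN hU hv hv0 hmem h1
    have : transv h1 = transv hb := by
      ext x
      rw [transv_apply, transv_apply, hfb x, smul_smul, mul_comm]
    rwa [← this]
  · obtain ⟨c, hc, hfc⟩ := SetLike.not_le_iff_exists.1 hker
    rw [LinearMap.mem_ker] at hc hfc
    have hc' : b ((f c)⁻¹ • c) = 0 := by simp [hc]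
    have key : transv hv * (transv hc' * (transv hv)⁻¹ * (transv hc')⁻¹) = transv hb := by
      rw [← mul_assoc, mul_inv_eq_iff_eq_mul, ← mul_assoc, mul_inv_eq_iff_eq_mul]
      ext x
      simp only [LinearEquiv.mul_apply, transv_apply, map_add, map_smul, hb, hc]
      match_scalars <;> field_simp <;> ring
    rw [← key]
    exact N.mul_mem hmem (hN _ _ hc' _ (N.inv_mem hmem))

/-- The route is `(f, v)` to `(f, w)` to `(b, w)` to `(b, c)` with `w` in both kernels. -/
theorem transv_mem_of_mem [Module.Finite F U] (hU : 3 ≤ Module.finrank F U)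
    {f b : Module.Dual F U} {v c : U} (hv : f v = 0) (hf0 : f ≠ 0) (hv0 : v ≠ 0)
    (hmem : transv hv ∈ N) (hb : b c = 0) : transv hb ∈ N := by
  obtain ⟨w, hw0, hfw, hbw⟩ := exists_ne_zero_of_two_duals hU f b
  have h1 := transv_mem_of_left_eq hN hU hv hv0 hmem hfw
  have h2 := transv_mem_of_right_eq hN hU hfw hf0 hw0 h1 hbw
  exact transv_mem_of_left_eq hN hU hbw hw0 h2 hb

/-- A commutator of `g` with a transvection has the form `x ↦ x + f'(x) g v - f(x) v`, and a further
commutator, with a transvection whose functional kills `v` but not `g v`, leaves only `x ↦ x + f'(x)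
v`. -/
theorem exists_transv_mem [Module.Finite F U] (hU : 4 ≤ Module.finrank F U) {g : U ≃ₗ[F] U}
    (hg : g ∈ N) (hgs : ¬ IsHomothety g) :
    ∃ (f : Module.Dual F U) (v : U) (h : f v = 0), f ≠ 0 ∧ v ≠ 0 ∧ transv h ∈ N := by
  obtain ⟨v, hv⟩ := exists_linearIndependent_of_not_isHomothety hgs
  have hv0 : v ≠ 0 := by
    rw [LinearIndependent.pair_symm_iff, linearIndependent_fin2] at hv
    exact hv.1
  obtain ⟨f, hf0, hfv, hfgv, hfg⟩ : ∃ f : Module.Dual F U, f ≠ 0 ∧ f v = 0 ∧ f (g v) = 0 ∧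
      f ((g⁻¹ : U ≃ₗ[F] U) v) = 0 := by
    classical
    -- A functional vanishing on three vectors: this is where dimension four enters.
    obtain ⟨f, hf0, hf⟩ := exists_dual_ne_zero_of_card_lt (F := F) {v, g v, (g⁻¹ : U ≃ₗ[F] U) v}
      (Finset.card_le_three.trans_lt hU)
    exact ⟨f, hf0, hf _ (by simp), hf _ (by simp), hf _ (by simp)⟩
  obtain ⟨b, hbv, hbw⟩ := exists_dual_pair hv 0 1
  let f' : Module.Dual F U := f.comp (g⁻¹ : U ≃ₗ[F] U).toLinearMap
  have hf' : ∀ x, f' x = f ((g⁻¹ : U ≃ₗ[F] U) x) := fun x => rfl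
  have hf'v : f' v = 0 := hfg
  have hf'0 : f' ≠ 0 := by
    intro h0
    apply hf0
    ext x
    have := LinearMap.congr_fun h0 (g x)
    rwa [hf', inv_apply_self] at this
  have hy : g * (transv hfv * g⁻¹ * (transv hfv)⁻¹) ∈ N :=
    N.mul_mem hg (hN _ _ hfv _ (N.inv_mem hg))
  set y := g * (transv hfv * g⁻¹ * (transv hfv)⁻¹) with hydef
  have hyx : ∀ x, y x = x + f' x • g v - f x • v := by
    intro x
    obtain ⟨z, rfl⟩ : ∃ z, transv hfv z = x := ⟨_, apply_inv_self _ x⟩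
    have e : y (transv hfv z) = g (transv hfv ((g⁻¹ : U ≃ₗ[F] U) z)) := by
      simp only [hydef, LinearEquiv.mul_apply, inv_apply_self]
    have hginv : (g⁻¹ : U ≃ₗ[F] U) (transv hfv z) =
        (g⁻¹ : U ≃ₗ[F] U) z + f z • (g⁻¹ : U ≃ₗ[F] U) v := by
      rw [transv_apply, map_add, map_smul]
    rw [e, hf', hginv]
    simp only [transv_apply, map_add, map_smul, apply_inv_self, hfg, hfv, smul_zero,
      add_zero]
    abel
  refine ⟨f', v, hf'v, hf'0, hv0, ?_⟩
  have key : transv hbv * y * (transv hbv)⁻¹ * y⁻¹ = transv hf'v := by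
    rw [mul_inv_eq_iff_eq_mul, mul_inv_eq_iff_eq_mul]
    ext x
    have h1 : f' (g v) = 0 := by rw [hf', inv_apply_self, hfv]
    simp only [LinearEquiv.mul_apply, transv_apply, hyx, map_add, map_sub, map_smul, hf'v, hbv,
      hbw, hfv, h1]
    module
  rw [← key]
  exact N.mul_mem (hN _ _ hbv _ hy) (N.inv_mem hy)

end Normal

/-- Every linear automorphism is diagonal up to transvections. -/
theorem exists_mul_diagonal_mul {ι : Type*} [Fintype ι] [DecidableEq ι] (e : Module.Basis ι F U)
    {T : Subgroup (U ≃ₗ[F] U)} (hT : ∀ (f : Module.Dual F U) (v : U) (h : f v = 0), transv h ∈ T)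
    (g : U ≃ₗ[F] U) :
    ∃ p ∈ T, ∃ q ∈ T, ∃ D : ι → F, ∀ i, (p * g * q) (e i) = D i • e i := by
  obtain ⟨L, L', D, h⟩ :=
    Matrix.Pivot.exists_list_transvec_mul_mul_list_transvec_eq_diagonal
      (LinearMap.toMatrix e e g.toLinearMap)
  have hL : ∀ L : List (Matrix.TransvectionStruct ι F), ∃ p ∈ T,
      Matrix.toLin e e (L.map Matrix.TransvectionStruct.toMatrix).prod = p.toLinearMap := by
    intro L
    induction L with
    | nil => exact ⟨1, T.one_mem, by rw [List.map_nil, List.prod_nil, Matrix.toLin_one]; rfl⟩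
    | cons t L ih =>
      obtain ⟨p, hp, hpL⟩ := ih
      have h0 : (e.coord t.i) (t.c • e t.j) = 0 := by
        simp [t.hij.symm]
      have h1 : (e.coord t.j) (t.c • e t.i) = 0 := by
        simp [t.hij]
      refine ⟨transv h1 * p, T.mul_mem (hT _ _ _) hp, ?_⟩
      rw [List.map_cons, List.prod_cons, Matrix.toLin_mul e e e, hpL]
      ext x
      rw [LinearMap.comp_apply, LinearEquiv.coe_coe, LinearEquiv.coe_coe, LinearEquiv.mul_apply]
      generalize p x = y
      have h2 : Matrix.toLin e e t.toMatrix = (transv h1).toLinearMap := by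
        refine e.ext fun k => ?_
        rw [Matrix.toLin_self, LinearEquiv.coe_coe, transv_apply]
        simp only [Matrix.TransvectionStruct.toMatrix, Matrix.transvection, Matrix.add_apply,
          add_smul, Finset.sum_add_distrib, Matrix.one_apply, Matrix.single_apply]
        simp [Finsupp.single_apply, ite_and]
        by_cases hk : t.j = k
        · subst hk; simp
        · simp [hk, Ne.symm hk]
      rw [h2]; rfl
  obtain ⟨p, hp, hpL⟩ := hL L
  obtain ⟨q, hq, hqL⟩ := hL L'
  refine ⟨p, hp, q, hq, D, fun i => ?_⟩
  have h3 := congrArg (Matrix.toLin e e) h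
  rw [Matrix.toLin_mul e e e, Matrix.toLin_mul e e e, hpL, hqL, Matrix.toLin_toMatrix] at h3
  have h4 := LinearMap.congr_fun h3 (e i)
  rw [Matrix.toLin_self] at h4
  simpa [Matrix.diagonal_apply] using h4

/-- Modulo the normal closure of the transvections every automorphism is diagonal in one fixed
basis, so the quotient is abelian. -/
theorem commutator_le_of_transv_mem [Module.Finite F U] {N : Subgroup (U ≃ₗ[F] U)}
    (hN : ∀ (f : Module.Dual F U) (v : U) (h : f v = 0), transv h ∈ N) :
    ⁅(⊤ : Subgroup (U ≃ₗ[F] U)), (⊤ : Subgroup (U ≃ₗ[F] U))⁆ ≤ N := by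
  classical
  let T : Subgroup (U ≃ₗ[F] U) := Subgroup.normalClosure (LinearEquiv.transvections F U)
  have hTN : T ≤ N := by
    refine (Subgroup.closure_le _).2 fun x hx => ?_
    obtain ⟨y, ⟨f, v, hfv, rfl⟩, hy⟩ := Group.mem_conjugatesOfSet_iff.1 hx
    obtain ⟨g, rfl⟩ := isConj_iff.1 hy
    have h0 : (f.comp (g⁻¹ : U ≃ₗ[F] U).toLinearMap) (g v) = 0 := by
      simp [hfv]
    have : g * LinearEquiv.transvection hfv * g⁻¹ = transv h0 := by
      ext x
      change g ((g⁻¹ : U ≃ₗ[F] U) x + f ((g⁻¹ : U ≃ₗ[F] U) x) • v) = _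
      rw [map_add, map_smul, apply_inv_self]; rfl
    rw [this]
    exact hN _ _ _
  have hT : ∀ (f : Module.Dual F U) (v : U) (h : f v = 0), transv h ∈ T := fun f v h =>
    Subgroup.subset_normalClosure ⟨f, v, h, rfl⟩
  refine le_trans ?_ hTN
  rw [Subgroup.commutator_le]
  intro x _ y _
  let e := Module.finBasis F U
  obtain ⟨p, hp, q, hq, D, hD⟩ := exists_mul_diagonal_mul e hT x
  obtain ⟨p', hp', q', hq', D', hD'⟩ := exists_mul_diagonal_mul e hT y
  have hcomm : Commute (p * x * q) (p' * y * q') := by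
    apply LinearEquiv.toLinearMap_injective
    refine e.ext fun i => ?_
    simp only [LinearEquiv.coe_coe]
    rw [LinearEquiv.mul_apply (p * x * q), LinearEquiv.mul_apply (p' * y * q'), hD, hD', map_smul,
      map_smul, hD, hD', smul_smul, smul_smul, mul_comm]
  have hm : ∀ p ∈ T, (QuotientGroup.mk' T) p = 1 := fun p hp =>
    (QuotientGroup.eq_one_iff p).2 hp
  have h1 := hcomm.map (QuotientGroup.mk' T)
  simp only [map_mul, hm _ hp, hm _ hq, hm _ hp', hm _ hq', one_mul, mul_one] at h1
  rw [← QuotientGroup.eq_one_iff]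
  change (QuotientGroup.mk' T) (x * y * x⁻¹ * y⁻¹) = 1
  rw [map_mul, map_mul, map_mul, map_inv, map_inv, mul_inv_eq_one, mul_inv_eq_iff_eq_mul]
  exact h1.eq

theorem isHomologyFactor_commutator [Module.Finite F U] (hU : 4 ≤ Module.finrank F U) {α : F}
    (hα : α ≠ 1) (hα0 : α ≠ 0) {a : U ≃ₗ[F] U} (ha : IsHomology α a) :
    IsHomologyFactor (⊤ : Subgroup (U ≃ₗ[F] U)) a α where
  le_of_normalized N _ hS _ := by
    rintro ⟨g, hg, hgs⟩
    have hN : ∀ (f : Module.Dual F U) (v : U) (h : f v = 0), ∀ x ∈ N,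
        transv h * x * (transv h)⁻¹ ∈ N := fun f v h x hx =>
      hS _ (transv_mem_commutator hα hα0 h) x hx
    obtain ⟨f, v, h, hf0, hv0, hmem⟩ := exists_transv_mem hN hU hg hgs
    exact commutator_le_of_transv_mem fun b c hb =>
      transv_mem_of_mem hN (by omega) h hf0 hv0 hmem hb
  exists_commutator := by
    have : Nontrivial U := Module.nontrivial_of_finrank_pos (R := F) (by omega)
    obtain ⟨v, hv0⟩ := exists_ne (0 : U)
    obtain ⟨b, hbv⟩ := Module.Projective.exists_dual_eq_one F hv0
    obtain ⟨c, hc0, hbc, -⟩ := exists_ne_zero_of_two_duals (by omega) b b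
    obtain ⟨f, hf0, hfv, hfc⟩ := exists_dual_ne_zero_of_pair (F := F) (by omega) v c
    refine ⟨transv hbc, transv_mem_commutator hα hα0 _, transv hfv,
      transv_mem_commutator hα hα0 _, ?_⟩
    have key : transv hbc * transv hfv * (transv hbc)⁻¹ * (transv hfv)⁻¹ = transv hfc := by
      rw [mul_inv_eq_iff_eq_mul, mul_inv_eq_iff_eq_mul]
      ext x
      simp only [LinearEquiv.mul_apply, transv_apply, map_add, map_smul, hfv, hbv, hfc]
      module
    rw [key]
    exact not_isHomothety_transv hfc hf0 hc0
  exists_root := by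
    obtain ⟨f, p, hfp, ha⟩ := ha
    have hα1 : α - 1 ≠ 0 := sub_ne_zero.2 hα
    have hp0 : p ≠ 0 := ne_zero_of_dual_apply_eq hα hfp
    obtain ⟨p₂, hp₂0, hfp₂, -⟩ := exists_ne_zero_of_two_duals (by omega : 3 ≤ _) f f
    have hind : LinearIndependent F ![p, p₂] := by
      rw [linearIndependent_fin2]
      refine ⟨hp₂0, fun c hc => hα1 ?_⟩
      have hc' : c • p₂ = p := hc
      rw [← hfp, ← hc', map_smul, hfp₂, smul_zero]
    obtain ⟨f₂, hf₂p, hf₂p₂⟩ := exists_dual_pair hind 0 (α - 1)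
    -- With this normalisation the product `g` of three transvections is the Weyl element of the
    -- plane spanned by `p` and `p₂`: it sends `p` to `p₂` and carries `f` to `f₂`.
    let κ : F := (α - 1)⁻¹
    have h1 : (κ • f) p₂ = 0 := by simp [hfp₂]
    have h2 : (κ • f₂) (-p) = 0 := by simp [hf₂p]
    have hmul : κ * (α - 1) = 1 := inv_mul_cancel₀ hα1
    let g := transv h1 * transv h2 * transv h1
    have hb : ∀ x, (g * a * g⁻¹) x = x + f₂ x • p₂ := by
      intro x
      obtain ⟨z, rfl⟩ : ∃ z, g z = x := ⟨_, apply_inv_self g x⟩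
      simp only [LinearEquiv.mul_apply, inv_apply_self]
      have hgz : f₂ (g z) = f z := by
        simp only [g, LinearEquiv.mul_apply, transv_apply, LinearMap.smul_apply, map_add, map_smul,
          map_neg, hf₂p₂, hfp₂, hf₂p, hfp, smul_eq_mul, mul_zero]
        linear_combination (f₂ z * (-(1 + κ * (α - 1))) +
          f z * (1 - κ * (α - 1) - (κ * (α - 1)) ^ 2)) * hmul
      have hgp : g p = p₂ := by
        simp only [g, LinearEquiv.mul_apply, transv_apply, LinearMap.smul_apply, map_add, map_smul,
          map_neg, hf₂p₂, hfp₂, hf₂p, hfp, smul_eq_mul, mul_zero, hmul, one_smul, smul_neg]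
        module
      rw [ha, map_add, map_smul, hgp, hgz]
    have hg : g ∈ ⁅(⊤ : Subgroup (U ≃ₗ[F] U)), (⊤ : Subgroup (U ≃ₗ[F] U))⁆ :=
      mul_mem (mul_mem (transv_mem_commutator hα hα0 _) (transv_mem_commutator hα hα0 _))
        (transv_mem_commutator hα hα0 _)
    -- The root subgroup is `x ↦ x + f₃(x) c p`. The product of the two homologies preserves `f₃`
    -- and multiplies `p` by `α`.
    obtain ⟨f₃, hf₃0, hf₃p, hf₃p₂⟩ := exists_dual_ne_zero_of_pair (F := F) (by omega) p p₂
    have hu : ∀ c : F, f₃ (c • p) = 0 := fun c => by simp [hf₃p]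
    obtain ⟨b, hbdef⟩ : ∃ b, b = g * a * g⁻¹ := ⟨_, rfl⟩
    refine ⟨g, hg, ?_⟩
    rw [← hbdef] at hb ⊢
    refine ⟨fun c => transv (hu c), fun c => transv_mem_commutator hα hα0 _, ?_, ?_, ?_, ?_,
      1, ?_⟩
    · intro c d
      ext x
      simp only [LinearEquiv.mul_apply, transv_apply, map_add, map_smul, hf₃p]
      module
    · ext x
      simp only [LinearEquiv.mul_apply, ha, hb, map_add, map_smul, hfp₂, hf₂p, smul_zero, add_zero]
      abel
    · rintro ⟨z, hz⟩
      have hz' : ∀ x, a x = z • b x := fun x => by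
        rw [← hz, LinearEquiv.mul_apply, inv_apply_self]
      obtain ⟨w, hw0, hfw, hf₂w⟩ := exists_ne_zero_of_two_duals (by omega : 3 ≤ _) f f₂
      have h3 := hz' w
      rw [ha, hb, hfw, hf₂w, zero_smul, zero_smul, add_zero, ← sub_eq_zero] at h3
      have h4 : (1 - z) • w = 0 := by rw [← h3]; module
      have h5 : z = 1 := (sub_eq_zero.1 ((smul_eq_zero.1 h4).resolve_right hw0)).symm
      have h6 := hz' p
      rw [ha, hb, hfp, hf₂p, h5, zero_smul, add_zero, one_smul, add_eq_left] at h6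
      exact (smul_ne_zero hα1 hp0) h6
    · intro c
      rw [mul_inv_eq_iff_eq_mul]
      ext x
      simp only [LinearEquiv.mul_apply, transv_apply, ha, hb, map_add, map_smul, hf₃p, hf₃p₂, hf₂p,
        hfp, hfp₂, smul_eq_mul, mul_zero, add_zero, zero_smul]
      module
    · have h7 : f₃ ((α * 1 - 1) • p) = 0 := by simp [hf₃p]
      have : transv (hu (α * 1)) * (transv (hu 1))⁻¹ = transv h7 := by
        rw [mul_inv_eq_iff_eq_mul]
        ext x
        simp only [LinearEquiv.mul_apply, transv_apply, map_add, map_smul, hf₃p]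
        module
      rw [this]
      exact not_isHomothety_transv h7 hf₃0 (smul_ne_zero (by rwa [mul_one]) hp0)

end GeneralLinear

/-! ### Traces, norms and Hilbert 90 for an involution. -/

section Involution

variable {F : Type*} [Field F] {σ : F →+* F} (hσ : ∀ c, σ (σ c) = c) (hne : ∃ c, σ c ≠ c)

include hσ hne

/-- The trace to the fixed field is linear over that field and nonzero; were it zero, evaluating at
`1` would force `σ` to be the identity. -/
theorem exists_add_involution_eq {a : F} (ha : σ a = a) : ∃ c, c + σ c = a := by
  obtain ⟨d, hd⟩ : ∃ d, d + σ d ≠ 0 := by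
    by_contra! h
    obtain ⟨c, hc⟩ := hne
    have h1 := h 1
    rw [map_one] at h1
    apply hc
    linear_combination h c - c * h1
  refine ⟨a * (d + σ d)⁻¹ * d, ?_⟩
  rw [map_mul, map_mul, map_inv₀, map_add, hσ, ha, add_comm (σ d) d]
  field_simp

/-- Hilbert 90 for `-α`, with the explicit solution `c - σ(α) σ(c)` for a `c` that makes it nonzero.
-/
theorem exists_involution_eq_mul {α : F} (hα : α * σ α = 1) : ∃ b, b ≠ 0 ∧ σ b = -α * b := by
  obtain ⟨c, hc⟩ : ∃ c, c - σ α * σ c ≠ 0 := by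
    by_contra! h
    obtain ⟨c, hc⟩ := hne
    have h1 := h 1
    rw [map_one, mul_one] at h1
    apply hc
    linear_combination -h c + σ c * h1
  refine ⟨_, hc, ?_⟩
  rw [map_sub, map_mul, hσ, hσ]
  linear_combination - σ c * hα

/-- The norm onto the fixed field of an involution of a finite field is surjective. -/
theorem exists_mul_involution_eq [Finite F] {a : F} (ha : σ a = a) : ∃ c, c * σ c = a := by
  rcases eq_or_ne a 0 with rfl | ha0
  · exact ⟨0, by simp⟩
  let s : Fˣ →* Fˣ := Units.map σ
  let N : Fˣ →* Fˣ := MonoidHom.id _ * s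
  let D : Fˣ →* Fˣ := MonoidHom.id _ / s
  have hN : ∀ u : Fˣ, N u = u * s u := fun u => rfl
  have hD : ∀ u : Fˣ, D u = u / s u := fun u => rfl
  have hs : ∀ u : Fˣ, ((s u : Fˣ) : F) = σ u := fun u => rfl
  have hss : ∀ u : Fˣ, s (s u) = u := fun u => by ext; simp [hs, hσ]
  have h1 : D.range = N.ker := by
    ext u
    rw [MonoidHom.mem_range, MonoidHom.mem_ker, hN]
    constructor
    · rintro ⟨v, rfl⟩
      rw [hD, _root_.map_div, hss]; simp
    · intro hu
      have hu' : (-(u⁻¹ : Fˣ) : F) * σ (-(u⁻¹ : Fˣ) : F) = 1 := by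
        rw [map_neg, neg_mul_neg, ← hs, ← Units.val_mul, map_inv, ← mul_inv, hu, inv_one,
          Units.val_one]
      obtain ⟨b, hb0, hb⟩ := exists_involution_eq_mul hσ hne hu'
      refine ⟨Units.mk0 b hb0, ?_⟩
      rw [hD, div_eq_iff_eq_mul]
      ext
      rw [Units.val_mul, hs, Units.val_mk0, hb, neg_neg, Units.mul_inv_cancel_left]
  have h2 : N.range ≤ D.ker := by
    rintro _ ⟨u, rfl⟩
    rw [MonoidHom.mem_ker, hD, hN, map_mul, hss, mul_comm (s u), div_self']
  have h3 : Nat.card N.ker * Nat.card N.range = Nat.card Fˣ := by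
    rw [← Subgroup.index_ker, Subgroup.card_mul_index]
  have h4 : Nat.card D.ker * Nat.card D.range = Nat.card Fˣ := by
    rw [← Subgroup.index_ker, Subgroup.card_mul_index]
  -- Hilbert 90 identifies `D.range` with `N.ker`; comparing orders in the two exact sequences shows
  -- that the norms fill the group `D.ker` of fixed units.
  have h5 : N.range = D.ker := by
    apply Subgroup.eq_of_le_of_card_ge h2
    rw [h1, ← h3, mul_comm] at h4
    exact (Nat.eq_of_mul_eq_mul_left Nat.card_pos h4).le
  have h6 : Units.mk0 a ha0 ∈ D.ker := by
    rw [MonoidHom.mem_ker, hD, div_eq_one]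
    ext
    rw [hs, Units.val_mk0, ha]
  rw [← h5] at h6
  obtain ⟨c, hc⟩ := h6
  refine ⟨c, ?_⟩
  rw [← hs, ← Units.val_mul, ← hN, hc, Units.val_mk0]

end Involution

/-! ### Vectors of prescribed norm in hermitian spaces. -/

section Hermitian

variable {F U : Type*} [Field F] [AddCommGroup U] [Module F U] {σ : F →+* F}

/-- `h` is a nondegenerate hermitian form for the nontrivial involution `σ`, which is such that
norms to the fixed field are surjective. -/
structure IsHermitian (h : U →ₗ[F] U →ₛₗ[σ] F) : Prop where
  invol : ∀ c, σ (σ c) = c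
  ne : ∃ c, σ c ≠ c
  norm : ∀ a, σ a = a → ∃ c, c * σ c = a
  herm : ∀ x y, σ (h x y) = h y x
  nondeg : ∀ x, (∀ y, h x y = 0) → x = 0

variable {h : U →ₗ[F] U →ₛₗ[σ] F}

/-- The hyperplane of vectors orthogonal to `p`. -/
def perp (h : U →ₗ[F] U →ₛₗ[σ] F) (p : U) : Submodule F U := LinearMap.ker (h.flip p)

theorem mem_perp {p x : U} : x ∈ perp h p ↔ h x p = 0 := by
  rw [perp, LinearMap.mem_ker, LinearMap.flip_apply]

/-- `h` is nondegenerate on `X`. -/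
def NondegenerateOn (h : U →ₗ[F] U →ₛₗ[σ] F) (X : Submodule F U) : Prop :=
  ∀ x ∈ X, (∀ y ∈ X, h x y = 0) → x = 0

theorem finrank_le_inf_perp [Module.Finite F U] (X : Submodule F U) (p : U) :
    Module.finrank F X ≤ Module.finrank F (X ⊓ perp h p : Submodule F U) + 1 := by
  have h1 := Submodule.finrank_sup_add_finrank_inf_eq X (perp h p)
  have h2 := LinearMap.finrank_range_add_finrank_ker (h.flip p)
  have h3 : Module.finrank F (LinearMap.range (h.flip p)) ≤ 1 := by
    simpa using Submodule.finrank_le (LinearMap.range (h.flip p))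
  have h4 := Submodule.finrank_le (X ⊔ perp h p)
  change _ + Module.finrank F (perp h p) = _ at h2
  omega

namespace IsHermitian

variable (hh : IsHermitian h)

include hh

theorem symm_zero {x y : U} (hxy : h x y = 0) : h y x = 0 := by
  rw [← hh.herm, hxy, map_zero]

theorem fixed (x : U) : σ (h x x) = h x x := hh.herm x x

theorem nondegenerateOn_top : NondegenerateOn h ⊤ := fun x _ hx =>
  hh.nondeg x fun y => hx y Submodule.mem_top

theorem nondegenerateOn_inf_perp {X : Submodule F U} (hX : NondegenerateOn h X) {p : U}
    (hp : p ∈ X) (hpp : h p p ≠ 0) : NondegenerateOn h (X ⊓ perp h p) := by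
  intro x hx hxy
  have hxp : h x p = 0 := mem_perp.1 hx.2
  refine hX x hx.1 fun y hy => ?_
  have h1 := hxy (y - (h y p / h p p) • p) ⟨X.sub_mem hy (X.smul_mem _ hp), mem_perp.2 <| by
    rw [map_sub, map_smul, LinearMap.sub_apply, LinearMap.smul_apply, smul_eq_mul,
      div_mul_cancel₀ _ hpp, sub_self]⟩
  rwa [map_sub, LinearMap.map_smulₛₗ, hxp, smul_zero, sub_zero] at h1

theorem nondegenerateOn_inf_perp_perp {X : Submodule F U} (hX : NondegenerateOn h X) {v w : U}
    (hv : v ∈ X) (hw : w ∈ X) (hvv : h v v = 0) (hww : h w w = 0) (hvw : h v w ≠ 0) :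
    NondegenerateOn h (X ⊓ perp h v ⊓ perp h w) := by
  intro x hx hxy
  have hxv : h x v = 0 := mem_perp.1 hx.1.2
  have hxw : h x w = 0 := mem_perp.1 hx.2
  have hwv : h w v ≠ 0 := fun h0 => hvw (hh.symm_zero h0)
  refine hX x hx.1.1 fun y hy => ?_
  have h1 := hxy (y - (h y w / h v w) • v - (h y v / h w v) • w)
    ⟨⟨X.sub_mem (X.sub_mem hy (X.smul_mem _ hv)) (X.smul_mem _ hw), mem_perp.2 <| by
      simp [hvv, hwv]⟩, mem_perp.2 <| by simp [hww, hvw]⟩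
  rwa [map_sub, map_sub, LinearMap.map_smulₛₗ, LinearMap.map_smulₛₗ, hxv, hxw, smul_zero, smul_zero,
    sub_zero, sub_zero] at h1

/-- Some vector of `X` is anisotropic, for otherwise polarisation would make every trace vanish.
Scaling it by an element of suitable norm gives every fixed value. -/
theorem exists_self_eq {X : Submodule F U} (hX : NondegenerateOn h X) (hX0 : X ≠ ⊥) {a : F}
    (ha : σ a = a) : ∃ x ∈ X, h x x = a := by
  obtain ⟨x, hx, hxx⟩ : ∃ x ∈ X, h x x ≠ 0 := by
    by_contra! hcon
    obtain ⟨x, hx, hx0⟩ := Submodule.exists_mem_ne_zero_of_ne_bot hX0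
    obtain ⟨y, hy, hxy⟩ : ∃ y ∈ X, h x y ≠ 0 := by
      by_contra! hc
      exact hx0 (hX x hx hc)
    have h1 : ∀ d : F, d + σ d = 0 := by
      intro d
      have hz : (d / h x y) • x ∈ X := X.smul_mem _ hx
      have h2 := hcon _ (X.add_mem hz hy)
      have h3 : h ((d / h x y) • x) y = d := by simp [hxy]
      rw [map_add, map_add, LinearMap.add_apply, LinearMap.add_apply, hcon _ hz, hcon _ hy, h3,
        ← hh.herm, h3] at h2
      linear_combination h2
    obtain ⟨c, hc⟩ := hh.ne
    have h4 := h1 1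
    rw [map_one] at h4
    apply hc
    linear_combination h1 c - c * h4
  obtain ⟨c, hc⟩ := hh.norm (a / h x x) (by rw [map_div₀, ha, hh.fixed])
  refine ⟨c • x, X.smul_mem _ hx, ?_⟩
  rw [LinearMap.map_smulₛₗ, map_smul, LinearMap.smul_apply, smul_eq_mul, smul_eq_mul]
  field_simp at hc
  linear_combination hc

/-- Only the value zero needs an argument: add orthogonal vectors of norm `1` and `-1`, which
requires dimension two. -/
theorem exists_ne_zero_self_eq [Module.Finite F U] {X : Submodule F U} (hX : NondegenerateOn h X)
    (hX2 : 2 ≤ Module.finrank F X) {a : F} (ha : σ a = a) : ∃ x ∈ X, x ≠ 0 ∧ h x x = a := by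
  have hX0 : X ≠ ⊥ := by rintro rfl; rw [finrank_bot] at hX2; omega
  rcases eq_or_ne a 0 with rfl | ha0
  · obtain ⟨x, hx, hx1⟩ := hh.exists_self_eq hX hX0 (a := 1) (map_one σ)
    have h2 := finrank_le_inf_perp (h := h) X x
    have hY0 : X ⊓ perp h x ≠ ⊥ := by intro h0; rw [h0, finrank_bot] at h2; omega
    obtain ⟨y, hy, hy1⟩ := hh.exists_self_eq
      (hh.nondegenerateOn_inf_perp hX hx (by rw [hx1]; exact one_ne_zero)) hY0 (a := -1) (by simp)
    have hyx := mem_perp.1 hy.2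
    have hxy := hh.symm_zero hyx
    refine ⟨x + y, X.add_mem hx hy.1, fun h0 => ?_, by simp [hx1, hy1, hxy, hyx]⟩
    have : h (x + y) x = 1 := by simp [hx1, hyx]
    rw [h0, map_zero, LinearMap.zero_apply] at this
    exact zero_ne_one this
  · obtain ⟨x, hx, hxa⟩ := hh.exists_self_eq hX hX0 ha
    refine ⟨x, hx, ?_, hxa⟩
    rintro rfl
    exact ha0 (by rw [← hxa, map_zero])

theorem exists_orthonormal [Module.Finite F U] (m : ℕ) (X : Submodule F U)
    (hX : NondegenerateOn h X) (hm : m ≤ Module.finrank F X) :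
    ∃ e : Fin m → U, (∀ i, e i ∈ X) ∧ ∀ i j, h (e i) (e j) = if i = j then 1 else 0 := by
  induction m generalizing X with
  | zero => exact ⟨Fin.elim0, fun i => i.elim0, fun i => i.elim0⟩
  | succ m ih =>
    have hX0 : X ≠ ⊥ := by rintro rfl; rw [finrank_bot] at hm; omega
    obtain ⟨p, hp, hp1⟩ := hh.exists_self_eq hX hX0 (a := 1) (map_one σ)
    have h2 := finrank_le_inf_perp (h := h) X p
    obtain ⟨e, heX, he⟩ := ih (X ⊓ perp h p)
      (hh.nondegenerateOn_inf_perp hX hp (by rw [hp1]; exact one_ne_zero)) (by omega)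
    have hep : ∀ i, h (e i) p = 0 := fun i => mem_perp.1 (heX i).2
    refine ⟨Fin.cons p e, fun i => ?_, fun i j => ?_⟩
    · refine Fin.cases ?_ (fun i => ?_) i
      · simpa using hp
      · simpa using (heX i).1
    · refine Fin.cases ?_ (fun i => ?_) i
      · refine Fin.cases ?_ (fun j => ?_) j
        · simpa using hp1
        · simpa [(Fin.succ_ne_zero j).symm] using hh.symm_zero (hep j)
      · refine Fin.cases ?_ (fun j => ?_) j
        · simpa using hep i
        · simpa using he i j

/-- An orthonormal basis. -/
theorem exists_orthonormal_basis [Module.Finite F U] :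
    ∃ e : Module.Basis (Fin (Module.finrank F U)) F U,
      (∀ i j, h (e i) (e j) = if i = j then 1 else 0) ∧ ∀ x, x = ∑ i, h x (e i) • e i := by
  obtain ⟨e, -, he⟩ := hh.exists_orthonormal (Module.finrank F U) ⊤ hh.nondegenerateOn_top
    (by rw [finrank_top])
  have hsum : ∀ (c : Fin (Module.finrank F U) → F) j, h (∑ i, c i • e i) (e j) = c j := by
    intro c j
    simp [he]
  have hli : LinearIndependent F e := by
    rw [Fintype.linearIndependent_iff]
    intro c hc j
    rw [← hsum c j, hc, map_zero, LinearMap.zero_apply]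
  let b := basisOfLinearIndependentOfCardEqFinrank' e hli (by simp)
  have hb : ∀ i, b i = e i := fun i => by simp [b]
  refine ⟨b, fun i j => by rw [hb, hb, he], fun x => ?_⟩
  simp only [hb]
  conv_lhs => rw [← b.sum_repr x]
  refine Finset.sum_congr rfl fun i _ => ?_
  conv_rhs => rw [← b.sum_repr x]
  simp only [hb]
  rw [hsum]

theorem smul_self_eq {c : F} (hc : c * σ c = 1) (p : U) : h (c • p) (c • p) = h p p := by
  rw [LinearMap.map_smulₛₗ, map_smul, LinearMap.smul_apply, smul_eq_mul, smul_eq_mul]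
  linear_combination h p p * hc

theorem add_self_eq {p v : U} (hv : h v v = 0) (hpv : h p v = 0) : h (p + v) (p + v) = h p p := by
  simp [hv, hpv, hh.symm_zero hpv]

/-- Any two vectors of norm one of a nondegenerate space of dimension at least three are joined by a
chain of vectors of norm one in which neighbours span degenerate planes, up to scalars. -/
theorem chain_norm_one [Module.Finite F U] {X : Submodule F U} (hX : NondegenerateOn h X)
    (hX3 : 3 ≤ Module.finrank F X) (P : U → Prop)
    (hadd : ∀ p ∈ X, ∀ v ∈ X, h p p = 1 → h v v = 0 → h p v = 0 → P p → P (p + v))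
    (hsmul : ∀ p ∈ X, ∀ c : F, h p p = 1 → c * σ c = 1 → P p → P (c • p))
    {p q : U} (hp : p ∈ X) (hq : q ∈ X) (hpp : h p p = 1) (hqq : h q q = 1) (hP : P p) : P q := by
  have hqp : h q p = σ (h p q) := (hh.herm p q).symm
  by_cases hb : h p q * σ (h p q) = 1
  -- Here `h p q • q - p` is isotropic and orthogonal to `p`, so one step and one rescaling suffice.
  · have hb' : σ (h p q) * σ (σ (h p q)) = 1 := by rw [hh.invol, mul_comm, hb]
    have h1 := hadd p hp (h p q • q - p) (X.sub_mem (X.smul_mem _ hq) hp) hpp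
      (by simp [hpp, hqq, hqp]; linear_combination -hb)
      (by simp [hpp]; linear_combination hb) hP
    rw [add_sub_cancel] at h1
    have h2 := hsmul _ (X.smul_mem _ hq) _ (by rw [hh.smul_self_eq hb, hqq]) hb' h1
    rwa [smul_smul, mul_comm, hb, one_smul] at h2
  · set b := h p q with hbdef
    have hD : 1 - b * σ b ≠ 0 := fun h0 => hb (sub_eq_zero.1 h0).symm
    set r := q - σ b • p with hr
    have hrX : r ∈ X := X.sub_mem hq (X.smul_mem _ hp)
    have hrp : h r p = 0 := by simp [hr, hqp, hpp]
    have hrr : h r r = 1 - b * σ b := by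
      simp [hr, hqp, hpp, hqq, hh.invol, ← hbdef]
    have hN1 := hh.nondegenerateOn_inf_perp hX hp (by rw [hpp]; exact one_ne_zero)
    have hN2 := hh.nondegenerateOn_inf_perp hN1 ⟨hrX, mem_perp.2 hrp⟩ (by rw [hrr]; exact hD)
    have hf1 := finrank_le_inf_perp (h := h) X p
    have hf2 := finrank_le_inf_perp (h := h) (X ⊓ perp h p) r
    have hY0 : X ⊓ perp h p ⊓ perp h r ≠ ⊥ := by
      intro h0
      rw [h0, finrank_bot] at hf2
      omega
    set D := 1 - b * σ b
    -- The aim is `s` whose products with `p`, with `q` and with itself are all `1`; then `s - p`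
    -- and `q - s` are admissible steps. The vector `e` solves the first two conditions in the plane
    -- of `p` and `q`, and a vector `w` orthogonal to that plane corrects the norm.
    set e := ((1 - σ b) / D) • p + ((1 - b) / D) • q with he
    have heX : e ∈ X := X.add_mem (X.smul_mem _ hp) (X.smul_mem _ hq)
    have hep : h e p = 1 := by
      simp [he, hpp, hqp]
      field_simp
      simp only [D]; ring
    have heq : h e q = 1 := by
      simp [he, hqq, ← hbdef]
      field_simp
      simp only [D]; ring
    obtain ⟨w, hw, hww⟩ := hh.exists_self_eq hN2 hY0 (a := 1 - h e e)
      (by rw [map_sub, map_one, hh.fixed])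
    have hwp : h w p = 0 := mem_perp.1 hw.1.2
    have hwq : h w q = 0 := by
      have := mem_perp.1 hw.2
      simpa [hr, hwp] using this
    have hew : h e w = 0 := by
      simp [he, hh.symm_zero hwp, hh.symm_zero hwq]
    set s := e + w with hs
    have hsX : s ∈ X := X.add_mem heX hw.1.1
    have hsp : h s p = 1 := by simp [hs, hep, hwp]
    have hsq : h s q = 1 := by simp [hs, heq, hwq]
    have hps : h p s = 1 := by rw [← hh.herm, hsp, map_one]
    have hqs : h q s = 1 := by rw [← hh.herm, hsq, map_one]
    have hss : h s s = 1 := by simp [hs, hew, hh.symm_zero hew, hww]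
    have h1 := hadd p hp (s - p) (X.sub_mem hsX hp) hpp (by simp [hss, hps, hsp, hpp])
      (by simp [hps, hpp]) hP
    rw [add_sub_cancel] at h1
    have h2 := hadd s hsX (q - s) (X.sub_mem hq hsX) hss (by simp [hss, hqs, hsq, hqq])
      (by simp [hsq, hss]) h1
    rwa [add_sub_cancel] at h2

end IsHermitian

end Hermitian

/-! ### Quasi-reflections and their transitivity properties. -/

section Hermitian

variable {F U : Type*} [Field F] [AddCommGroup U] [Module F U] {σ : F →+* F}
  {h : U →ₗ[F] U →ₛₗ[σ] F}

/-- The quasi-reflection `x ↦ x + (β - 1) h(x, p) p` for a vector `p` of norm one. -/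
def qrefl (h : U →ₗ[F] U →ₛₗ[σ] F) {β : F} (hβ : β * σ β = 1) {p : U} (hp : h p p = 1) :
    U ≃ₗ[F] U where
  toFun x := x + ((β - 1) * h x p) • p
  invFun x := x + ((σ β - 1) * h x p) • p
  map_add' x y := by rw [map_add, LinearMap.add_apply]; module
  map_smul' c x := by
    rw [map_smul, LinearMap.smul_apply, smul_eq_mul, RingHom.id_apply]; module
  left_inv x := by
    simp only [map_add, map_smul, LinearMap.add_apply, LinearMap.smul_apply, hp, smul_eq_mul]
    rw [add_assoc, ← add_smul, add_eq_left]
    convert zero_smul F p using 2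
    linear_combination h x p * hβ
  right_inv x := by
    simp only [map_add, map_smul, LinearMap.add_apply, LinearMap.smul_apply, hp, smul_eq_mul]
    rw [add_assoc, ← add_smul, add_eq_left]
    convert zero_smul F p using 2
    linear_combination h x p * hβ

theorem qrefl_apply {β : F} (hβ : β * σ β = 1) {p : U} (hp : h p p = 1) (x : U) :
    qrefl h hβ hp x = x + ((β - 1) * h x p) • p := rfl

theorem qrefl_inv_apply {β : F} (hβ : β * σ β = 1) {p : U} (hp : h p p = 1) (x : U) :
    (qrefl h hβ hp)⁻¹ x = x + ((σ β - 1) * h x p) • p := rfl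

theorem qrefl_apply_self {β : F} (hβ : β * σ β = 1) {p : U} (hp : h p p = 1) :
    qrefl h hβ hp p = β • p := by
  rw [qrefl_apply, hp]; module

theorem qrefl_apply_of_perp {β : F} (hβ : β * σ β = 1) {p : U} (hp : h p p = 1) {x : U}
    (hx : h x p = 0) : qrefl h hβ hp x = x := by
  rw [qrefl_apply, hx, mul_zero, zero_smul, add_zero]

theorem qrefl_inv_apply_of_perp {β : F} (hβ : β * σ β = 1) {p : U} (hp : h p p = 1) {x : U}
    (hx : h x p = 0) : (qrefl h hβ hp)⁻¹ x = x := by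
  rw [qrefl_inv_apply, hx, mul_zero, zero_smul, add_zero]

/-- The isometry group of `h`. -/
def unitaryGroup (h : U →ₗ[F] U →ₛₗ[σ] F) : Subgroup (U ≃ₗ[F] U) where
  carrier := {g | ∀ x y, h (g x) (g y) = h x y}
  one_mem' := fun _ _ => rfl
  mul_mem' := fun {a b} ha hb x y => (ha (b x) (b y)).trans (hb x y)
  inv_mem' := fun {a} ha x y => by
    have h1 := ha (a⁻¹ x) (a⁻¹ y)
    rw [apply_inv_self, apply_inv_self] at h1
    exact h1.symm

theorem norm_apply_of_mem {g : U ≃ₗ[F] U} (hg : g ∈ unitaryGroup h) {p : U} (hp : h p p = 1) :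
    h (g p) (g p) = 1 := (hg p p).trans hp

theorem conj_qrefl {β : F} (hβ : β * σ β = 1) {g : U ≃ₗ[F] U} (hg : g ∈ unitaryGroup h) {p : U}
    (hp : h p p = 1) : g * qrefl h hβ hp * g⁻¹ = qrefl h hβ (norm_apply_of_mem hg hp) := by
  ext x
  obtain ⟨y, rfl⟩ : ∃ y, g y = x := ⟨_, apply_inv_self g x⟩
  rw [LinearEquiv.mul_apply, inv_apply_self, LinearEquiv.mul_apply, qrefl_apply, qrefl_apply,
    map_add, map_smul, hg]

theorem qrefl_congr {β : F} (hβ : β * σ β = 1) {p q : U} (hp : h p p = 1) (hq : h q q = 1)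
    (hpq : p = q) : qrefl h hβ hp = qrefl h hβ hq := by
  subst hpq; rfl

/-- The product `R_q R_p⁻¹` of two quasi-reflections. -/
def qquot (h : U →ₗ[F] U →ₛₗ[σ] F) {β : F} (hβ : β * σ β = 1) {p q : U} (hp : h p p = 1)
    (hq : h q q = 1) : U ≃ₗ[F] U := qrefl h hβ hq * (qrefl h hβ hp)⁻¹

theorem conj_qquot {β : F} (hβ : β * σ β = 1) {g : U ≃ₗ[F] U} (hg : g ∈ unitaryGroup h) {p q : U}
    (hp : h p p = 1) (hq : h q q = 1) : g * qquot h hβ hp hq * g⁻¹ =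
      qquot h hβ (norm_apply_of_mem hg hp) (norm_apply_of_mem hg hq) := by
  rw [qquot, qquot, ← conj_qrefl hβ hg hp, ← conj_qrefl hβ hg hq]
  group

theorem qquot_apply_of_perp {β : F} (hβ : β * σ β = 1) {p q x : U} (hp : h p p = 1)
    (hq : h q q = 1) (hxp : h x p = 0) (hxq : h x q = 0) : qquot h hβ hp hq x = x := by
  rw [qquot, LinearEquiv.mul_apply, qrefl_inv_apply_of_perp hβ hp hxp,
    qrefl_apply_of_perp hβ hq hxq]

namespace IsHermitian

variable (hh : IsHermitian h) {α : F} (hα : α * σ α = 1)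

include hh

theorem qrefl_mem {β : F} (hβ : β * σ β = 1) {p : U} (hp : h p p = 1) :
    qrefl h hβ hp ∈ unitaryGroup h := by
  intro x y
  simp only [qrefl_apply, map_add, LinearMap.map_smulₛₗ, map_smul, LinearMap.add_apply,
    LinearMap.smul_apply, hp, smul_eq_mul, map_mul, map_sub, map_one, hh.herm, mul_one]
  rw [← hh.herm y p, hh.herm]
  linear_combination (h x p * h p y) * hβ

theorem qquot_mem {β : F} (hβ : β * σ β = 1) {p q : U} (hp : h p p = 1) (hq : h q q = 1) :
    qquot h hβ hp hq ∈ unitaryGroup h :=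
  mul_mem (hh.qrefl_mem hβ hq) (inv_mem (hh.qrefl_mem hβ hp))

theorem qrefl_smul {β : F} (hβ : β * σ β = 1) {c : F} (hc : c * σ c = 1) {p : U} (hp : h p p = 1)
    (hp' : h (c • p) (c • p) = 1) : qrefl h hβ hp' = qrefl h hβ hp := by
  ext x
  rw [qrefl_apply, qrefl_apply, LinearMap.map_smulₛₗ, smul_eq_mul, smul_smul]
  congr 2
  linear_combination (β - 1) * h x p * hc

include hα

/-- `R_{p+v} R_p⁻¹` moves `p` to `p + (1 - α⁻¹) v`. -/
theorem qquot_add_apply {p v : U} (hp : h p p = 1) (hpv : h p v = 0)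
    (hq : h (p + v) (p + v) = 1) : qquot h hα hp hq p = p + (1 - σ α) • v := by
  have h1 : (qrefl h hα hp)⁻¹ p = σ α • p := by rw [qrefl_inv_apply, hp]; module
  rw [qquot, LinearEquiv.mul_apply, h1, map_smul, qrefl_apply, map_add, hp, hpv, add_zero, mul_one,
    smul_add, smul_smul, mul_sub, mul_comm (σ α) α, hα]
  module

/-- A chain in which each step is the application of some `R_q R_p⁻¹`, or a scalar. -/
theorem chain_qquot [Module.Finite F U] (hα1 : α ≠ 1) {X : Submodule F U}
    (hX : NondegenerateOn h X) (hX3 : 3 ≤ Module.finrank F X) (P : U → Prop)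
    (hquot : ∀ p ∈ X, ∀ q ∈ X, ∀ (hp : h p p = 1) (hq : h q q = 1), P p → P (qquot h hα hp hq p))
    (hsmul : ∀ p ∈ X, ∀ c : F, h p p = 1 → c * σ c = 1 → P p → P (c • p))
    {p q : U} (hp : p ∈ X) (hq : q ∈ X) (hpp : h p p = 1) (hqq : h q q = 1) (hP : P p) : P q := by
  refine hh.chain_norm_one hX hX3 P (fun p hp v hv hpp hvv hpv hPp => ?_) hsmul hp hq hpp hqq hP
  have hσ1 : 1 - σ α ≠ 0 := by
    intro h0
    apply hα1
    rw [← mul_one α, sub_eq_zero.1 h0, hα, ← sub_eq_zero.1 h0]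
  have hvv' : h ((1 - σ α)⁻¹ • v) ((1 - σ α)⁻¹ • v) = 0 := by simp [hvv]
  have hpv' : h p ((1 - σ α)⁻¹ • v) = 0 := by simp [hpv]
  have hq : h (p + (1 - σ α)⁻¹ • v) (p + (1 - σ α)⁻¹ • v) = 1 := by
    rw [hh.add_self_eq hvv' hpv', hpp]
  have h1 := hquot p hp _ (X.add_mem hp (X.smul_mem _ hv)) hpp hq hPp
  rwa [hh.qquot_add_apply hα hpp hpv', smul_inv_smul₀ hσ1] at h1

/-- The quasi-reflections of a nondegenerate space of dimension at least three act transitively on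
the nonzero isotropic vectors. -/
theorem chain_isotropic [Module.Finite F U] (hα1 : α ≠ 1) {X : Submodule F U}
    (hX : NondegenerateOn h X) (hX3 : 3 ≤ Module.finrank F X) (P : U → Prop)
    (hrefl : ∀ v ∈ X, ∀ s ∈ X, ∀ hs : h s s = 1, h v v = 0 → P v → P (qrefl h hα hs v))
    {v w : U} (hv : v ∈ X) (hw : w ∈ X) (hvv : h v v = 0) (hww : h w w = 0) (hv0 : v ≠ 0)
    (hw0 : w ≠ 0) (hP : P v) : P w := by
  have stepA : ∀ v ∈ X, ∀ w ∈ X, h v v = 0 → h w w = 0 → h v w ≠ 0 →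
      σ (h v w) = -α * h v w → P v → P w := by
    intro v hv w hw hvv hww hvw hb hP
    have hwv : h w v = σ (h v w) := (hh.herm v w).symm
    -- The condition on `h v w` is chosen so that `h d d = (α - 1) h v w`; then the quasi-reflection
    -- in the direction `d` sends `v` exactly to `w`.
    set d := w - v with hd
    have hdd : h d d = (α - 1) * h v w := by
      simp [hd, hvv, hww, hwv, hb]; ring
    have hdd0 : h d d ≠ 0 := by
      rw [hdd]; exact mul_ne_zero (sub_ne_zero.2 hα1) hvw
    obtain ⟨c, hc⟩ := hh.norm (h d d)⁻¹ (by rw [map_inv₀, hh.fixed])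
    have hs : h (c • d) (c • d) = 1 := by
      rw [LinearMap.map_smulₛₗ, map_smul, LinearMap.smul_apply, smul_eq_mul, smul_eq_mul]
      have : c * σ c * h d d = 1 := by rw [hc, inv_mul_cancel₀ hdd0]
      linear_combination this
    have h1 := hrefl v hv (c • d) (X.smul_mem _ (X.sub_mem hw hv)) hs hvv hP
    have hvd : h v d = h v w := by simp [hd, hvv]
    have h2 : qrefl h hα hs v = w := by
      rw [qrefl_apply, LinearMap.map_smulₛₗ, hvd, smul_eq_mul, smul_smul]
      have h3 : (α - 1) * (σ c * h v w) * c = 1 := by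
        have : c * σ c * h d d = 1 := by rw [hc, inv_mul_cancel₀ hdd0]
        rw [hdd] at this
        linear_combination this
      rw [h3, one_smul, hd, add_sub_cancel]
    rwa [h2] at h1
  obtain ⟨b, hb0, hb⟩ := exists_involution_eq_mul hh.invol hh.ne hα
  have stepB : ∀ v ∈ X, ∀ w ∈ X, h v v = 0 → h w w = 0 → h v w ≠ 0 → P v → P w := by
    intro v hv w hw hvv hww hvw hP
    have hwv : h w v = σ (h v w) := (hh.herm v w).symm
    have hN := hh.nondegenerateOn_inf_perp_perp hX hv hw hvv hww hvw
    have hf1 := finrank_le_inf_perp (h := h) X v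
    have hf2 := finrank_le_inf_perp (h := h) (X ⊓ perp h v) w
    have hY0 : X ⊓ perp h v ⊓ perp h w ≠ ⊥ := by
      intro h0
      rw [h0, finrank_bot] at hf2
      omega
    -- An intermediate isotropic vector `u` with `h v u = h u w = b`, where `σ b = -α b`, splits the
    -- move into two moves of the first kind. The vector `e` has these products, and `y` orthogonal
    -- to `v` and `w` makes `e + y` isotropic.
    set e := (b / h v w) • v + σ (b / h v w) • w with he
    obtain ⟨y, hy, hyy⟩ := hh.exists_self_eq hN hY0 (a := -h e e) (by rw [map_neg, hh.fixed])
    have hyv : h y v = 0 := mem_perp.1 hy.1.2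
    have hyw : h y w = 0 := mem_perp.1 hy.2
    have hey : h e y = 0 := by simp [he, hh.symm_zero hyv, hh.symm_zero hyw]
    set u := e + y with hu
    have huX : u ∈ X := X.add_mem (X.add_mem (X.smul_mem _ hv) (X.smul_mem _ hw)) hy.1.1
    have hvu : h v u = b := by
      simp only [hu, he, map_add, LinearMap.map_smulₛₗ, hvv, hh.symm_zero hyv, hh.invol,
        smul_eq_mul]
      field_simp
      ring
    have huw : h u w = b := by
      simp only [hu, he, map_add, map_smul, LinearMap.add_apply, LinearMap.smul_apply, hww, hyw,
        smul_eq_mul]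
      field_simp
      ring
    have huu : h u u = 0 := by
      have : h u u = h e e + h y y + h e y + h y e := by
        simp only [hu, map_add, LinearMap.add_apply]; ring
      rw [this, hyy, hey, hh.symm_zero hey]; ring
    have h1 := stepA v hv u huX hvv huu (by rw [hvu]; exact hb0) (by rw [hvu]; exact hb) hP
    exact stepA u huX w hw huu hww (by rw [huw]; exact hb0) (by rw [huw]; exact hb) h1
  by_cases hvw : h v w = 0
  · obtain ⟨x, hx, hxv, hxw⟩ : ∃ x ∈ X, h v x ≠ 0 ∧ h w x ≠ 0 := by
      obtain ⟨x, hx, hvx⟩ : ∃ x ∈ X, h v x ≠ 0 := by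
        by_contra! hc
        exact hv0 (hX v hv hc)
      obtain ⟨y, hy, hwy⟩ : ∃ x ∈ X, h w x ≠ 0 := by
        by_contra! hc
        exact hw0 (hX w hw hc)
      by_cases h1 : h w x = 0
      · by_cases h2 : h v y = 0
        · exact ⟨x + y, X.add_mem hx hy, by simpa [h2] using hvx, by simpa [h1] using hwy⟩
        · exact ⟨y, hy, h2, hwy⟩
      · exact ⟨x, hx, hvx, h1⟩
    -- Orthogonal `v` and `w` are joined through an isotropic vector orthogonal to neither: `x` is
    -- corrected along `v`, which contributes `c + σ c` to its norm.
    obtain ⟨c, hc⟩ := exists_add_involution_eq hh.invol hh.ne (a := -h x x)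
      (by rw [map_neg, hh.fixed])
    set u := x + (c / h v x) • v with hu
    have huX : u ∈ X := X.add_mem hx (X.smul_mem _ hv)
    have hvu : h v u ≠ 0 := by simpa [hu, hvv] using hxv
    have hwu : h w u ≠ 0 := by simpa [hu, hh.symm_zero hvw] using hxw
    have hxv' : σ (h v x) ≠ 0 := (map_ne_zero σ).2 hxv
    have huu : h u u = 0 := by
      have h1 : h x v = σ (h v x) := (hh.herm v x).symm
      simp only [hu, map_add, LinearMap.map_smulₛₗ, map_smul, LinearMap.add_apply,
        LinearMap.smul_apply, hvv, h1, smul_eq_mul, map_div₀]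
      field_simp
      linear_combination (h v x * σ (h v x)) * hc
    have h1 := stepB v hv u huX hvv huu hvu hP
    exact stepB u huX w hw huu hww (fun h0 => hwu (hh.symm_zero h0)) h1
  · exact stepB v hv w hw hvv hww hvw hP

end IsHermitian

end Hermitian

/-! ### Normal subgroups of the unitary group and linked vectors. -/

section Hermitian

variable {F U : Type*} [Field F] [AddCommGroup U] [Module F U] {σ : F →+* F}
  {h : U →ₗ[F] U →ₛₗ[σ] F}

/-- The vectors `p` and `q` of norm one define quasi-reflections that are congruent modulo `N`. -/
def Linked (N : Subgroup (U ≃ₗ[F] U)) (h : U →ₗ[F] U →ₛₗ[σ] F) {α : F} (hα : α * σ α = 1)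
    (p q : U) : Prop :=
  ∃ (hp : h p p = 1) (hq : h q q = 1), qquot h hα hp hq ∈ N

variable {N : Subgroup (U ≃ₗ[F] U)} {α : F} {hα : α * σ α = 1}

theorem Linked.refl {p : U} (hp : h p p = 1) : Linked N h hα p p :=
  ⟨hp, hp, by rw [qquot, mul_inv_cancel]; exact one_mem _⟩

theorem Linked.trans {p q r : U} (hpq : Linked N h hα p q) (hqr : Linked N h hα q r) :
    Linked N h hα p r := by
  obtain ⟨hp, hq, h1⟩ := hpq
  obtain ⟨_, hr, h2⟩ := hqr
  refine ⟨hp, hr, ?_⟩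
  have := N.mul_mem h2 h1
  rwa [qquot, qquot, ← mul_assoc, inv_mul_cancel_right] at this

theorem Linked.conj {g : U ≃ₗ[F] U} (hg : g ∈ unitaryGroup h) (hgN : ∀ x ∈ N, g * x * g⁻¹ ∈ N)
    {p q : U} (hpq : Linked N h hα p q) : Linked N h hα (g p) (g q) := by
  obtain ⟨hp, hq, h1⟩ := hpq
  refine ⟨norm_apply_of_mem hg hp, norm_apply_of_mem hg hq, ?_⟩
  rw [← conj_qquot hα hg hp hq]
  exact hgN _ h1

/-- `R_{np} R_p⁻¹ = n (R_p n⁻¹ R_p⁻¹)`, and both factors lie in `N`. -/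
theorem Linked.of_mem (hN : N ≤ unitaryGroup h)
    (hNα : ∀ (p : U) (hp : h p p = 1), ∀ x ∈ N, qrefl h hα hp * x * (qrefl h hα hp)⁻¹ ∈ N)
    {n : U ≃ₗ[F] U} (hn : n ∈ N) {p : U} (hp : h p p = 1) : Linked N h hα p (n p) := by
  refine ⟨hp, norm_apply_of_mem (hN hn) hp, ?_⟩
  rw [qquot, ← conj_qrefl hα (hN hn) hp]
  have := N.mul_mem hn (hNα p hp _ (N.inv_mem hn))
  simpa only [mul_assoc] using this

namespace IsHermitian

variable (hh : IsHermitian h)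

include hh

theorem linked_smul_right {c : F} (hc : c * σ c = 1) {p q : U} (hpq : Linked N h hα p q) :
    Linked N h hα p (c • q) := by
  obtain ⟨hp, hq, h1⟩ := hpq
  have hq' : h (c • q) (c • q) = 1 := by rw [hh.smul_self_eq hc, hq]
  exact ⟨hp, hq', by rwa [qquot, hh.qrefl_smul hα hc hq hq']⟩

theorem linked_smul_left {c : F} (hc : c * σ c = 1) {p q : U} (hpq : Linked N h hα p q) :
    Linked N h hα (c • p) q := by
  obtain ⟨hp, hq, h1⟩ := hpq
  have hp' : h (c • p) (c • p) = 1 := by rw [hh.smul_self_eq hc, hp]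
  exact ⟨hp', hq, by rwa [qquot, hh.qrefl_smul hα hc hp hp']⟩

/-- An isometry that fixes all lines spanned by vectors of norm one is a homothety. -/
theorem exists_norm_one_not_mem_span [Module.Finite F U] (hU : 3 ≤ Module.finrank F U)
    {g : U ≃ₗ[F] U} (hg : g ∈ unitaryGroup h) (hgs : ¬ IsHomothety g) :
    ∃ p, h p p = 1 ∧ ∀ c : F, g p ≠ c • p := by
  by_contra! hcon
  apply hgs
  obtain ⟨e, he, -⟩ := hh.exists_orthonormal_basis
  have he1 : ∀ i, h (e i) (e i) = 1 := fun i => by rw [he, if_pos rfl]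
  obtain ⟨c, hc⟩ := hcon _ (he1 ⟨0, by omega⟩)
  have key : ∀ q, h q q = 1 → g q = c • q := by
    intro q hq
    refine hh.chain_norm_one hh.nondegenerateOn_top (by rwa [finrank_top])
      (fun x => g x = c • x) (fun p _ v _ hp hv hpv hP => ?_) (fun p _ d _ _ hP => ?_)
      Submodule.mem_top Submodule.mem_top (he1 ⟨0, by omega⟩) hq hc
    · obtain ⟨d, hd⟩ := hcon (p + v) (by rw [hh.add_self_eq hv hpv, hp])
      have h1 : g v = (d - c) • p + d • v := by
        have : g v = g (p + v) - g p := by rw [map_add, add_sub_cancel_left]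
        rw [this, hd, hP]; module
      -- If `g` multiplies `p` by `c` and `p + v` by `d`, the norm of `g v` is `(d - c) σ(d - c)`,
      -- so isotropy of `v` forces `d = c`.
      have h2 : h (g v) (g v) = 0 := by rw [hg, hv]
      rw [h1] at h2
      simp [hp, hv, hpv, hh.symm_zero hpv] at h2
      have h3 : d = c := by
        rcases h2 with h2 | h2
        · exact sub_eq_zero.1 h2
        · rw [← map_sub, map_eq_zero] at h2
          exact sub_eq_zero.1 h2
      rw [hd, h3]
    · rw [map_smul, hP, smul_comm]
  refine ⟨c, fun v => ?_⟩
  have h1 : g.toLinearMap = c • LinearMap.id := e.ext fun i => by simpa using key _ (he1 i)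
  exact LinearMap.congr_fun h1 v

/-- A normalised subgroup that is not scalar contains a product `R_q R_p⁻¹` for some `p ≠ q` that
span a degenerate plane. -/
theorem exists_linked_add [Module.Finite F U] (hU : 4 ≤ Module.finrank F U) (hα1 : α ≠ 1)
    (hN : N ≤ unitaryGroup h)
    (hNα : ∀ (p : U) (hp : h p p = 1), ∀ x ∈ N, qrefl h hα hp * x * (qrefl h hα hp)⁻¹ ∈ N)
    (hNs : ∃ x ∈ N, ¬ IsHomothety x) :
    ∃ p v, h p p = 1 ∧ v ≠ 0 ∧ h v v = 0 ∧ h v p = 0 ∧ Linked N h hα p (p + v) := by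
  obtain ⟨g, hgN, hgs⟩ := hNs
  obtain ⟨p, hpp, hgp⟩ := hh.exists_norm_one_not_mem_span (by omega) (hN hgN) hgs
  set q := g p with hq
  have hqq : h q q = 1 := norm_apply_of_mem (hN hgN) hpp
  have hpq : Linked N h hα p q := Linked.of_mem hN hNα hgN hpp
  have hqp : h q p = σ (h p q) := (hh.herm p q).symm
  set b := h p q with hb
  by_cases hD : b * σ b = 1
  · refine ⟨p, b • q - p, hpp, fun h0 => ?_, ?_, ?_, ?_⟩
    · apply hgp (σ b)
      rw [← sub_eq_zero.1 h0, smul_smul, mul_comm, hD, one_smul]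
    · simp [hpp, hqq, hqp, ← hb]; linear_combination -hD
    · simp [hpp, hqp]; linear_combination hD
    · rw [add_sub_cancel]
      exact hh.linked_smul_right hD hpq
  · have hD0 : 1 - b * σ b ≠ 0 := fun h0 => hD (sub_eq_zero.1 h0).symm
    have hXn := hh.nondegenerateOn_inf_perp hh.nondegenerateOn_top (p := q) Submodule.mem_top
      (by rw [hqq]; exact one_ne_zero)
    have hf1 := finrank_le_inf_perp (h := h) ⊤ q
    rw [finrank_top] at hf1
    set p₁ := p - b • q with hp1
    have hp1q : h p₁ q = 0 := by simp [hp1, hqq, hb]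
    have hp1p1 : h p₁ p₁ = 1 - b * σ b := by
      simp [hp1, hpp, hqq, hqp, ← hb]; ring
    have hYn := hh.nondegenerateOn_inf_perp hXn (p := p₁) ⟨Submodule.mem_top, mem_perp.2 hp1q⟩
      (by rw [hp1p1]; exact hD0)
    have hf2 := finrank_le_inf_perp (h := h) (⊤ ⊓ perp h q) p₁
    set D := 1 - b * σ b with hDdef
    have hσD : σ D = D := by simp [hDdef, hh.invol, mul_comm]
    -- The coefficient makes `h v p = -σ b`, hence `q + v` orthogonal to `p`; the vector `w` makes
    -- `v` isotropic. When `b = 0` the required norm of `w` is zero and `w` must still be nonzero,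
    -- which needs a complement of dimension two, hence `4 ≤ finrank`.
    set c := -(σ b) / D with hc
    obtain ⟨w, hw, hw0, hww⟩ := hh.exists_ne_zero_self_eq hYn (by omega) (a := -(c * σ c * D))
      (by rw [map_neg, map_mul, map_mul, hh.invol, hσD]; ring)
    have hwq : h w q = 0 := mem_perp.1 hw.1.2
    have hwp1 : h w p₁ = 0 := mem_perp.1 hw.2
    set v := c • p₁ + w with hv
    have hvp1 : h v p₁ = -(σ b) := by
      simp [hv, hwp1, hp1p1, hc]; field_simp
    have hvq : h v q = 0 := by simp [hv, hwq, hp1q]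
    have hvv : h v v = 0 := by
      simp [hv, hwp1, hh.symm_zero hwp1, hp1p1, hww]; ring
    have hv0 : v ≠ 0 := by
      intro h0
      rw [h0, map_zero, LinearMap.zero_apply] at hvp1
      have hc0 : c = 0 := by rw [hc, ← hvp1, zero_div]
      rw [hv, hc0, zero_smul, zero_add] at h0
      exact hw0 h0
    have hvp : h v p = -(σ b) := by
      have : p = p₁ + b • q := by rw [hp1, sub_add_cancel]
      rw [this, map_add, LinearMap.map_smulₛₗ, hvq, smul_zero, add_zero, hvp1]
    have hqv : h q v = 0 := hh.symm_zero hvq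
    have hnn : h (q + v) (q + v) = 1 := by rw [hh.add_self_eq hvv hqv, hqq]
    have horth : h (q + v) p = 0 := by simp [hvp, hqp]
    obtain ⟨hp', hq', hmem⟩ := hpq
    have h1 := Linked.of_mem hN hNα hmem hnn
    -- `R_p` fixes `q + v`, and `R_q` only multiplies its `q`-part by `α`. Rescaling by `σ α` gives
    -- `q + v` plus the isotropic vector `(σ α - 1) v`.
    have h2 : qquot h hα hp' hq' (q + v) = α • q + v := by
      rw [qquot, LinearEquiv.mul_apply, qrefl_inv_apply_of_perp _ _ horth, qrefl_apply, map_add,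
        LinearMap.add_apply, hqq, hvq]
      module
    rw [h2] at h1
    have hσα : σ α * σ (σ α) = 1 := by rw [hh.invol, mul_comm, hα]
    have h3 := hh.linked_smul_right hσα h1
    have h4 : σ α • (α • q + v) = (q + v) + (σ α - 1) • v := by
      rw [smul_add, smul_smul, mul_comm, hα]; module
    rw [h4] at h3
    have hσ1 : σ α - 1 ≠ 0 := by
      intro h0
      apply hα1
      rw [← mul_one α, ← sub_eq_zero.1 h0, hα, sub_eq_zero.1 h0]
    refine ⟨q + v, (σ α - 1) • v, hnn, smul_ne_zero hσ1 hv0, by simp [hvv], by simp [hvv, hvq], h3⟩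

/-- A normalised subgroup that is not scalar contains all products `R_q R_p⁻¹`. -/
theorem linked_of_not_isHomothety [Module.Finite F U] (hU : 4 ≤ Module.finrank F U) (hα1 : α ≠ 1)
    (hN : N ≤ unitaryGroup h)
    (hNα : ∀ (p : U) (hp : h p p = 1), ∀ x ∈ N, qrefl h hα hp * x * (qrefl h hα hp)⁻¹ ∈ N)
    (hNs : ∃ x ∈ N, ¬ IsHomothety x) {p q : U} (hp : h p p = 1) (hq : h q q = 1) :
    Linked N h hα p q := by
  obtain ⟨p₀, v₀, hp₀, hv0, hv₀, hvp₀, hlink⟩ := hh.exists_linked_add hU hα1 hN hNα hNs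
  have hσ1 : 1 - σ α ≠ 0 := by
    intro h0
    apply hα1
    rw [← mul_one α, sub_eq_zero.1 h0, hα, ← sub_eq_zero.1 h0]
  -- Quasi-reflections in vectors orthogonal to `p₀` fix `p₀`, preserve the relation, and are
  -- transitive on the nonzero isotropic vectors of the orthogonal complement of `p₀`.
  have hfull₀ : ∀ v, h v v = 0 → h v p₀ = 0 → Linked N h hα p₀ (p₀ + v) := by
    intro v hv hvp
    by_cases hv' : v = 0
    · subst hv'; rw [add_zero]; exact Linked.refl hp₀
    have hXn := hh.nondegenerateOn_inf_perp hh.nondegenerateOn_top (p := p₀) Submodule.mem_top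
      (by rw [hp₀]; exact one_ne_zero)
    have hf1 := finrank_le_inf_perp (h := h) ⊤ p₀
    rw [finrank_top] at hf1
    refine hh.chain_isotropic hα hα1 hXn (by omega) (fun v => Linked N h hα p₀ (p₀ + v))
      (fun w hw s hs hss hww hP => ?_) (v := v₀) (w := v) ⟨Submodule.mem_top, mem_perp.2 hvp₀⟩
      ⟨Submodule.mem_top, mem_perp.2 hvp⟩ hv₀ hv hv0 hv' hlink
    have h1 := Linked.conj (hh.qrefl_mem hα hss) (hNα s hss) hP
    rwa [map_add, qrefl_apply_of_perp hα hss (hh.symm_zero (mem_perp.1 hs.2))] at h1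
  -- The property passes from `p` to `p + v`: after rescaling `v`, it supplies an element of `N`
  -- sending `p` to `p + v`, and conjugation by this element moves the property along.
  have hfull : ∀ p, h p p = 1 → ∀ v, h v v = 0 → h v p = 0 → Linked N h hα p (p + v) := by
    intro p hp
    refine hh.chain_norm_one hh.nondegenerateOn_top (by rw [finrank_top]; omega)
      (fun p => ∀ v, h v v = 0 → h v p = 0 → Linked N h hα p (p + v))
      (fun p _ v _ hp hv hpv hP => ?_) (fun p _ c hp hc hP v hv hvp => ?_)
      Submodule.mem_top Submodule.mem_top hp₀ hp hfull₀
    · have hvv' : h ((1 - σ α)⁻¹ • v) ((1 - σ α)⁻¹ • v) = 0 := by simp [hv]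
      have hpv' : h p ((1 - σ α)⁻¹ • v) = 0 := by simp [hpv]
      obtain ⟨hp', hq, hmem⟩ := hP _ hvv' (hh.symm_zero hpv')
      have h1 := hh.qquot_add_apply hα hp' hpv' hq
      rw [smul_inv_smul₀ hσ1] at h1
      rw [← h1]
      intro w hww hwp
      have hginv := inv_mem (hN hmem)
      have h2 := hP ((qquot h hα hp' hq)⁻¹ w) (by rw [hginv, hww]) (by
        rw [← hN hmem, apply_inv_self]; exact hwp)
      have h3 := Linked.conj (hN hmem)
        (fun x hx => N.mul_mem (N.mul_mem hmem hx) (N.inv_mem hmem)) h2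
      rwa [map_add, apply_inv_self] at h3
    · have hσc : σ c * σ (σ c) = 1 := by rw [hh.invol, mul_comm, hc]
      have h1 := hP (σ c • v) (by simp [hv]) (by
        have hc0 : σ c ≠ 0 := by intro h0; rw [h0, mul_zero] at hc; exact zero_ne_one hc
        rw [LinearMap.map_smulₛₗ, smul_eq_mul] at hvp
        simp [(mul_eq_zero.1 hvp).resolve_left hc0])
      have h2 := hh.linked_smul_left hc (hh.linked_smul_right hc h1)
      rwa [smul_add, smul_smul, hc, one_smul] at h2
  exact hh.chain_norm_one hh.nondegenerateOn_top (by rw [finrank_top]; omega)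
    (fun x => Linked N h hα p x)
    (fun x _ v _ hx hv hxv hP => hP.trans (hfull x hx v hv (hh.symm_zero hxv)))
    (fun x _ c _ hc hP => hh.linked_smul_right hc hP)
    Submodule.mem_top Submodule.mem_top hp hq (Linked.refl hp)

end IsHermitian

end Hermitian

/-! ### The quotient by the products of quasi-reflections is abelian. -/

section Hermitian

variable {F U : Type*} [Field F] [AddCommGroup U] [Module F U] {σ : F →+* F}
  {h : U →ₗ[F] U →ₛₗ[σ] F}

namespace IsHermitian

variable (hh : IsHermitian h) {α : F} (hα : α * σ α = 1)

include hh

section Quotient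

variable [Module.Finite F U] (hU : 4 ≤ Module.finrank F U) (hα1 : α ≠ 1) {Q : Type*} [Group Q]
  (φ : unitaryGroup h →* Q)
  (hφ : ∀ (p q : U) (hp : h p p = 1) (hq : h q q = 1),
    φ ⟨qquot h hα hp hq, hh.qquot_mem hα hp hq⟩ = 1)

include hU hα1 hφ

/-- The products `R_y R_x⁻¹` lie in the kernel of `φ`, and they move `p` along the chain up to
scalars of norm one. -/
theorem exists_map_eq_one_apply_eq_smul {p q : U} (hp : h p p = 1) (hq : h q q = 1) :
    ∃ n : unitaryGroup h, φ n = 1 ∧ ∃ c : F, c * σ c = 1 ∧ (n : U ≃ₗ[F] U) p = c • q := by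
  refine hh.chain_qquot hα hα1 hh.nondegenerateOn_top (by rw [finrank_top]; omega)
    (fun x => ∃ n : unitaryGroup h, φ n = 1 ∧ ∃ c : F, c * σ c = 1 ∧ (n : U ≃ₗ[F] U) p = c • x)
    ?_ ?_ Submodule.mem_top Submodule.mem_top hp hq ⟨1, map_one φ, 1, by simp, by simp⟩
  · rintro x - y - hx hy ⟨n, hn, c, hc, hnp⟩
    refine ⟨⟨_, hh.qquot_mem hα hx hy⟩ * n, by rw [map_mul, hn, hφ, mul_one], c, hc, ?_⟩
    rw [Subgroup.coe_mul, LinearEquiv.mul_apply, hnp, map_smul]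
  · rintro x - d hx hd ⟨n, hn, c, hc, hnp⟩
    refine ⟨n, hn, c * σ d, ?_, ?_⟩
    · rw [map_mul, hh.invol]; linear_combination hc + c * σ c * hd
    · rw [hnp, smul_smul, mul_assoc, mul_comm (σ d), hd, mul_one]

/-- Conjugation of `R_p` by `y` gives the quasi-reflection at `y p`, which is also a conjugate of
`R_p` by an element of the kernel. The multiplier `β` may differ from `α`, because kernel elements
act on norm-one lines independently of `β`. -/
theorem commute_map_qrefl {β : F} (hβ : β * σ β = 1) {p : U} (hp : h p p = 1)
    (y : unitaryGroup h) : Commute (φ ⟨qrefl h hβ hp, hh.qrefl_mem hβ hp⟩) (φ y) := by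
  obtain ⟨n, hn, c, hc, hnp⟩ := hh.exists_map_eq_one_apply_eq_smul hα hU hα1 φ hφ hp
    (norm_apply_of_mem y.2 hp)
  set R : unitaryGroup h := ⟨qrefl h hβ hp, hh.qrefl_mem hβ hp⟩ with hR
  have h1 : n * R * n⁻¹ = y * R * y⁻¹ := by
    ext1
    change (n : U ≃ₗ[F] U) * qrefl h hβ hp * (n : U ≃ₗ[F] U)⁻¹ =
      (y : U ≃ₗ[F] U) * qrefl h hβ hp * (y : U ≃ₗ[F] U)⁻¹
    rw [conj_qrefl hβ n.2 hp, conj_qrefl hβ y.2 hp]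
    have h2 : h (c • (y : U ≃ₗ[F] U) p) (c • (y : U ≃ₗ[F] U) p) = 1 := by
      rw [← hnp]; exact norm_apply_of_mem n.2 hp
    rw [qrefl_congr hβ _ h2 hnp, hh.qrefl_smul hβ hc]
  have h2 := congrArg φ h1
  rw [map_mul, map_mul, map_inv, hn, one_mul, inv_one, mul_one, map_mul, map_mul, map_inv,
    eq_mul_inv_iff_mul_eq] at h2
  exact h2

/-- The scalars left over in the chain are removed by quasi-reflections of arbitrary multiplier,
whose images are central. All maps used have centres in `X`, so they fix its orthogonal complement.
-/
theorem exists_central_apply_eq {X : Submodule F U} (hX : NondegenerateOn h X)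
    (hX3 : 3 ≤ Module.finrank F X) {p q : U} (hpX : p ∈ X) (hqX : q ∈ X) (hp : h p p = 1)
    (hq : h q q = 1) : ∃ z : unitaryGroup h, (∀ y, Commute (φ z) (φ y)) ∧
      (z : U ≃ₗ[F] U) p = q ∧ ∀ x, (∀ y ∈ X, h x y = 0) → (z : U ≃ₗ[F] U) x = x := by
  refine hh.chain_qquot hα hα1 hX hX3 (fun q => ∃ z : unitaryGroup h, (∀ y, Commute (φ z) (φ y)) ∧
      (z : U ≃ₗ[F] U) p = q ∧ ∀ x, (∀ y ∈ X, h x y = 0) → (z : U ≃ₗ[F] U) x = x)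
    ?_ ?_ hpX hqX hp hq ⟨1, fun y => by rw [map_one]; exact Commute.one_left _, by simp, by simp⟩
  · rintro x hx y hy hxx hyy ⟨z, hz, hzp, hzf⟩
    refine ⟨⟨_, hh.qquot_mem hα hxx hyy⟩ * z, fun y => ?_, ?_, fun w hw => ?_⟩
    · rw [map_mul, hφ, one_mul]; exact hz y
    · rw [Subgroup.coe_mul, LinearEquiv.mul_apply, hzp]
    · rw [Subgroup.coe_mul, LinearEquiv.mul_apply, hzf w hw,
        qquot_apply_of_perp hα hxx hyy (hw x hx) (hw y hy)]
  · rintro x hx c hxx hc ⟨z, hz, hzp, hzf⟩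
    refine ⟨⟨_, hh.qrefl_mem hc hxx⟩ * z, fun y => ?_, ?_, fun w hw => ?_⟩
    · rw [map_mul]
      exact (hh.commute_map_qrefl hα hU hα1 φ hφ hc hxx y).mul_left (hz y)
    · rw [Subgroup.coe_mul, LinearEquiv.mul_apply, hzp, qrefl_apply_self]
    · rw [Subgroup.coe_mul, LinearEquiv.mul_apply, hzf w hw, qrefl_apply_of_perp hc hxx (hw x hx)]

/-- The images of the orthonormal basis vectors are moved back one at a time, each inside the
orthogonal complement of those already fixed. This complement must have dimension at least three, so
two basis vectors remain. -/
theorem exists_central_mul_fix {e : Module.Basis (Fin (Module.finrank F U)) F U}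
    (he : ∀ i j, h (e i) (e j) = if i = j then 1 else 0) (hsum : ∀ x, x = ∑ i, h x (e i) • e i)
    (g : unitaryGroup h) (k : ℕ) (hk : k + 2 ≤ Module.finrank F U) :
    ∃ z u : unitaryGroup h, (∀ y, Commute (φ z) (φ y)) ∧ g = z * u ∧
      ∀ i : Fin (Module.finrank F U), (i : ℕ) < k → (u : U ≃ₗ[F] U) (e i) = e i := by
  induction k with
  | zero => exact ⟨1, g, fun y => by rw [map_one]; exact Commute.one_left _, by simp, by simp⟩
  | succ k ih =>
    obtain ⟨z, u, hz, rfl, hu⟩ := ih (by omega)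
    let X : Submodule F U := ⨅ i : {i : Fin (Module.finrank F U) // (i : ℕ) < k}, perp h (e i)
    have hmem : ∀ x, x ∈ X ↔ ∀ i : Fin (Module.finrank F U), (i : ℕ) < k → h x (e i) = 0 := by
      intro x
      simp [X, Submodule.mem_iInf, mem_perp]
    have heX : ∀ i : Fin (Module.finrank F U), k ≤ i → e i ∈ X := by
      intro i hi
      rw [hmem]
      intro j hj
      rw [he, if_neg]
      rintro rfl
      omega
    have hXn : NondegenerateOn h X := by
      intro x hx hxy
      rw [hsum x]
      refine Finset.sum_eq_zero fun i _ => ?_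
      rcases lt_or_ge (i : ℕ) k with hi | hi
      · rw [(hmem x).1 hx i hi, zero_smul]
      · rw [hxy _ (heX i hi), zero_smul]
    have hX3 : 3 ≤ Module.finrank F X := by
      let f : Fin 3 → X := fun j => ⟨e ⟨k + j, by omega⟩, heX _ (by simp)⟩
      have hf : LinearIndependent F f := by
        apply LinearIndependent.of_comp X.subtype
        exact e.linearIndependent.comp (fun j : Fin 3 => (⟨k + j, by omega⟩ : Fin _))
          (fun a b hab => by
            have := congrArg Fin.val hab
            ext; simpa using this)
      simpa using hf.fintype_card_le_finrank
    have hk' : k < Module.finrank F U := by omega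
    have huX : (u : U ≃ₗ[F] U) (e ⟨k, hk'⟩) ∈ X := by
      rw [hmem]
      intro i hi
      rw [← hu i hi, u.2, he, if_neg]
      rintro rfl
      exact lt_irrefl _ hi
    obtain ⟨z', hz', hze, hzf⟩ := hh.exists_central_apply_eq hα hU hα1 φ hφ hXn hX3 huX
      (heX ⟨k, hk'⟩ le_rfl) (by rw [u.2, he, if_pos rfl]) (by rw [he, if_pos rfl])
    refine ⟨z * z'⁻¹, z' * u, fun y => ?_, by group, fun i hi => ?_⟩
    · rw [map_mul, map_inv]
      exact (hz y).mul_left (hz' y).inv_left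
    · rw [Subgroup.coe_mul, LinearEquiv.mul_apply]
      rcases Nat.lt_succ_iff_lt_or_eq.1 hi with hi | hi
      · rw [hu i hi]
        exact hzf _ fun y hy => hh.symm_zero ((hmem y).1 hy i hi)
      · have : i = ⟨k, hk'⟩ := Fin.ext hi
        rw [this, hze]

/-- In the quotient by the normal subgroup generated by the `R_q R_p⁻¹` all isometries commute. -/
theorem commute_map_of_map_qquot_eq_one (x y : unitaryGroup h) : Commute (φ x) (φ y) := by
  obtain ⟨e, he, hsum⟩ := hh.exists_orthonormal_basis
  obtain ⟨m, hm⟩ : ∃ m, Module.finrank F U = m + 2 := ⟨_, (Nat.sub_add_cancel (by omega)).symm⟩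
  obtain ⟨z, u, hz, rfl, hu⟩ := hh.exists_central_mul_fix hα hU hα1 φ hφ he hsum x m hm.ge
  obtain ⟨z', u', hz', rfl, hu'⟩ := hh.exists_central_mul_fix hα hU hα1 φ hφ he hsum y m hm.ge
  have he1 : ∀ i, h (e i) (e i) = 1 := fun i => by rw [he, if_pos rfl]
  have he0 : ∀ i j, i ≠ j → h (e i) (e j) = 0 := fun i j hij => by rw [he, if_neg hij]
  let a : Fin (Module.finrank F U) := ⟨m, by omega⟩
  let b : Fin (Module.finrank F U) := ⟨m + 1, by omega⟩
  let c : Fin (Module.finrank F U) := ⟨0, by omega⟩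
  let d : Fin (Module.finrank F U) := ⟨1, by omega⟩
  have hne : ∀ {i j : Fin (Module.finrank F U)}, (i : ℕ) ≠ j → i ≠ j := fun hij h0 =>
    hij (congrArg Fin.val h0)
  -- an isometry fixing the first `m` basis vectors fixes the complement of the last two
  have hfix : ∀ v : unitaryGroup h, (∀ i : Fin _, (i : ℕ) < m → (v : U ≃ₗ[F] U) (e i) = e i) →
      ∀ x, h x (e a) = 0 → h x (e b) = 0 → (v : U ≃ₗ[F] U) x = x := by
    intro v hv x hxa hxb
    conv_lhs => rw [hsum x]
    conv_rhs => rw [hsum x]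
    rw [map_sum]
    refine Finset.sum_congr rfl fun i _ => ?_
    rw [map_smul]
    rcases lt_trichotomy (i : ℕ) m with hi | hi | hi
    · rw [hv i hi]
    · have : i = a := Fin.ext hi
      rw [this, hxa, zero_smul, zero_smul]
    · have : i = b := Fin.ext (by change (i : ℕ) = m + 1; omega)
      rw [this, hxb, zero_smul, zero_smul]
  have hsub : ∀ v : unitaryGroup h, (∀ i : Fin _, (i : ℕ) < m → (v : U ≃ₗ[F] U) (e i) = e i) →
      ∀ x, ∃ r s : F, (v : U ≃ₗ[F] U) x = x + (r • e a + s • e b) := by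
    intro v hv x
    refine ⟨h ((v : U ≃ₗ[F] U) x - x) (e a), h ((v : U ≃ₗ[F] U) x - x) (e b), ?_⟩
    rw [← sub_eq_iff_eq_add']
    set y := (v : U ≃ₗ[F] U) x - x with hy
    have hab : a ≠ b := hne (by change m ≠ m + 1; omega)
    have h1 : ∀ i, i ≠ a ∧ i ≠ b → h y (e i) • e i = 0 := by
      rintro i ⟨hia, hib⟩
      have hi : (i : ℕ) < m := by
        have h1 : (i : ℕ) ≠ m := fun h0 => hia (Fin.ext h0)
        have h2 : (i : ℕ) ≠ m + 1 := fun h0 => hib (Fin.ext h0)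
        omega
      have : h y (e i) = 0 := by
        rw [hy, map_sub, LinearMap.sub_apply]
        conv_lhs => enter [1, 2]; rw [← hv i hi]
        rw [v.2, sub_self]
      rw [this, zero_smul]
    conv_lhs => rw [hsum y]
    exact Fintype.sum_eq_add a b hab h1
  obtain ⟨w₁, hw₁, hw₁a, -⟩ := hh.exists_central_apply_eq hα hU hα1 φ hφ hh.nondegenerateOn_top
    (by rw [finrank_top]; omega) (Submodule.mem_top (x := e a)) (Submodule.mem_top (x := e c))
    (he1 a) (he1 c)
  have hf1 := finrank_le_inf_perp (h := h) ⊤ (e c)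
  rw [finrank_top] at hf1
  obtain ⟨w₂, hw₂, hw₂b, hw₂f⟩ := hh.exists_central_apply_eq hα hU hα1 φ hφ
    (hh.nondegenerateOn_inf_perp hh.nondegenerateOn_top (p := e c) Submodule.mem_top
      (by rw [he1]; exact one_ne_zero)) (by omega) (p := (w₁ : U ≃ₗ[F] U) (e b)) (q := e d)
    ⟨Submodule.mem_top, mem_perp.2 (by
      rw [← hw₁a, w₁.2]; exact he0 _ _ (hne (by change m + 1 ≠ m; omega)))⟩
    ⟨Submodule.mem_top, mem_perp.2 (he0 _ _ (hne (by change 1 ≠ 0; omega)))⟩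
    (by rw [w₁.2, he1]) (he1 d)
  -- `w` has central image and carries the last two basis vectors to the first two, so conjugating
  -- `u'` by it does not change `φ u'`.
  set w := w₂ * w₁ with hw
  have hwa : (w : U ≃ₗ[F] U) (e a) = e c := by
    rw [hw, Subgroup.coe_mul, LinearEquiv.mul_apply, hw₁a]
    exact hw₂f _ fun y hy => hh.symm_zero (mem_perp.1 hy.2)
  have hwb : (w : U ≃ₗ[F] U) (e b) = e d := by
    rw [hw, Subgroup.coe_mul, LinearEquiv.mul_apply, hw₂b]
  -- The two isometries live on orthogonal coordinate planes, which are disjoint because the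
  -- dimension is at least four.
  have hcomm : Commute u (w * u' * w⁻¹) := by
    have happ : ∀ x, ((w * u' * w⁻¹ : unitaryGroup h) : U ≃ₗ[F] U) x =
        (w : U ≃ₗ[F] U) ((u' : U ≃ₗ[F] U) ((w : U ≃ₗ[F] U)⁻¹ x)) := fun x => rfl
    have hfa : ∀ i : Fin (Module.finrank F U), (i : ℕ) ≠ 0 → (i : ℕ) ≠ 1 →
        ((w * u' * w⁻¹ : unitaryGroup h) : U ≃ₗ[F] U) (e i) = e i := by
      intro i hi0 hi1
      rw [happ, hfix u' hu', apply_inv_self]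
      · rw [← w.2, apply_inv_self, hwa]
        exact he0 _ _ (hne hi0)
      · rw [← w.2, apply_inv_self, hwb]
        exact he0 _ _ (hne hi1)
    generalize w * u' * w⁻¹ = v at happ hfa ⊢
    ext x
    rw [Subgroup.coe_mul, Subgroup.coe_mul, LinearEquiv.mul_apply, LinearEquiv.mul_apply]
    obtain ⟨r, s, hrs⟩ := hsub u hu x
    obtain ⟨r', s', hrs'⟩ := hsub u' hu' ((w : U ≃ₗ[F] U)⁻¹ x)
    have h1 : (v : U ≃ₗ[F] U) x = x + (r' • e c + s' • e d) := by
      rw [happ, hrs', map_add, map_add, map_smul, map_smul, hwa, hwb, apply_inv_self]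
    rw [hrs, map_add _ x, h1, map_add _ x, hrs, map_add, map_add, map_smul, map_smul, map_smul,
      map_smul, hu c (by change 0 < m; omega), hu d (by change 1 < m; omega),
      hfa a (by change m ≠ 0; omega) (by change m ≠ 1; omega),
      hfa b (by change m + 1 ≠ 0; omega) (by change m + 1 ≠ 1; omega)]
    abel
  have hwc : ∀ y, Commute (φ w) (φ y) := fun y => by
    rw [hw, map_mul]
    exact (hw₂ y).mul_left (hw₁ y)
  have huu : Commute (φ u) (φ u') := by
    have := hcomm.map φ
    rwa [map_mul, map_mul, map_inv, (hwc u').eq, mul_inv_cancel_right] at this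
  rw [map_mul, map_mul]
  exact Commute.mul_left (hz _ |>.mul_right (by simpa using hz u'))
    (((hz' u).symm).mul_right huu)

end Quotient

end IsHermitian

end Hermitian

/-! ### Unitary root subgroups and the unitary factor. -/

section Hermitian

variable {F U : Type*} [Field F] [AddCommGroup U] [Module F U] {σ : F →+* F}
  {h : U →ₗ[F] U →ₛₗ[σ] F}

/-- The isometry `x ↦ x + σ(c) h(x, v) w - c h(x, w) v` attached to a totally isotropic plane. -/
def eichler (h : U →ₗ[F] U →ₛₗ[σ] F) {v w : U} (hvv : h v v = 0) (hww : h w w = 0)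
    (hvw : h v w = 0) (hwv : h w v = 0) (c : F) : U ≃ₗ[F] U where
  toFun x := x + ((σ c * h x v) • w - (c * h x w) • v)
  invFun x := x - ((σ c * h x v) • w - (c * h x w) • v)
  map_add' x y := by simp only [map_add, LinearMap.add_apply]; module
  map_smul' d x := by
    simp only [map_smul, LinearMap.smul_apply, smul_eq_mul, RingHom.id_apply]; module
  left_inv x := by
    simp only [map_add, map_sub, map_smul, LinearMap.add_apply, LinearMap.sub_apply,
      LinearMap.smul_apply, hvv, hww, hvw, hwv, smul_zero, sub_zero, add_zero, add_sub_cancel_right]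
  right_inv x := by
    simp only [map_sub, map_smul, LinearMap.sub_apply,
      LinearMap.smul_apply, hvv, hww, hvw, hwv, smul_zero, sub_zero, sub_add_cancel]

section Eichler

variable {v w : U} (hvv : h v v = 0) (hww : h w w = 0) (hvw : h v w = 0) (hwv : h w v = 0)

theorem eichler_apply (c : F) (x : U) :
    eichler h hvv hww hvw hwv c x = x + ((σ c * h x v) • w - (c * h x w) • v) := rfl

theorem eichler_add (c d : F) : eichler h hvv hww hvw hwv (c + d) =
    eichler h hvv hww hvw hwv c * eichler h hvv hww hvw hwv d := by
  ext x
  simp only [LinearEquiv.mul_apply, eichler_apply, map_add, map_sub, map_smul, hvv, hww, hvw, hwv]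
  module

theorem eichler_apply_right (c : F) : eichler h hvv hww hvw hwv c w = w := by
  rw [eichler_apply, hwv, hww]; simp

/-- Conjugation by an isometry replaces `v`, `w` by `t v = α v` and `t w = w`; the scalar can be
absorbed into `c`. -/
theorem eichler_conj {t : U ≃ₗ[F] U} (ht : t ∈ unitaryGroup h) {α : F}
    (htv : t v = α • v) (htw : t w = w) (c : F) :
    t * eichler h hvv hww hvw hwv c * t⁻¹ = eichler h hvv hww hvw hwv (α * c) := by
  rw [mul_inv_eq_iff_eq_mul]
  ext x
  have h1 : h (t x) w = h x w := by
    conv_lhs => rw [← htw]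
    exact ht x w
  have h2 : σ α * h (t x) v = h x v := by
    have := ht x v
    rwa [htv, LinearMap.map_smulₛₗ, smul_eq_mul] at this
  rw [LinearEquiv.mul_apply, LinearEquiv.mul_apply, eichler_apply, eichler_apply, map_add, map_sub,
    map_smul, map_smul, htv, htw, h1, ← h2, map_mul]
  module

end Eichler

namespace IsHermitian

variable (hh : IsHermitian h) {α : F} (hα : α * σ α = 1)

include hh

theorem eichler_mem {v w : U} (hvv : h v v = 0) (hww : h w w = 0) (hvw : h v w = 0)
    (hwv : h w v = 0) (c : F) : eichler h hvv hww hvw hwv c ∈ unitaryGroup h := by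
  intro x y
  simp only [eichler_apply, map_add, map_sub, LinearMap.map_smulₛₗ, map_smul, LinearMap.add_apply,
    LinearMap.sub_apply, LinearMap.smul_apply, hvv, hww, hvw, hwv, smul_eq_mul, map_mul, hh.invol,
    hh.herm]
  ring

/-- A homology that is an isometry is a quasi-reflection. -/
theorem exists_eq_qrefl {a : U ≃ₗ[F] U} (hα1 : α ≠ 1) (ha : IsHomology α a)
    (hG : a ∈ unitaryGroup h) : ∃ (hα : α * σ α = 1) (p : U) (hp : h p p = 1),
      a = qrefl h hα hp := by
  obtain ⟨f, p, hfp, ha⟩ := ha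
  have hp0 : p ≠ 0 := ne_zero_of_dual_apply_eq hα1 hfp
  have hap : a p = α • p := by rw [ha, hfp]; module
  have h1 : ∀ x, σ α * (h x p + f x * h p p) = h x p := by
    intro x
    have := hG x p
    rw [hap, ha, LinearMap.map_smulₛₗ, map_add, map_smul, LinearMap.add_apply, LinearMap.smul_apply,
      smul_eq_mul, smul_eq_mul] at this
    exact this
  have hpp : h p p ≠ 0 := by
    intro h0
    apply hp0
    have hσ1 : σ α - 1 ≠ 0 := by
      intro h2
      apply hα1
      rw [← hh.invol α, sub_eq_zero.1 h2, map_one]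
    refine hh.nondeg p fun x => hh.symm_zero ?_
    have := h1 x
    rw [h0, mul_zero, add_zero] at this
    have h3 : (σ α - 1) * h x p = 0 := by linear_combination this
    exact (mul_eq_zero.1 h3).resolve_left hσ1
  have hα : α * σ α = 1 := by
    have := h1 p
    rw [hfp] at this
    apply mul_right_cancel₀ hpp
    linear_combination this
  obtain ⟨c, hc⟩ := hh.norm (h p p)⁻¹ (by rw [map_inv₀, hh.fixed])
  have hc1 : c * σ c * h p p = 1 := by rw [hc, inv_mul_cancel₀ hpp]
  have hpc : h (c • p) (c • p) = 1 := by
    rw [LinearMap.map_smulₛₗ, map_smul, LinearMap.smul_apply, smul_eq_mul, smul_eq_mul]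
    linear_combination hc1
  refine ⟨hα, c • p, hpc, ?_⟩
  ext x
  rw [ha, qrefl_apply, LinearMap.map_smulₛₗ, smul_eq_mul, smul_smul]
  congr 2
  apply mul_right_cancel₀ hpp
  linear_combination α * h1 x - (h x p + f x * h p p) * hα - (α - 1) * h x p * hc1

theorem exists_mem_apply_eq [Module.Finite F U] (hU : 3 ≤ Module.finrank F U) {p q : U}
    (hp : h p p = 1) (hq : h q q = 1) (hα : α * σ α = 1) (hα1 : α ≠ 1) :
    ∃ g ∈ unitaryGroup h, g p = q := by
  refine hh.chain_qquot hα hα1 hh.nondegenerateOn_top (by rwa [finrank_top])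
    (fun q => ∃ g ∈ unitaryGroup h, g p = q) ?_ ?_ Submodule.mem_top Submodule.mem_top hp hq
    ⟨1, one_mem _, rfl⟩
  · rintro x - y - hx hy ⟨g, hg, rfl⟩
    exact ⟨_, mul_mem (hh.qquot_mem hα hx hy) hg, rfl⟩
  · rintro x - c hx hc ⟨g, hg, rfl⟩
    exact ⟨_, mul_mem (hh.qrefl_mem hc hx) hg, qrefl_apply_self hc hx⟩

/-- If the isometry `g` sends `p` to `q`, then `R_q R_p⁻¹` is the commutator of `g` and `R_p`. -/
theorem qquot_mem_commutator [Module.Finite F U] (hU : 3 ≤ Module.finrank F U) (hα1 : α ≠ 1)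
    {p q : U} (hp : h p p = 1) (hq : h q q = 1) :
    qquot h hα hp hq ∈ ⁅unitaryGroup h, unitaryGroup h⁆ := by
  obtain ⟨g, hg, rfl⟩ := hh.exists_mem_apply_eq hU hp hq hα hα1
  rw [qquot, ← conj_qrefl hα hg hp]
  exact Subgroup.commutator_mem_commutator hg (hh.qrefl_mem hα hp)

theorem commutator_le_of_qquot_mem [Module.Finite F U] (hU : 4 ≤ Module.finrank F U)
    (hα1 : α ≠ 1) {N : Subgroup (U ≃ₗ[F] U)}
    (hN : ∀ (p q : U) (hp : h p p = 1) (hq : h q q = 1), qquot h hα hp hq ∈ N) :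
    ⁅unitaryGroup h, unitaryGroup h⁆ ≤ N := by
  let s : Set (unitaryGroup h) :=
    {x | ∃ (p q : U) (hp : h p p = 1) (hq : h q q = 1), (x : U ≃ₗ[F] U) = qquot h hα hp hq}
  have hs : Subgroup.normalClosure s ≤ N.subgroupOf (unitaryGroup h) := by
    refine (Subgroup.closure_le _).2 fun x hx => ?_
    obtain ⟨y, ⟨p, q, hp, hq, hy⟩, hyx⟩ := Group.mem_conjugatesOfSet_iff.1 hx
    obtain ⟨g, rfl⟩ := isConj_iff.1 hyx
    change (g : U ≃ₗ[F] U) * (y : U ≃ₗ[F] U) * (g : U ≃ₗ[F] U)⁻¹ ∈ N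
    rw [hy, conj_qquot hα g.2 hp hq]
    exact hN _ _ _ _
  have hcomm := hh.commute_map_of_map_qquot_eq_one hα hU hα1
    (QuotientGroup.mk' (Subgroup.normalClosure s)) (fun p q hp hq =>
      (QuotientGroup.eq_one_iff _).2 (Subgroup.subset_normalClosure ⟨p, q, hp, hq, rfl⟩))
  rw [Subgroup.commutator_le]
  intro x hx y hy
  have h1 := hcomm ⟨x, hx⟩ ⟨y, hy⟩
  have h2 : (⟨x, hx⟩ * ⟨y, hy⟩ * ⟨x, hx⟩⁻¹ * ⟨y, hy⟩⁻¹ : unitaryGroup h) ∈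
      Subgroup.normalClosure s := by
    rw [← QuotientGroup.eq_one_iff]
    change (QuotientGroup.mk' (Subgroup.normalClosure s)) _ = 1
    rw [map_mul, map_mul, map_mul, map_inv, map_inv, mul_inv_eq_one, mul_inv_eq_iff_eq_mul]
    exact h1.eq
  exact hs h2

/-- The homology is a quasi-reflection `R_p`. With `q` orthogonal to `p`, the root subgroup comes
from a totally isotropic plane containing one isotropic vector of the plane of `p` and `q` and one
of its complement; dimension four leaves room for both. -/
theorem isHomologyFactor_unitaryGroup [Module.Finite F U] (hU : 4 ≤ Module.finrank F U)
    {a : U ≃ₗ[F] U} (hα1 : α ≠ 1) (ha : IsHomology α a) (haG : a ∈ unitaryGroup h) :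
    IsHomologyFactor (unitaryGroup h) a α := by
  obtain ⟨hα, p, hp, rfl⟩ := hh.exists_eq_qrefl hα1 ha haG
  have hσα : σ α * σ (σ α) = 1 := by rw [hh.invol, mul_comm, hα]
  have hα1' : α - 1 ≠ 0 := sub_ne_zero.2 hα1
  have hS : ∀ {q r : U} (hq : h q q = 1) (hr : h r r = 1),
      qquot h hα hq hr ∈ ⁅unitaryGroup h, unitaryGroup h⁆ := fun hq hr =>
    hh.qquot_mem_commutator hα (by omega) hα1 hq hr
  have hSG : ⁅unitaryGroup h, unitaryGroup h⁆ ≤ unitaryGroup h :=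
    (Subgroup.commutator_le).2 fun x hx y hy =>
      mul_mem (mul_mem (mul_mem hx hy) (inv_mem hx)) (inv_mem hy)
  -- the geometric configuration
  have hX := hh.nondegenerateOn_inf_perp hh.nondegenerateOn_top (p := p) Submodule.mem_top
    (by rw [hp]; exact one_ne_zero)
  have hf1 := finrank_le_inf_perp (h := h) ⊤ p
  rw [finrank_top] at hf1
  obtain ⟨q, hqX, hq⟩ := hh.exists_self_eq hX (by intro h0; rw [h0, finrank_bot] at hf1; omega)
    (a := 1) (map_one σ)
  have hqp : h q p = 0 := mem_perp.1 hqX.2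
  have hpq := hh.symm_zero hqp
  have hf2 := finrank_le_inf_perp (h := h) (⊤ ⊓ perp h p) q
  obtain ⟨w, hwX, hw0, hww⟩ := hh.exists_ne_zero_self_eq
    (hh.nondegenerateOn_inf_perp hX hqX (by rw [hq]; exact one_ne_zero)) (by omega) (a := 0)
    (map_zero σ)
  have hwp : h w p = 0 := mem_perp.1 hwX.1.2
  have hwq : h w q = 0 := mem_perp.1 hwX.2
  -- The element `d` of norm `-1` makes `p + d q` isotropic. `R_p R_q` multiplies it by `α`, since
  -- both basis vectors of the plane are scaled equally.
  obtain ⟨d, hd⟩ := hh.norm (-1) (by simp)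
  set v := p + d • q with hv
  have hvp : h v p = 1 := by simp [hv, hp, hqp]
  have hvv : h v v = 0 := by simp [hv, hp, hq, hqp, hpq]; linear_combination hd
  have hvw : h v w = 0 := by simp [hv, hh.symm_zero hwp, hh.symm_zero hwq]
  have hwv := hh.symm_zero hvw
  obtain ⟨z, hzw⟩ : ∃ z, h z w ≠ 0 := by
    by_contra! hcon
    exact hw0 (hh.nondeg w fun y => hh.symm_zero (hcon y))
  let u := eichler h hvv hww hvw hwv
  let t := qrefl h hα hp * qrefl h hα hq
  have htG : t ∈ unitaryGroup h := mul_mem (hh.qrefl_mem hα hp) (hh.qrefl_mem hα hq)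
  have htv : t v = α • v := by
    simp only [t, hv, LinearEquiv.mul_apply, map_add, map_smul]
    rw [qrefl_apply_of_perp hα hq hpq, qrefl_apply_self, qrefl_apply_self, map_smul,
      qrefl_apply_of_perp hα hp hqp]
    module
  have htw : t w = w := by
    rw [LinearEquiv.mul_apply, qrefl_apply_of_perp hα hq hwq, qrefl_apply_of_perp hα hp hwp]
  have huS : ∀ c, u c ∈ ⁅unitaryGroup h, unitaryGroup h⁆ := by
    intro c
    -- The commutator of `t` with `u c'` is `u ((α - 1) c')`.
    have h1 : t * u ((α - 1)⁻¹ * c) * t⁻¹ * (u ((α - 1)⁻¹ * c))⁻¹ = u c := by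
      rw [eichler_conj hvv hww hvw hwv htG htv htw, mul_inv_eq_iff_eq_mul, ← eichler_add]
      congr 1
      field_simp
      ring
    rw [← h1]
    exact Subgroup.commutator_mem_commutator htG (hh.eichler_mem hvv hww hvw hwv _)
  have huapp : ∀ c x, u c x = x + ((σ c * h x v) • w - (c * h x w) • v) := fun _ _ => rfl
  have hune : ∀ c, c ≠ 0 → ¬ IsHomothety (u c) := by
    intro c hc hs
    have h1 := hs.eq_one_of_apply_eq hw0 (eichler_apply_right hvv hww hvw hwv c)
    have h2 := LinearEquiv.congr_fun h1 z
    rw [huapp, LinearEquiv.coe_one, id, add_eq_left] at h2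
    have h3 : h ((σ c * h z v) • w - (c * h z w) • v) p = 0 := by
      rw [h2, map_zero, LinearMap.zero_apply]
    simp [hwp, hvp] at h3
    tauto
  refine ⟨fun N hNG hNS hNa hNs => ?_, ?_, ?_⟩
  · refine hh.commutator_le_of_qquot_mem hα hU hα1 fun q r hq hr => ?_
    have hNp : ∀ {s : U} (hs : h s s = 1), ∀ x ∈ N,
        qrefl h hα hs * x * (qrefl h hα hs)⁻¹ ∈ N := fun {s} hs x hx => by
      -- Every `R_s` equals `(R_s R_p⁻¹) R_p`, so normalisation by the commutator subgroup and by
      -- `R_p` alone gives normalisation by all quasi-reflections.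
      have h2 := hNS _ (hS hp hs) _ (hNa x hx)
      have h3 : qrefl h hα hs = qquot h hα hp hs * qrefl h hα hp := by
        rw [qquot, inv_mul_cancel_right]
      rw [h3, mul_inv_rev]
      simpa only [mul_assoc] using h2
    obtain ⟨_, _, h1⟩ := hh.linked_of_not_isHomothety (hα := hα) hU hα1 hNG
      (fun s hs x hx => hNp hs x hx) hNs hq hr
    exact h1
  · refine ⟨qquot h hα hq hp, hS hq hp, u 1, huS 1, fun hs => ?_⟩
    set x := qquot h hα hq hp with hx
    have hxw : x w = w := qquot_apply_of_perp hα hq hp hwq hwp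
    have hxw' : x⁻¹ w = w := by
      conv_lhs => rw [← hxw]
      exact inv_apply_self x w
    have huw : u 1 w = w := eichler_apply_right hvv hww hvw hwv 1
    have huw' : (u 1)⁻¹ w = w := by
      conv_lhs => rw [← huw]
      exact inv_apply_self (u 1) w
    -- Both elements fix `w`, so a scalar commutator would be trivial. Comparing the two products at
    -- `z` and pairing with `p` then forces `α = 1`.
    have h1 := hs.eq_one_of_apply_eq hw0 (by
      simp only [LinearEquiv.mul_apply, huw', hxw', huw, hxw])
    rw [mul_inv_eq_one, mul_inv_eq_iff_eq_mul] at h1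
    have h2 := LinearEquiv.congr_fun h1 z
    have hxz : h (x z) w = h z w := by
      conv_lhs => rw [← hxw]
      exact (hSG (hS hq hp)) z w
    have hxv : h (x v) p = α := by
      have h4 : x v = α • p + (d * σ α) • q := by
        have h5 : (qrefl h hα hq)⁻¹ q = σ α • q := by rw [qrefl_inv_apply, hq]; module
        rw [hx, qquot, LinearEquiv.mul_apply, hv, map_add, map_smul,
          qrefl_inv_apply_of_perp hα hq hpq, h5, map_add, map_smul, map_smul, qrefl_apply_self,
          qrefl_apply_of_perp hα hp hqp, smul_smul]
      rw [h4]
      simp [hp, hqp]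
    rw [LinearEquiv.mul_apply, LinearEquiv.mul_apply, huapp, huapp, map_add, map_sub, map_smul,
      map_smul, hxw, hxz] at h2
    have h3 := congrArg (fun y => h y p) (add_left_cancel h2)
    simp [hwp, hvp, hxv] at h3
    exact mul_ne_zero hzw hα1' (by linear_combination h3)
  · obtain ⟨g, hgS, c, hc, hgp⟩ : ∃ g ∈ ⁅unitaryGroup h, unitaryGroup h⁆, ∃ c : F, c * σ c = 1 ∧
        g p = c • q := by
      refine hh.chain_qquot hα hα1 hh.nondegenerateOn_top (by rw [finrank_top]; omega)
        (fun q => ∃ g ∈ ⁅unitaryGroup h, unitaryGroup h⁆, ∃ c : F, c * σ c = 1 ∧ g p = c • q) ?_ ?_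
        Submodule.mem_top Submodule.mem_top hp hq ⟨1, one_mem _, 1, by simp, by simp⟩
      · rintro x - y - hx hy ⟨g, hg, c, hc, hgp⟩
        exact ⟨_, mul_mem (hS hx hy) hg, c, hc, by rw [LinearEquiv.mul_apply, hgp, map_smul]⟩
      · rintro x - e hx he ⟨g, hg, c, hc, hgp⟩
        refine ⟨g, hg, c * σ e, ?_, ?_⟩
        · rw [map_mul, hh.invol]; linear_combination hc + c * σ c * he
        · rw [hgp, smul_smul, mul_assoc, mul_comm (σ e), he, mul_one]
    have hb : g * qrefl h hα hp * g⁻¹ = qrefl h hα hq := by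
      have h1 : h (c • q) (c • q) = 1 := by rw [hh.smul_self_eq hc, hq]
      rw [conj_qrefl hα (hSG hgS) hp, qrefl_congr hα _ h1 hgp, hh.qrefl_smul hα hc hq]
    refine ⟨g, hgS, ?_⟩
    rw [hb]
    refine ⟨u, huS, eichler_add hvv hww hvw hwv, ?_, fun hs => ?_,
      eichler_conj hvv hww hvw hwv htG htv htw, 1, ?_⟩
    · refine mul_inv_eq_iff_eq_mul.1 ?_
      rw [conj_qrefl hα (hh.qrefl_mem hα hp) hq]
      exact qrefl_congr hα _ _ (qrefl_apply_of_perp hα hp hqp)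
    · have h1 := hs.eq_one_of_apply_eq hw0 (by
        rw [LinearEquiv.mul_apply, qrefl_inv_apply_of_perp hα hq hwq,
          qrefl_apply_of_perp hα hp hwp])
      have h2 := LinearEquiv.congr_fun h1 p
      rw [LinearEquiv.mul_apply, qrefl_inv_apply_of_perp hα hq hpq, qrefl_apply_self,
        LinearEquiv.coe_one, id] at h2
      have h3 := congrArg (fun y => h y p) h2
      simp [hp] at h3
      exact hα1 h3
    · have h1 : u (α * 1) * (u 1)⁻¹ = u (α - 1) := by
        rw [mul_inv_eq_iff_eq_mul, ← eichler_add]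
        congr 1
        ring
      rw [h1]
      exact hune _ hα1'

end IsHermitian

end Hermitian

/-! ### Kernel dimensions and root multiplicities. -/

section KerAeval

open TensorProduct

theorem finrank_ker_mul_le {K V : Type*} [Field K] [AddCommGroup V] [Module K V]
    [Module.Finite K V] (f g : Module.End K V) :
    Module.finrank K (LinearMap.ker (f * g)) ≤
      Module.finrank K (LinearMap.ker f) + Module.finrank K (LinearMap.ker g) := by
  let q : LinearMap.ker (f * g) →ₗ[K] LinearMap.ker f :=
    (g.domRestrict _).codRestrict _ fun x => x.2
  rw [← LinearMap.finrank_range_add_finrank_ker q]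
  refine add_le_add (Submodule.finrank_le _) ?_
  refine LinearMap.finrank_le_finrank_of_injective
    (f := (((LinearMap.ker (f * g)).subtype.comp (LinearMap.ker q).subtype).codRestrict
      (LinearMap.ker g) fun x => congrArg Subtype.val x.2)) fun x y hxy => ?_
  have h : ((x : LinearMap.ker (f * g)) : V) = (y : LinearMap.ker (f * g)) :=
    congrArg (fun z : LinearMap.ker g => (z : V)) hxy
  exact Subtype.ext (Subtype.ext h)

theorem finrank_ker_le_finrank_ker_baseChange {K V : Type*} [Field K] [AddCommGroup V] [Module K V]
    [Module.Finite K V] (L : Type*) [Field L] [Algebra K L] (f : Module.End K V) :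
    Module.finrank K (LinearMap.ker f) ≤ Module.finrank L (LinearMap.ker (f.baseChange L)) := by
  rw [← Module.finrank_baseChange (R := L) (S := K)]
  have hinj : Function.Injective ((LinearMap.ker f).subtype.baseChange L) :=
    Module.Flat.lTensor_preserves_injective_linearMap (M := L) _
      (LinearMap.ker f).injective_subtype
  have h0 : f.comp (LinearMap.ker f).subtype = 0 := by ext x; exact x.2
  refine LinearMap.finrank_le_finrank_of_injective
    (f := ((LinearMap.ker f).subtype.baseChange L).codRestrict
      (LinearMap.ker (f.baseChange L)) fun x => ?_) fun x y hxy => hinj (congrArg Subtype.val hxy)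
  rw [LinearMap.mem_ker, ← LinearMap.comp_apply, ← LinearMap.baseChange_comp, h0,
    LinearMap.baseChange_zero, LinearMap.zero_apply]

/-- Kernel dimension is subadditive on products, and each linear factor contributes at most the
algebraic multiplicity of its root. -/
theorem finrank_ker_aeval_prod_le {L W : Type*} [Field L] [AddCommGroup W] [Module L W]
    [Module.Finite L W] (T : Module.End L W) (s : Multiset L) :
    Module.finrank L (LinearMap.ker (aeval T (s.map fun β => X - C β).prod)) ≤
      (s.map fun β => T.charpoly.rootMultiplicity β).sum := by
  induction s using Multiset.induction with
  | empty =>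
    rw [Multiset.map_zero, Multiset.prod_zero, map_one, Module.End.one_eq_id, LinearMap.ker_id,
      finrank_bot]
    exact Nat.zero_le _
  | cons β s ih =>
    rw [Multiset.map_cons, Multiset.prod_cons, Multiset.map_cons, Multiset.sum_cons, map_mul]
    refine (finrank_ker_mul_le _ _).trans (add_le_add ?_ ih)
    have := LinearMap.finrank_eigenspace_le T β
    rw [Module.End.eigenspace_def] at this
    rwa [map_sub, aeval_X, aeval_C]

/-- The kernel of `p(T)` has dimension at most `deg p` when every root of `p` is a simple root of
the characteristic polynomial of `T`. -/
theorem finrank_ker_aeval_le {K V : Type*} [Field K] [AddCommGroup V] [Module K V]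
    [Module.Finite K V] (T : Module.End K V) {p : K[X]} (hp : p.Monic)
    (h : ∀ β : AlgebraicClosure K, aeval β p = 0 →
      (T.charpoly.map (algebraMap K (AlgebraicClosure K))).rootMultiplicity β ≤ 1) :
    Module.finrank K (LinearMap.ker (aeval T p)) ≤ p.natDegree := by
  set L := AlgebraicClosure K
  set P := p.map (algebraMap K L) with hP
  have hPm : P.Monic := hp.map _
  have hs : P.Splits := IsAlgClosed.splits P
  have h1 : (aeval T p).baseChange L = aeval (T.baseChange L) P := by
    rw [hP, aeval_map_algebraMap]
    exact (aeval_algHom_apply (Module.End.baseChangeHom K L V) T p).symm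
  refine (finrank_ker_le_finrank_ker_baseChange L _).trans ?_
  rw [h1]
  have h2 := finrank_ker_aeval_prod_le (T.baseChange L) P.roots
  rw [← hs.eq_prod_roots_of_monic hPm] at h2
  refine h2.trans ?_
  rw [LinearMap.charpoly_baseChange]
  refine (Multiset.sum_le_card_nsmul _ 1 ?_).trans ?_
  · intro m hm
    obtain ⟨β, hβ, rfl⟩ := Multiset.mem_map.1 hm
    refine h β ?_
    rw [mem_roots hPm.ne_zero, IsRoot.def, hP, eval_map_algebraMap] at hβ
    exact hβ
  · rw [Multiset.card_map, smul_eq_mul, mul_one, ← hs.natDegree_eq_card_roots, natDegree_map]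

end KerAeval

/-! ### Making the homology semisimple. -/

section Homology

/-- If the characteristic polynomial of `T` is `(X - 1) ^ m (X - α)` with `α ≠ 1` fixed by the
`E`-th power map, `E ≥ m` a power of the characteristic, then `T ^ E` is a homology. -/
theorem isHomology_pow {F U : Type*} [Field F] [AddCommGroup U] [Module F U] [Module.Finite F U]
    (p : ℕ) [Fact p.Prime] [CharP F p] {T : U ≃ₗ[F] U} {α : F} (hα : α ≠ 1) {m e : ℕ}
    (hT : LinearMap.charpoly (T : U →ₗ[F] U) = (X - 1) ^ m * (X - C α)) (hm : m ≤ p ^ e)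
    (hαe : α ^ p ^ e = α) : IsHomology α (T ^ p ^ e) := by
  set t : Module.End F U := (T : U →ₗ[F] U) with ht
  have hE : p ^ e ≠ 0 := pow_ne_zero _ (Fact.out : p.Prime).ne_zero
  have hroot : LinearMap.charpoly t ≠ 0 := (LinearMap.charpoly_monic t).ne_zero
  have hmult : (LinearMap.charpoly t).rootMultiplicity α = 1 := by
    rw [hT, rootMultiplicity_mul (by rw [← hT]; exact hroot), rootMultiplicity_X_sub_C_self,
      Nat.add_eq_right, rootMultiplicity_eq_zero_iff]
    intro h
    rw [IsRoot.def, eval_pow, eval_sub, eval_X, eval_one] at h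
    exact absurd h (pow_ne_zero _ (sub_ne_zero.2 hα))
  have h0 : (t - 1) ^ m * (t - algebraMap F _ α) = 0 := by
    have := LinearMap.aeval_self_charpoly t
    rw [hT] at this
    simpa using this
  obtain ⟨k, hk⟩ := Nat.exists_eq_add_of_le hm
  have hcomm : Commute (t - 1) (t - algebraMap F _ α) :=
    ((Commute.refl t).sub_right (Algebra.commutes α t).symm).sub_left
      ((Commute.one_left t).sub_right (Commute.one_left _))
  -- Raising the exponent from `m` to `p ^ e` turns the factor into `t ^ p ^ e - 1`, whose image is
  -- therefore contained in the `α`-eigenline of `t`.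
  have h1 : (t - algebraMap F _ α) * (t - 1) ^ p ^ e = 0 := by
    rw [(hcomm.pow_left _).eq.symm, hk, pow_add, (Commute.pow_pow_self _ _ _).eq, mul_assoc, h0,
      mul_zero]
  have : CharP (Module.End F U) p := by
    have : Nontrivial U := by
      by_contra hn
      rw [not_nontrivial_iff_subsingleton] at hn
      have := LinearMap.charpoly_natDegree t
      rw [Module.finrank_zero_of_subsingleton, hT, natDegree_mul (by
        exact pow_ne_zero _ (by simpa using X_sub_C_ne_zero (1 : F))) (X_sub_C_ne_zero α),
        natDegree_X_sub_C] at this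
      omega
    exact charP_of_injective_algebraMap (algebraMap F (Module.End F U)).injective p
  have h2 : (t - 1) ^ p ^ e = t ^ p ^ e - 1 := by
    rw [sub_pow_char_pow_of_commute _ _ (Commute.one_right t), one_pow]
  rw [h2] at h1
  -- the image of `t ^ p ^ e - 1` lies on an eigenline
  have hrank := LinearMap.finrank_eigenspace_le t α
  rw [hmult] at hrank
  obtain ⟨q, hq⟩ : ∃ q, t.HasEigenvector α q := by
    refine Module.End.HasEigenvalue.exists_hasEigenvector ?_
    rw [Module.End.hasEigenvalue_iff_isRoot_charpoly]
    rw [← rootMultiplicity_pos hroot, hmult]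
    exact one_pos
  have hq0 : q ≠ 0 := hq.2
  have hline : ∀ x, ∃ c : F, (t ^ p ^ e - 1) x = c • q := by
    intro x
    have hx : (t ^ p ^ e - 1) x ∈ t.eigenspace α := by
      rw [Module.End.mem_eigenspace_iff]
      have := LinearMap.congr_fun h1 x
      rw [Module.End.mul_apply, LinearMap.sub_apply, Module.algebraMap_end_apply,
        LinearMap.zero_apply, sub_eq_zero] at this
      exact this
    obtain ⟨v, hv⟩ := (finrank_le_one_iff (K := F)).1 hrank
    obtain ⟨a, ha⟩ := hv ⟨_, hx⟩
    obtain ⟨b, hb⟩ := hv ⟨q, hq.1⟩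
    have hb' : b • (v : U) = q := congrArg Subtype.val hb
    have ha' : a • (v : U) = _ := congrArg Subtype.val ha
    have hb0 : b ≠ 0 := by rintro rfl; rw [zero_smul] at hb'; exact hq0 hb'.symm
    exact ⟨a * b⁻¹, by rw [← hb', smul_smul, inv_mul_cancel_right₀ hb0]; exact ha'.symm⟩
  obtain ⟨ψ, hψ⟩ := Module.Projective.exists_dual_eq_one F hq0
  have hcoe : ∀ (k : ℕ) (x : U), (T ^ k) x = (t ^ k) x := by
    intro k x
    exact LinearMap.congr_fun
      (map_pow (LinearEquiv.automorphismGroup.toLinearMapMonoidHom (R := F) (M := U)) T k) x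
  refine ⟨ψ.comp (t ^ p ^ e - 1), q, ?_, fun x => ?_⟩
  · rw [LinearMap.comp_apply, LinearMap.sub_apply, hq.pow_apply, hαe, Module.End.one_apply, map_sub,
      map_smul, hψ, smul_eq_mul, mul_one]
  · obtain ⟨c, hc⟩ := hline x
    rw [LinearMap.comp_apply, hc, map_smul, hψ, smul_eq_mul, mul_one, ← hc, hcoe,
      LinearMap.sub_apply, Module.End.one_apply, add_sub_cancel]

end Homology

/-! ### Blocks, reciprocal polynomials and the form. -/

section Blocks

variable {K : Type*} [Field K] {V : Type*} [AddCommGroup V] [Module K V]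

theorem mem_block {z : V ≃ₗ[K] V} {p : K[X]} {v : V} :
    v ∈ block z p ↔ aeval (z : Module.End K V) p v = 0 := Iff.rfl

theorem eq_zero_of_mem_block_of_isCoprime {z : V ≃ₗ[K] V} {p q : K[X]} (h : IsCoprime p q) {v : V}
    (hp : v ∈ block z p) (hq : v ∈ block z q) : v = 0 := by
  have := Polynomial.disjoint_ker_aeval_of_isCoprime (z : Module.End K V) h
  exact (Submodule.disjoint_def.1 this) v hp hq

theorem exists_add_eq_of_isCoprime {z : V ≃ₗ[K] V} {p q : K[X]} (h : IsCoprime p q) {v : V}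
    (hv : v ∈ block z (p * q)) :
    ∃ u w, w ∈ block z p ∧ v = aeval (z : Module.End K V) p u + w := by
  obtain ⟨a, b, hab⟩ := h
  refine ⟨aeval (z : Module.End K V) a v, aeval (z : Module.End K V) (b * q) v, ?_, ?_⟩
  · rw [mem_block] at hv ⊢
    rw [← Module.End.mul_apply, ← map_mul, show p * (b * q) = b * (p * q) by ring, map_mul,
      Module.End.mul_apply, hv, map_zero]
  · rw [← Module.End.mul_apply, ← map_mul, ← LinearMap.add_apply, ← map_add, mul_comm p, hab,
      map_one, Module.End.one_apply]

theorem apply_eq_zero_of_mem_block_mul {z : V ≃ₗ[K] V} {p q : K[X]} (h : IsCoprime p q)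
    {W : Type*} [AddCommGroup W] [Module K W] {d : V →ₗ[K] W} (hp : ∀ v ∈ block z p, d v = 0)
    (hq : ∀ v ∈ block z q, d v = 0) : ∀ v ∈ block z (p * q), d v = 0 := by
  intro v hv
  have h1 := Polynomial.sup_ker_aeval_eq_ker_aeval_mul_of_coprime (z : Module.End K V) h
  have h2 : block z (p * q) ≤ LinearMap.ker d := by
    rw [block, ← h1]
    exact sup_le hp hq
  exact h2 hv

theorem apply_eq_zero_of_mem_block_prod {z : V ≃ₗ[K] V} {ι : Type*} {p : ι → K[X]} (s : Finset ι)
    (hs : (∏ i ∈ s, p i).Separable) {W : Type*} [AddCommGroup W] [Module K W] {d : V →ₗ[K] W}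
    (hp : ∀ i ∈ s, ∀ v ∈ block z (p i), d v = 0) : ∀ v ∈ block z (∏ i ∈ s, p i), d v = 0 := by
  classical
  induction s using Finset.induction_on with
  | empty =>
    intro v hv
    rw [mem_block, Finset.prod_empty, map_one, Module.End.one_apply] at hv
    rw [hv, map_zero]
  | insert i s hi ih =>
    rw [Finset.prod_insert hi] at hs ⊢
    exact apply_eq_zero_of_mem_block_mul hs.isCoprime (hp i (Finset.mem_insert_self i s))
      (ih hs.of_mul_right fun k hk => hp k (Finset.mem_insert_of_mem hk))

theorem aeval_reflect (g : V ≃ₗ[K] V) {N : ℕ} {p : K[X]} (hp : p.natDegree ≤ N) :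
    aeval (g : Module.End K V) (reflect N p) =
      (g : Module.End K V) ^ N * aeval ((g⁻¹ : V ≃ₗ[K] V) : Module.End K V) p := by
  have hg : (g : Module.End K V) * ((g⁻¹ : V ≃ₗ[K] V) : Module.End K V) = 1 := by
    ext x; exact LinearEquiv.congr_fun (mul_inv_cancel g) x
  have hg' : ((g⁻¹ : V ≃ₗ[K] V) : Module.End K V) * (g : Module.End K V) = 1 := by
    ext x; exact LinearEquiv.congr_fun (inv_mul_cancel g) x
  have hc : Commute (g : Module.End K V) ((g⁻¹ : V ≃ₗ[K] V) : Module.End K V) := hg.trans hg'.symm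
  refine Polynomial.induction_with_natDegree_le
    (fun p => aeval (g : Module.End K V) (reflect N p) =
      (g : Module.End K V) ^ N * aeval ((g⁻¹ : V ≃ₗ[K] V) : Module.End K V) p) N ?_ ?_ ?_ p hp
  · simp
  · intro k c _ hk
    rw [reflect_C_mul_X_pow, revAt_le hk, map_mul, map_mul, aeval_C, aeval_C, map_pow, map_pow,
      aeval_X, aeval_X, ← mul_assoc, ← Algebra.commutes, mul_assoc, Algebra.commutes,
      ← Algebra.commutes]
    congr 1
    obtain ⟨m, rfl⟩ := Nat.exists_eq_add_of_le hk
    rw [Nat.add_sub_cancel_left, add_comm k m, pow_add, mul_assoc, ← hc.mul_pow, hg, one_pow,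
      mul_one]
  · intro f q _ _ hf hq
    rw [reflect_add, map_add, hf, hq, map_add, mul_add]

/-- Up to a nonzero constant, `recip p` at `z` is a power of `z` times `p(z⁻¹)`, and `z` is
invertible. -/
theorem mem_block_recip {z : V ≃ₗ[K] V} {p : K[X]} (hp : p.coeff 0 ≠ 0) {v : V} :
    v ∈ block z (recip p) ↔ aeval ((z⁻¹ : V ≃ₗ[K] V) : Module.End K V) p v = 0 := by
  have h : ∀ (k : ℕ) (x : V), ((z : Module.End K V) ^ k) x = 0 ↔ x = 0 := by
    intro k x
    induction k with
    | zero => rfl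
    | succ k ih =>
      rw [pow_succ', Module.End.mul_apply, LinearEquiv.coe_coe, LinearEquiv.map_eq_zero_iff, ih]
  rw [mem_block, recip, map_mul, aeval_C, Module.End.mul_apply, Module.algebraMap_end_apply,
    smul_eq_zero_iff_right (inv_ne_zero hp), reverse, aeval_reflect z le_rfl, Module.End.mul_apply,
    h]

/-- If `g` commutes with `z` and multiplies `v ∈ U_φ` by the scalar `a` of `K[X]/(φ)`, then `p(g)`
multiplies `v` by `p(a)`. -/
theorem aeval_apply_of_apply_eq_smul {z : V ≃ₗ[K] V} {φ : K[X]} {g : Module.End K V}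
    (hg : Commute g (z : Module.End K V)) {v : block z φ} {a : AdjoinRoot φ}
    (h : g v = ((a • v : block z φ) : V)) (p : K[X]) :
    aeval g p (v : V) = ((aeval a p • v : block z φ) : V) := by
  have hlin : ∀ b : AdjoinRoot φ,
      g ((b • v : block z φ) : V) = (((b * a) • v : block z φ) : V) := by
    intro b
    obtain ⟨q, rfl⟩ := AdjoinRoot.mk_surjective b
    have := LinearMap.congr_fun (commute_aeval hg q).eq (v : V)
    rw [Module.End.mul_apply, Module.End.mul_apply, h] at this
    rw [mk_smul_coe, this, mul_smul, mk_smul_coe]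
  have hpow : ∀ k : ℕ, (g ^ k) (v : V) = ((a ^ k • v : block z φ) : V) := by
    intro k
    induction k with
    | zero => simp
    | succ k ih => rw [pow_succ', Module.End.mul_apply, ih, hlin, pow_succ]
  induction p using Polynomial.induction_on' with
  | add p q hp hq => simp [hp, hq, add_smul]
  | monomial k c =>
    rw [aeval_monomial, aeval_monomial, Module.End.mul_apply, hpow, Module.algebraMap_end_apply,
      ← Algebra.smul_def, smul_assoc, Submodule.coe_smul]

variable {B : LinearMap.BilinForm K V}

theorem apply_aeval_apply {g : V ≃ₗ[K] V} (hg : g ∈ Sp B) (p : K[X]) (v w : V) :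
    B (aeval (g : Module.End K V) p v) w =
      B v (aeval ((g⁻¹ : V ≃ₗ[K] V) : Module.End K V) p w) := by
  have h1 : ∀ x y, B (g x) y = B x ((g⁻¹ : V ≃ₗ[K] V) y) := by
    intro x y
    conv_lhs => rw [← apply_inv_self g y]
    exact hg _ _
  have hpow : ∀ (k : ℕ) (w : V), B (((g : Module.End K V) ^ k) v) w =
      B v ((((g⁻¹ : V ≃ₗ[K] V) : Module.End K V) ^ k) w) := by
    intro k
    induction k with
    | zero => intro w; rfl
    | succ k ih =>
      intro w
      rw [pow_succ', pow_succ, Module.End.mul_apply, Module.End.mul_apply, LinearEquiv.coe_coe, h1,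
        ih]
      rfl
  induction p using Polynomial.induction_on' with
  | add p q hp hq => simp [hp, hq]
  | monomial k c =>
    simp only [aeval_monomial, Module.End.mul_apply, Module.algebraMap_end_apply, map_smul,
      LinearMap.smul_apply, hpow]

theorem apply_aeval_apply' {g : V ≃ₗ[K] V} (hg : g ∈ Sp B) (p : K[X]) (v w : V) :
    B v (aeval (g : Module.End K V) p w) =
      B (aeval ((g⁻¹ : V ≃ₗ[K] V) : Module.End K V) p v) w := by
  rw [apply_aeval_apply (inv_mem hg), inv_inv]

/-- The form pairs `U_φ` nondegenerately with the block of the reciprocal polynomial. -/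
theorem eq_zero_of_orthogonal_block_recip (hB : B.Nondegenerate) {z : V ≃ₗ[K] V} (hz : z ∈ Sp B)
    {p q : K[X]} (hpq : IsCoprime (recip p) q)
    (h0 : aeval (z : Module.End K V) (recip p * q) = 0) {v : V} (hv : v ∈ block z p)
    (h : ∀ w ∈ block z (recip p), B v w = 0) : v = 0 := by
  refine hB.1 v fun x => ?_
  -- Any vector is a sum of one in the image of `recip p` at `z` and one in the dual block. The
  -- image is orthogonal to `U_p`, because the adjoint of `z` is `z⁻¹`.
  obtain ⟨u, w, hw, rfl⟩ := exists_add_eq_of_isCoprime (z := z) hpq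
    (v := x) (by rw [mem_block, h0, LinearMap.zero_apply])
  rw [map_add, h w hw, add_zero, recip, reverse, map_mul, aeval_C, aeval_reflect z le_rfl,
    Module.End.mul_apply, Module.algebraMap_end_apply, map_smul,
    (commute_aeval (g := (z : Module.End K V) ^ p.natDegree) (Commute.pow_left (by
      ext y; exact LinearEquiv.congr_fun ((mul_inv_cancel z).trans (inv_mul_cancel z).symm) y) _)
      p).eq, Module.End.mul_apply, ← apply_aeval_apply hz, mem_block.1 hv, map_zero,
    LinearMap.zero_apply, smul_zero]

theorem eq_zero_of_orthogonal_block (hB : B.Nondegenerate) {z : V ≃ₗ[K] V} (hz : z ∈ Sp B)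
    {p q : K[X]} (hp : p.coeff 0 ≠ 0) (hpq : IsCoprime p q)
    (h0 : aeval (z : Module.End K V) (p * q) = 0) {w : V} (hw : w ∈ block z (recip p))
    (h : ∀ v ∈ block z p, B v w = 0) : w = 0 := by
  refine hB.2 w fun x => ?_
  obtain ⟨u, v, hv, rfl⟩ := exists_add_eq_of_isCoprime (z := z) hpq
    (v := x) (by rw [mem_block, h0, LinearMap.zero_apply])
  rw [map_add, LinearMap.add_apply, h v hv, add_zero, apply_aeval_apply hz,
    (mem_block_recip hp).1 hw, map_zero]

end Blocks

/-! ### The involution of a self-reciprocal block field. -/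

section Involution

variable {K : Type*} [Field K]

theorem aeval_recip_eq_zero_iff {F : Type*} [Field F] [Algebra K F] {φ : K[X]}
    (hφ : φ.coeff 0 ≠ 0) {x : F} (hx : x ≠ 0) : aeval x (recip φ) = 0 ↔ aeval x⁻¹ φ = 0 := by
  let _ : Invertible x⁻¹ := invertibleOfNonzero (inv_ne_zero hx)
  have h := eval₂_reverse_eq_zero_iff (algebraMap K F) x⁻¹ φ
  rw [invOf_eq_inv, inv_inv] at h
  rw [recip, map_mul, aeval_C, mul_eq_zero, aeval_def, aeval_def, h, or_iff_right]
  simpa using hφ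

theorem root_ne_zero {φ : K[X]} [Fact (Irreducible φ)] (hφ : φ.coeff 0 ≠ 0) :
    AdjoinRoot.root φ ≠ 0 := by
  intro h
  have h1 : aeval (AdjoinRoot.root φ) φ = 0 := by rw [AdjoinRoot.aeval_eq, AdjoinRoot.mk_self]
  rw [h, ← coeff_zero_eq_aeval_zero', map_eq_zero] at h1
  exact hφ h1

/-- The involution of `K[X]/(φ)` inverting the class of `X`, for `φ` self-reciprocal. -/
noncomputable def blockInvolution {φ : K[X]} [Fact (Irreducible φ)] (hφ : φ.coeff 0 ≠ 0)
    (hrec : recip φ = φ) : AdjoinRoot φ →ₐ[K] AdjoinRoot φ :=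
  AdjoinRoot.liftAlgHom φ (Algebra.ofId K _) (AdjoinRoot.root φ)⁻¹ (by
    have := (aeval_recip_eq_zero_iff hφ (root_ne_zero hφ)).1 (by
      rw [hrec, AdjoinRoot.aeval_eq, AdjoinRoot.mk_self])
    exact this)

section

variable {φ : K[X]} [Fact (Irreducible φ)] (hφ : φ.coeff 0 ≠ 0) (hrec : recip φ = φ)

theorem blockInvolution_root :
    blockInvolution hφ hrec (AdjoinRoot.root φ) = (AdjoinRoot.root φ)⁻¹ :=
  AdjoinRoot.liftAlgHom_root _ _ _ _

theorem blockInvolution_mk (p : K[X]) :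
    blockInvolution hφ hrec (AdjoinRoot.mk φ p) = aeval (AdjoinRoot.root φ)⁻¹ p := rfl

theorem blockInvolution_comp_self :
    (blockInvolution hφ hrec).comp (blockInvolution hφ hrec) = AlgHom.id K _ := by
  refine AdjoinRoot.algHom_ext ?_
  rw [AlgHom.comp_apply, blockInvolution_root, map_inv₀, blockInvolution_root, inv_inv]
  rfl

theorem blockInvolution_invol (a : AdjoinRoot φ) :
    blockInvolution hφ hrec (blockInvolution hφ hrec a) = a :=
  DFunLike.congr_fun (blockInvolution_comp_self hφ hrec) a

theorem trace_blockInvolution (a : AdjoinRoot φ) :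
    Algebra.trace K (AdjoinRoot φ) (blockInvolution hφ hrec a) =
      Algebra.trace K (AdjoinRoot φ) a :=
  Algebra.trace_eq_of_algEquiv (AlgEquiv.ofAlgHom _ _ (blockInvolution_comp_self hφ hrec)
    (blockInvolution_comp_self hφ hrec)) a

end

end Involution

/-! ### The hermitian form on a block. -/

section BlockForm

variable {K : Type*} [Field K] [Finite K] {V : Type*} [AddCommGroup V] [Module K V]
  {B : LinearMap.BilinForm K V} {z : V ≃ₗ[K] V} {φ : K[X]} [Fact (Irreducible φ)]

theorem ext_trace_mul {x y : AdjoinRoot φ} (h : ∀ a, Algebra.trace K (AdjoinRoot φ) (x * a) =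
    Algebra.trace K (AdjoinRoot φ) (y * a)) : x = y := by
  rw [← sub_eq_zero]
  refine (traceForm_nondegenerate K (AdjoinRoot φ)).1 _ fun a => ?_
  rw [Algebra.traceForm_apply, sub_mul, map_sub, h, sub_self]

theorem inv_apply_eq_root_inv_smul (hφ : φ.coeff 0 ≠ 0) (v : block z φ) :
    ((z⁻¹ : V ≃ₗ[K] V) : Module.End K V) v =
      (((AdjoinRoot.root φ)⁻¹ • v : block z φ) : V) := by
  have h1 : ∀ w : block z φ, ((AdjoinRoot.root φ • w : block z φ) : V) = z w := fun w => by
    rw [← AdjoinRoot.mk_X, mk_smul_coe, aeval_X]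
    rfl
  have h2 := h1 ((AdjoinRoot.root φ)⁻¹ • v)
  rw [smul_inv_smul₀ (root_ne_zero hφ)] at h2
  rw [h2]
  exact inv_apply_self z _

/-- The adjoint of `z` is `z⁻¹`, and `z⁻¹` acts on the block as the inverse of the class of `X`. -/
theorem apply_smul_left (hz : z ∈ Sp B) (hφ : φ.coeff 0 ≠ 0) (hrec : recip φ = φ)
    (a : AdjoinRoot φ) (v w : block z φ) :
    B ((a • v : block z φ) : V) w = B v ((blockInvolution hφ hrec a • w : block z φ) : V) := by
  obtain ⟨p, rfl⟩ := AdjoinRoot.mk_surjective a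
  rw [mk_smul_coe, apply_aeval_apply hz, blockInvolution_mk, aeval_apply_of_apply_eq_smul _
    (inv_apply_eq_root_inv_smul hφ w)]
  ext x
  exact LinearEquiv.congr_fun ((inv_mul_cancel z).trans (mul_inv_cancel z).symm) x

theorem blockForm_add_left (u v w : block z φ) :
    blockForm B z φ (u + v) w = blockForm B z φ u w + blockForm B z φ v w :=
  ext_trace_mul fun a => by
    rw [add_mul, map_add, trace_blockForm_mul, trace_blockForm_mul, trace_blockForm_mul, smul_add,
      Submodule.coe_add, map_add, LinearMap.add_apply]

theorem blockForm_add_right (u v w : block z φ) :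
    blockForm B z φ u (v + w) = blockForm B z φ u v + blockForm B z φ u w :=
  ext_trace_mul fun a => by
    rw [add_mul, map_add, trace_blockForm_mul, trace_blockForm_mul, trace_blockForm_mul,
      Submodule.coe_add, map_add]

theorem blockForm_smul_left (c : AdjoinRoot φ) (v w : block z φ) :
    blockForm B z φ (c • v) w = c * blockForm B z φ v w :=
  ext_trace_mul fun a => by
    rw [trace_blockForm_mul, mul_comm c, mul_assoc, trace_blockForm_mul, smul_smul, mul_comm c]

variable (hB : B.IsAlt) (hz : z ∈ Sp B) (hφ : φ.coeff 0 ≠ 0) (hrec : recip φ = φ)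

include hB hz

/-- The sign comes from `B` being alternating; the involution comes from moving the scalar across
`B` and from its invariance under the trace. -/
theorem blockForm_swap (v w : block z φ) :
    blockForm B z φ w v = -blockInvolution hφ hrec (blockForm B z φ v w) :=
  ext_trace_mul fun a => by
    have h1 := trace_blockInvolution hφ hrec (blockForm B z φ v w * blockInvolution hφ hrec a)
    rw [map_mul, blockInvolution_invol, trace_blockForm_mul] at h1
    rw [neg_mul, map_neg, h1, trace_blockForm_mul, apply_smul_left hz hφ hrec,
      LinearMap.BilinForm.IsAlt.neg_eq hB]

theorem blockForm_smul_right (c : AdjoinRoot φ) (v w : block z φ) :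
    blockForm B z φ v (c • w) = blockInvolution hφ hrec c * blockForm B z φ v w := by
  rw [blockForm_swap hB hz hφ hrec, blockForm_smul_left, blockForm_swap hB hz hφ hrec w v, map_mul,
    mul_neg]

/-- A hermitian multiple of the form `blockForm`. -/
noncomputable def hermitianBlockForm (μ : AdjoinRoot φ) : block z φ →ₗ[AdjoinRoot φ]
    block z φ →ₛₗ[(blockInvolution hφ hrec : AdjoinRoot φ →+* AdjoinRoot φ)] AdjoinRoot φ :=
  LinearMap.mk₂'ₛₗ (RingHom.id _) (blockInvolution hφ hrec : AdjoinRoot φ →+* AdjoinRoot φ)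
    (fun v w => μ * blockForm B z φ v w)
    (fun u v w => by rw [blockForm_add_left, mul_add])
    (fun c v w => by
      rw [blockForm_smul_left, smul_eq_mul, RingHom.id_apply, mul_left_comm])
    (fun u v w => by rw [blockForm_add_right, mul_add])
    (fun c v w => by
      rw [blockForm_smul_right hB hz hφ hrec, smul_eq_mul, mul_left_comm]; rfl)

theorem hermitianBlockForm_apply (μ : AdjoinRoot φ) (v w : block z φ) :
    hermitianBlockForm hB hz hφ hrec μ v w = μ * blockForm B z φ v w := rfl

theorem isHermitian_hermitianBlockForm (hBn : B.Nondegenerate) {q : K[X]} (hq : IsCoprime φ q)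
    (h0 : aeval (z : Module.End K V) (φ * q) = 0)
    (hroot : (AdjoinRoot.root φ)⁻¹ ≠ AdjoinRoot.root φ) {μ : AdjoinRoot φ} (hμ : μ ≠ 0)
    (hμσ : blockInvolution hφ hrec μ = -μ) :
    IsHermitian (hermitianBlockForm hB hz hφ hrec μ) where
  invol := blockInvolution_invol hφ hrec
  ne := ⟨AdjoinRoot.root φ, by
    intro h
    exact hroot ((blockInvolution_root hφ hrec).symm.trans h)⟩
  norm a ha := by
    have : Finite (AdjoinRoot φ) := Module.finite_of_finite K
    exact exists_mul_involution_eq (blockInvolution_invol hφ hrec)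
      ⟨AdjoinRoot.root φ, by
        intro h
        exact hroot ((blockInvolution_root hφ hrec).symm.trans h)⟩ ha
  herm v w := by
    rw [hermitianBlockForm_apply, hermitianBlockForm_apply, blockForm_swap hB hz hφ hrec v w]
    change blockInvolution hφ hrec _ = _
    rw [map_mul, hμσ]
    ring
  nondeg v hv := by
    refine Subtype.ext (eq_zero_of_orthogonal_block_recip hBn hz (by rwa [hrec])
      (by rwa [hrec]) v.2 fun w hw => ?_)
    rw [hrec] at hw
    have h1 := hv ⟨w, hw⟩
    rw [hermitianBlockForm_apply, mul_eq_zero, or_iff_right hμ] at h1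
    have h2 := trace_blockForm_mul B z φ v ⟨w, hw⟩ 1
    rw [h1, zero_mul, map_zero, one_smul] at h2
    exact h2.symm

omit hB hz in
-- With `x` the class of `X`, take `x - x⁻¹`. It is nonzero in every characteristic because `x⁻¹ ≠
-- x`.
theorem exists_blockInvolution_eq_neg (hroot : (AdjoinRoot.root φ)⁻¹ ≠ AdjoinRoot.root φ) :
    ∃ μ : AdjoinRoot φ, μ ≠ 0 ∧ blockInvolution hφ hrec μ = -μ :=
  ⟨AdjoinRoot.root φ - (AdjoinRoot.root φ)⁻¹, sub_ne_zero.2 hroot.symm, by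
    rw [map_sub, map_inv₀, blockInvolution_root, inv_inv, neg_sub]⟩

theorem unitaryBlockGroup_eq {μ : AdjoinRoot φ} (hμ : μ ≠ 0) :
    unitaryBlockGroup B z φ = unitaryGroup (hermitianBlockForm hB hz hφ hrec μ) := by
  ext g
  change (∀ v w, _ = _) ↔ ∀ v w, μ * _ = μ * _
  simp only [mul_right_inj' hμ]

include hφ hrec in
theorem isHomologyFactor_unitaryBlockGroup [Module.Finite K V] (hBn : B.Nondegenerate) {q : K[X]}
    (hq : IsCoprime φ q) (h0 : aeval (z : Module.End K V) (φ * q) = 0)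
    (hroot : (AdjoinRoot.root φ)⁻¹ ≠ AdjoinRoot.root φ)
    (hdim : 4 ≤ Module.finrank (AdjoinRoot φ) (block z φ)) {α : AdjoinRoot φ} (hα : α ≠ 1)
    {a : block z φ ≃ₗ[AdjoinRoot φ] block z φ} (ha : IsHomology α a)
    (haG : a ∈ unitaryBlockGroup B z φ) : IsHomologyFactor (unitaryBlockGroup B z φ) a α := by
  obtain ⟨μ, hμ, hμσ⟩ := exists_blockInvolution_eq_neg hφ hrec hroot
  rw [unitaryBlockGroup_eq hB hz hφ hrec hμ] at haG ⊢
  exact (isHermitian_hermitianBlockForm hB hz hφ hrec hBn hq h0 hroot hμ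
    hμσ).isHomologyFactor_unitaryGroup hdim hα ha haG

end BlockForm

/-! ### Projections of the centraliser to the blocks. -/

section Proj

variable {K : Type*} [Field K] {V : Type*} [AddCommGroup V] [Module K V]
  {B : LinearMap.BilinForm K V} {ζ : Sp B} {φ : K[X]}

theorem proj_mem_unitaryBlockGroup [Finite K] [Fact (Irreducible φ)]
    (g : Subgroup.centralizer {ζ}) :
    proj ζ φ g ∈ unitaryBlockGroup B (ζ : V ≃ₗ[K] V) φ := by
  intro v w
  refine ext_trace_mul fun a => ?_
  rw [trace_blockForm_mul, trace_blockForm_mul, ← map_smul]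
  exact (g : Sp B).2 _ _

/-- An element of the centraliser acting trivially on `U_φ` acts trivially on the dual block. -/
theorem apply_eq_of_proj_eq_one (hBn : B.Nondegenerate) {q : K[X]} (hφ : φ.coeff 0 ≠ 0)
    (hq : IsCoprime φ q) (h0 : aeval ((ζ : V ≃ₗ[K] V) : Module.End K V) (φ * q) = 0)
    {g : Subgroup.centralizer {ζ}} (hg : proj ζ φ g = 1) {w : V}
    (hw : w ∈ block (ζ : V ≃ₗ[K] V) (recip φ)) : ((g : Sp B) : V ≃ₗ[K] V) w = w := by
  have hw' := mem_block_of_commute (ζ : V ≃ₗ[K] V) (recip φ) (commute_of_mem_centralizer g) w hw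
  rw [← sub_eq_zero]
  refine eq_zero_of_orthogonal_block hBn ζ.2 hφ hq h0 (Submodule.sub_mem _ hw' hw) fun v hv => ?_
  have h1 : ((g : Sp B) : V ≃ₗ[K] V) v = v :=
    congrArg Subtype.val (LinearEquiv.congr_fun hg ⟨v, hv⟩)
  have h2 := (g : Sp B).2 v w
  rw [h1] at h2
  rw [map_sub, sub_eq_zero]
  exact h2

end Proj

/-! ### Factors of the cyclotomic polynomial modulo `ℓ`. -/

section Cyclotomic

variable {r ℓ : ℕ} [Fact r.Prime] [Fact ℓ.Prime]

theorem natCast_zmod_ne_zero (hrℓ : r ≠ ℓ) : (r : ZMod ℓ) ≠ 0 := by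
  rw [Ne, ZMod.natCast_eq_zero_iff]
  exact fun h => hrℓ ((Nat.prime_dvd_prime_iff_eq Fact.out Fact.out).1 h).symm

theorem cyclotomic_separable (hrℓ : r ≠ ℓ) : (cyclotomic r (ZMod ℓ)).Separable := by
  have : NeZero (r : ZMod ℓ) := ⟨natCast_zmod_ne_zero hrℓ⟩
  exact separable_cyclotomic r _

theorem aeval_pow_card_eq_zero {F : Type*} [Field F] [Algebra (ZMod ℓ) F] {p : (ZMod ℓ)[X]} {x : F}
    (hx : aeval x p = 0) (m : ℕ) : aeval (x ^ ℓ ^ m) p = 0 := by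
  induction m with
  | zero => simpa using hx
  | succ m ih =>
    have h := aeval_algHom_apply (FiniteField.frobeniusAlgHom (ZMod ℓ) F) (x ^ ℓ ^ m) p
    rw [ih, map_zero] at h
    simp only [FiniteField.coe_frobeniusAlgHom, ZMod.card, ← pow_mul, ← pow_succ] at h
    exact h

/-- For even order `i`, the residue `ℓ ^ (i / 2)` has square `1` but is not `1`, so it is `-1`
modulo `r`. -/
theorem natCast_dvd_pow_add_one (hrℓ : r ≠ ℓ) (hi : ¬ Odd (inertiaDeg r ℓ)) :
    r ∣ ℓ ^ (inertiaDeg r ℓ / 2) + 1 := by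
  have hℓ0 : (ℓ : ZMod r) ≠ 0 := natCast_zmod_ne_zero hrℓ.symm
  have hpos : 0 < inertiaDeg r ℓ :=
    orderOf_pos_iff.2 (isOfFinOrder_iff_pow_eq_one.2
      ⟨r - 1, Nat.sub_pos_of_lt (Fact.out : r.Prime).one_lt, ZMod.pow_card_sub_one_eq_one hℓ0⟩)
  obtain ⟨m, hm⟩ := Nat.not_odd_iff_even.1 hi
  have hm2 : inertiaDeg r ℓ / 2 = m := by omega
  have h1 : (ℓ : ZMod r) ^ m * (ℓ : ZMod r) ^ m = 1 := by
    rw [← pow_add, ← hm]; exact pow_orderOf_eq_one _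
  have h2 : (ℓ : ZMod r) ^ m ≠ 1 := pow_ne_one_of_lt_orderOf (by omega)
    (by change m < inertiaDeg r ℓ; omega)
  have h3 := (mul_self_eq_one_iff.1 h1).resolve_left h2
  rw [hm2, ← ZMod.natCast_eq_zero_iff]
  push_cast
  rw [h3, neg_add_cancel]

theorem coeff_zero_ne_zero_of_dvd_cyclotomic {p : (ZMod ℓ)[X]} (hp : p ∣ cyclotomic r (ZMod ℓ)) :
    p.coeff 0 ≠ 0 := by
  obtain ⟨q, hq⟩ := hp
  intro h0
  have h := cyclotomic_coeff_zero (ZMod ℓ) (Fact.out : r.Prime).one_lt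
  rw [hq, mul_coeff_zero, h0, zero_mul] at h
  exact zero_ne_one h

theorem isPrimitiveRoot_of_aeval_cyclotomic (hrℓ : r ≠ ℓ) {F : Type*} [Field F] [Algebra (ZMod ℓ) F]
    {x : F} (hx : aeval x (cyclotomic r (ZMod ℓ)) = 0) : IsPrimitiveRoot x r := by
  have : NeZero (r : F) := ⟨by
    rw [← map_natCast (algebraMap (ZMod ℓ) F), Ne, map_eq_zero]
    exact natCast_zmod_ne_zero hrℓ⟩
  rw [← isRoot_cyclotomic_iff, IsRoot.def, ← map_cyclotomic r (algebraMap (ZMod ℓ) F),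
    eval_map_algebraMap]
  exact hx

theorem aeval_cyclotomic_of_orderOf_eq {F : Type*} [Field F] [Algebra (ZMod ℓ) F]
    {x : F} (hx : orderOf x = r) : aeval x (cyclotomic r (ZMod ℓ)) = 0 := by
  have h : IsPrimitiveRoot x r := hx ▸ IsPrimitiveRoot.orderOf x
  have := h.isRoot_cyclotomic (Fact.out : r.Prime).pos
  rwa [IsRoot.def, ← map_cyclotomic r (algebraMap (ZMod ℓ) F), eval_map_algebraMap] at this

theorem isPrimitiveRoot_root (hrℓ : r ≠ ℓ) {φ : (ZMod ℓ)[X]} [Fact (Irreducible φ)]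
    (hφ : φ ∣ cyclotomic r (ZMod ℓ)) : IsPrimitiveRoot (AdjoinRoot.root φ) r := by
  refine isPrimitiveRoot_of_aeval_cyclotomic hrℓ ?_
  rw [AdjoinRoot.aeval_eq, AdjoinRoot.mk_eq_zero]
  exact hφ

theorem root_inv_ne_root (hr : r ≠ 2) (hrℓ : r ≠ ℓ) {φ : (ZMod ℓ)[X]} [Fact (Irreducible φ)]
    (hφ : φ ∣ cyclotomic r (ZMod ℓ)) : (AdjoinRoot.root φ)⁻¹ ≠ AdjoinRoot.root φ := by
  intro h
  have h0 := root_ne_zero (coeff_zero_ne_zero_of_dvd_cyclotomic hφ)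
  have h1 : AdjoinRoot.root φ ^ 2 = 1 := by
    rw [pow_two]
    nth_rewrite 1 [← h]
    exact inv_mul_cancel₀ h0
  have h2 := (isPrimitiveRoot_root hrℓ hφ).dvd_of_pow_eq_one 2 h1
  exact hr ((Nat.prime_dvd_prime_iff_eq Fact.out Nat.prime_two).1 h2)

/-- The Frobenius power with exponent `ℓ ^ (i / 2)` inverts `r`-th roots of unity, so the roots of
`φ` are closed under inversion. -/
theorem recip_eq_self (hrℓ : r ≠ ℓ) (hi : ¬ Odd (inertiaDeg r ℓ)) {φ : (ZMod ℓ)[X]}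
    [Fact (Irreducible φ)] (hm : φ.Monic) (hφ : φ ∣ cyclotomic r (ZMod ℓ)) : recip φ = φ := by
  have h0 := coeff_zero_ne_zero_of_dvd_cyclotomic hφ
  have hx0 := root_ne_zero h0
  have h1 : AdjoinRoot.root φ ^ ℓ ^ (inertiaDeg r ℓ / 2) = (AdjoinRoot.root φ)⁻¹ := by
    rw [← mul_eq_one_iff_eq_inv₀ hx0, ← pow_succ]
    exact ((isPrimitiveRoot_root hrℓ hφ).pow_eq_one_iff_dvd _).2 (natCast_dvd_pow_add_one hrℓ hi)
  have h2 : aeval (AdjoinRoot.root φ)⁻¹ φ = 0 := by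
    rw [← h1]
    exact aeval_pow_card_eq_zero (by rw [AdjoinRoot.aeval_eq, AdjoinRoot.mk_self]) _
  rw [← aeval_recip_eq_zero_iff h0 hx0, AdjoinRoot.aeval_eq, AdjoinRoot.mk_eq_zero] at h2
  refine eq_of_monic_of_dvd_of_natDegree_le hm ?_ h2 ?_
  · rw [recip, Monic, leadingCoeff_mul, leadingCoeff_C, reverse_leadingCoeff, trailingCoeff,
      natTrailingDegree_eq_zero.2 (Or.inr h0), inv_mul_cancel₀ h0]
  · exact (natDegree_C_mul_le _ _).trans (reverse_natDegree_le φ)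

section Factorisation

variable {t : ℕ} {φ : Fin t → (ZMod ℓ)[X]} [∀ j, Fact (Irreducible (φ j))]
  (hrℓ : r ≠ ℓ) (hm : ∀ j, (φ j).Monic)
  (hφ : cyclotomic r (ZMod ℓ) =
      if Odd (inertiaDeg r ℓ) then ∏ j, φ j * recip (φ j) else ∏ j, φ j)

include hφ

theorem dvd_cyclotomic (j : Fin t) : φ j ∣ cyclotomic r (ZMod ℓ) := by
  rw [hφ]
  split_ifs
  · exact (Dvd.intro _ rfl).trans
      (Finset.dvd_prod_of_mem (fun j => φ j * recip (φ j)) (Finset.mem_univ j))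
  · exact Finset.dvd_prod_of_mem φ (Finset.mem_univ j)

include hrℓ hm

theorem recip_dvd_cyclotomic (j : Fin t) : recip (φ j) ∣ cyclotomic r (ZMod ℓ) := by
  by_cases hi : Odd (inertiaDeg r ℓ)
  · rw [hφ, if_pos hi]
    exact (Dvd.intro_left _ rfl).trans
      (Finset.dvd_prod_of_mem (fun j => φ j * recip (φ j)) (Finset.mem_univ j))
  · rw [recip_eq_self hrℓ hi (hm j) (dvd_cyclotomic hφ j)]
    exact dvd_cyclotomic hφ j

theorem isCoprime_factor {j k : Fin t} (hjk : j ≠ k) :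
    IsCoprime (φ j) (φ k) ∧ IsCoprime (φ j) (recip (φ k)) := by
  have hsep := cyclotomic_separable hrℓ
  have hpair : ∀ f : Fin t → (ZMod ℓ)[X], f j * f k ∣ ∏ i, f i := fun f => by
    rw [← Finset.mul_prod_erase _ f (Finset.mem_univ j)]
    exact mul_dvd_mul_left _
      (Finset.dvd_prod_of_mem f (Finset.mem_erase.2 ⟨hjk.symm, Finset.mem_univ k⟩))
  by_cases hi : Odd (inertiaDeg r ℓ)
  · rw [hφ, if_pos hi] at hsep
    have h1 := (hsep.of_dvd (hpair fun j => φ j * recip (φ j))).isCoprime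
    exact ⟨h1.of_mul_left_left.of_mul_right_left, h1.of_mul_left_left.of_mul_right_right⟩
  · rw [recip_eq_self hrℓ hi (hm k) (dvd_cyclotomic hφ k), and_self]
    rw [hφ, if_neg hi] at hsep
    exact (hsep.of_dvd (hpair φ)).isCoprime

end Factorisation

/-- `z` is annihilated by `Φ_r ^ n` and by `X ^ r - 1 = Φ_r (X - 1)`. As `X ^ r - 1` is separable,
`Φ_r ^ n` is coprime to `X - 1`, and `Φ_r` is a combination of the two annihilators. -/
theorem aeval_cyclotomic_eq_zero {V : Type*} [AddCommGroup V] [Module (ZMod ℓ) V]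
    [Module.Finite (ZMod ℓ) V] (hrℓ : r ≠ ℓ) {n : ℕ} {z : V ≃ₗ[ZMod ℓ] V} (hz : z ^ r = 1)
    (hchar : LinearMap.charpoly (z : V →ₗ[ZMod ℓ] V) = cyclotomic r (ZMod ℓ) ^ n) :
    aeval (z : Module.End (ZMod ℓ) V) (cyclotomic r (ZMod ℓ)) = 0 := by
  have hmul := cyclotomic_prime_mul_X_sub_one (ZMod ℓ) r
  have hsep : (cyclotomic r (ZMod ℓ) * (X - 1)).Separable := by
    rw [hmul]
    exact separable_X_pow_sub_C 1 (natCast_zmod_ne_zero hrℓ) one_ne_zero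
  obtain ⟨a, b, hab⟩ := hsep.isCoprime.pow_left (m := n)
  have h1 : aeval (z : Module.End (ZMod ℓ) V) (cyclotomic r (ZMod ℓ) ^ n) = 0 := by
    rw [← hchar]; exact LinearMap.aeval_self_charpoly _
  have h2 : aeval (z : Module.End (ZMod ℓ) V) (cyclotomic r (ZMod ℓ) * (X - 1)) = 0 := by
    rw [hmul, map_sub, map_pow, aeval_X, map_one, sub_eq_zero]
    have := map_pow (LinearEquiv.automorphismGroup.toLinearMapMonoidHom (R := ZMod ℓ) (M := V)) z r
    rw [hz, map_one] at this
    exact this.symm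
  have h3 : cyclotomic r (ZMod ℓ) = (a * cyclotomic r (ZMod ℓ)) * cyclotomic r (ZMod ℓ) ^ n +
      b * (cyclotomic r (ZMod ℓ) * (X - 1)) := by
    linear_combination -cyclotomic r (ZMod ℓ) * hab
  rw [h3, map_add, map_mul, map_mul _ b, h1, h2, mul_zero, mul_zero, add_zero]

theorem rootMultiplicity_le_one (hrℓ : r ≠ ℓ) (m : ℕ) {L : Type*} [Field L] [Algebra (ZMod ℓ) L]
    {β : L} (hβ : aeval β (cyclotomic r (ZMod ℓ)) = 0) :
    (((X - 1) ^ m * cyclotomic r (ZMod ℓ)).map (algebraMap (ZMod ℓ) L)).rootMultiplicity β ≤ 1 := by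
  have hprim := isPrimitiveRoot_of_aeval_cyclotomic hrℓ hβ
  have h0 : (((X - 1) ^ m * cyclotomic r (ZMod ℓ)).map (algebraMap (ZMod ℓ) L)) ≠ 0 := by
    refine (Monic.map _ (Monic.mul (Monic.pow ?_ m) (cyclotomic.monic r _))).ne_zero
    simpa using monic_X_sub_C (1 : ZMod ℓ)
  rw [Polynomial.map_mul] at h0 ⊢
  rw [rootMultiplicity_mul h0, rootMultiplicity_eq_zero, zero_add]
  · exact rootMultiplicity_le_one_of_separable ((cyclotomic_separable hrℓ).map) β
  · rw [IsRoot.def, eval_map_algebraMap, map_pow, map_sub, aeval_X, map_one]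
    exact pow_ne_zero _ (sub_ne_zero.2 (hprim.ne_one (Fact.out : r.Prime).one_lt))

/-- By Fermat, `ℓ ^ (r - 1)` is `1` modulo `r`; the factor `n` only serves to make the exponent
large. -/
theorem pow_card_pow_eq_self (hrℓ : r ≠ ℓ) {M : Type*} [Monoid M] {x : M} (hx : orderOf x = r)
    (n : ℕ) : x ^ ℓ ^ ((r - 1) * n) = x := by
  have h1 : ((ℓ ^ ((r - 1) * n) : ℕ) : ZMod r) = (1 : ℕ) := by
    rw [Nat.cast_pow, Nat.cast_one, pow_mul,
      ZMod.pow_card_sub_one_eq_one (natCast_zmod_ne_zero hrℓ.symm), one_pow]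
  have h2 : x ^ ℓ ^ ((r - 1) * n) = x ^ 1 := by
    rw [← pow_mod_orderOf x (ℓ ^ _), ← pow_mod_orderOf x 1, hx,
      (ZMod.natCast_eq_natCast_iff _ _ _).1 h1]
  rw [h2, pow_one]

end Cyclotomic

/-! ### Eigenvectors in distinct blocks. -/

section Independence

variable {K : Type*} [Field K] {V : Type*} [AddCommGroup V] [Module K V] [Module.Finite K V]

/-- The line over `K[X]/(φ)` through `v` lies in the kernel of the minimal polynomial at `g`, and
its dimension over `K` is already at least the degree. A nonzero `w` in a coprime block would exceed
the bound. -/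
theorem eq_zero_of_aeval_minpoly_apply_eq_zero {z : V ≃ₗ[K] V} {φ ψ : K[X]}
    [Fact (Irreducible φ)] [Module.Finite K (AdjoinRoot φ)]
    (hφψ : IsCoprime φ ψ) {g : Module.End K V} (hg : Commute g (z : Module.End K V))
    {α : AdjoinRoot φ} {v : block z φ} (hv0 : v ≠ 0) (hv : g v = ((α • v : block z φ) : V))
    (hdim : Module.finrank K (LinearMap.ker (aeval g (minpoly K α))) ≤ (minpoly K α).natDegree)
    {w : V} (hw : w ∈ block z ψ) (hgw : aeval g (minpoly K α) w = 0) : w = 0 := by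
  by_contra hw0
  have hmem : ∀ a : AdjoinRoot φ, aeval g (minpoly K α) ((a • v : block z φ) : V) = 0 := by
    intro a
    have h1 : g ((a • v : block z φ) : V) = ((α • a • v : block z φ) : V) := by
      obtain ⟨q, rfl⟩ := AdjoinRoot.mk_surjective a
      have := LinearMap.congr_fun (commute_aeval hg q).eq (v : V)
      rw [Module.End.mul_apply, Module.End.mul_apply, hv] at this
      rw [mk_smul_coe, this, smul_comm, mk_smul_coe]
    rw [aeval_apply_of_apply_eq_smul hg h1, minpoly.aeval, zero_smul, Submodule.coe_zero]
  let f : (AdjoinRoot φ × K) →ₗ[K] LinearMap.ker (aeval g (minpoly K α)) :=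
    { toFun := fun x => ⟨((x.1 • v : block z φ) : V) + x.2 • w, by
        rw [LinearMap.mem_ker, map_add, hmem, map_smul, hgw, smul_zero, add_zero]⟩
      map_add' := fun x y => by
        ext; simp only [Prod.fst_add, Prod.snd_add, add_smul, Submodule.coe_add]; abel
      map_smul' := fun c x => by
        ext
        simp only [Prod.smul_fst, Prod.smul_snd, smul_assoc, Submodule.coe_smul, smul_add,
          RingHom.id_apply] }
  have hf : Function.Injective f := by
    rw [injective_iff_map_eq_zero]
    rintro ⟨a, c⟩ h
    have h1 : ((a • v : block z φ) : V) + c • w = 0 := congrArg Subtype.val h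
    have h2 : c • w = 0 := eq_zero_of_mem_block_of_isCoprime hφψ
      (by rw [← neg_eq_of_add_eq_zero_right h1]; exact Submodule.neg_mem _ (a • v).2)
      (Submodule.smul_mem _ c hw)
    rw [h2, add_zero] at h1
    rw [smul_eq_zero_iff_left hw0] at h2
    have h3 : a = 0 := (smul_eq_zero_iff_left hv0).1 (Subtype.ext h1)
    rw [h3, h2]
    rfl
  have h1 := LinearMap.finrank_le_finrank_of_injective hf
  rw [Module.finrank_prod, Module.finrank_self] at h1
  have h2 := minpoly.natDegree_le (A := K) α
  omega

/-- The eigenvalue `α` of `g` on `U_φ` becomes `α⁻¹` on the dual block. If `μ(g)` were injective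
there, it would be surjective, and `B(v, μ(g) u) = B(μ(g⁻¹) v, u) = 0` would make `v` orthogonal to
the dual block. -/
theorem exists_mem_block_recip_aeval_eq_zero {B : LinearMap.BilinForm K V} (hB : B.Nondegenerate)
    {ζ : Sp B} {φ q : K[X]} [Fact (Irreducible φ)] (hq : IsCoprime (recip φ) q)
    (h0 : aeval ((ζ : V ≃ₗ[K] V) : Module.End K V) (recip φ * q) = 0)
    {g : Subgroup.centralizer {ζ}} {α : AdjoinRoot φ} (hα : α ≠ 0)
    {v : block (ζ : V ≃ₗ[K] V) φ} (hv0 : v ≠ 0) (hv : proj ζ φ g v = α • v) {μ : K[X]}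
    (hμ : aeval α⁻¹ μ = 0) :
    ∃ w ∈ block (ζ : V ≃ₗ[K] V) (recip φ), w ≠ 0 ∧
      aeval (((g : Sp B) : V ≃ₗ[K] V) : Module.End K V) μ w = 0 := by
  by_contra! hcon
  set Y := block (ζ : V ≃ₗ[K] V) (recip φ) with hY
  set T := aeval (((g : Sp B) : V ≃ₗ[K] V) : Module.End K V) μ with hT
  have hTY : ∀ w ∈ Y, T w ∈ Y := mem_block_of_commute _ _
    (commute_aeval (commute_of_mem_centralizer g).symm μ).symm
  have hinj : Function.Injective (T.restrict hTY) := by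
    rw [injective_iff_map_eq_zero]
    intro w hw
    by_contra hw0
    exact hcon w w.2 (fun h => hw0 (Subtype.ext h)) (congrArg Subtype.val hw)
  have hsurj := LinearMap.injective_iff_surjective.1 hinj
  have hinv : proj ζ φ g⁻¹ v = α⁻¹ • v := by
    rw [eq_inv_smul_iff₀ hα, ← map_smul, ← hv, map_inv, inv_apply_self]
  apply hv0
  refine Subtype.ext (eq_zero_of_orthogonal_block_recip hB ζ.2 hq h0 v.2 fun w hw => ?_)
  obtain ⟨u, hu⟩ := hsurj ⟨w, hw⟩
  have hu' : T u = w := congrArg Subtype.val hu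
  have h1 : aeval (((((g : Sp B) : V ≃ₗ[K] V)⁻¹ : V ≃ₗ[K] V)) : Module.End K V) μ (v : V) = _ :=
    aeval_apply_of_apply_eq_smul (a := α⁻¹) (commute_of_mem_centralizer g⁻¹)
      (congrArg Subtype.val hinv) μ
  rw [← hu', hT, apply_aeval_apply' (g : Sp B).2, h1, hμ, zero_smul, Submodule.coe_zero,
    map_zero, LinearMap.zero_apply]

end Independence

/-! ### The factors of the centraliser and the separation of eigenvalues. -/

section Centraliser

variable {r ℓ n t : ℕ} [Fact r.Prime] [Fact ℓ.Prime]
  {V : Type*} [AddCommGroup V] [Module (ZMod ℓ) V]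
  {B : LinearMap.BilinForm (ZMod ℓ) V} {ζ : Sp B}
  {φ : Fin t → (ZMod ℓ)[X]} [∀ j, Fact (Irreducible (φ j))]

theorem proj_mem_factorGroup (j : Fin t) (g : Subgroup.centralizer {ζ}) :
    proj ζ (φ j) g ∈ factorGroup r B (ζ : V ≃ₗ[ZMod ℓ] V) (φ j) := by
  rw [factorGroup]
  split_ifs
  · exact Subgroup.mem_top _
  · exact proj_mem_unitaryBlockGroup g

variable (hrℓ : r ≠ ℓ) (hBnd : B.Nondegenerate)
  (h0 : aeval ((ζ : V ≃ₗ[ZMod ℓ] V) : Module.End (ZMod ℓ) V) (cyclotomic r (ZMod ℓ)) = 0)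
  (hm : ∀ j, (φ j).Monic)
  (hφ : cyclotomic r (ZMod ℓ) =
      if Odd (inertiaDeg r ℓ) then ∏ j, φ j * recip (φ j) else ∏ j, φ j)

include hrℓ hBnd h0 hφ

/-- The projections embed the centraliser into the product of the factors. -/
theorem eq_one_of_forall_proj_eq_one {g : Subgroup.centralizer {ζ}}
    (hg : ∀ j, proj ζ (φ j) g = 1) : g = 1 := by
  have hsep := cyclotomic_separable hrℓ
  let d : V →ₗ[ZMod ℓ] V := (((g : Sp B) : V ≃ₗ[ZMod ℓ] V) : V →ₗ[ZMod ℓ] V) - LinearMap.id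
  have h1 : ∀ j, ∀ v ∈ block (ζ : V ≃ₗ[ZMod ℓ] V) (φ j), d v = 0 := fun j v hv =>
    sub_eq_zero.2 (congrArg Subtype.val (LinearEquiv.congr_fun (hg j) ⟨v, hv⟩))
  have h2 : ∀ j, ∀ v ∈ block (ζ : V ≃ₗ[ZMod ℓ] V) (recip (φ j)), d v = 0 := fun j v hv => by
    obtain ⟨q, hq⟩ := dvd_cyclotomic hφ j
    rw [hq] at hsep h0
    exact sub_eq_zero.2 (apply_eq_of_proj_eq_one hBnd
      (coeff_zero_ne_zero_of_dvd_cyclotomic (dvd_cyclotomic hφ j)) hsep.isCoprime h0 (hg j) hv)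
  have h3 : ∀ v, d v = 0 := by
    intro v
    have hv : v ∈ block (ζ : V ≃ₗ[ZMod ℓ] V) (cyclotomic r (ZMod ℓ)) := by
      rw [mem_block, h0, LinearMap.zero_apply]
    by_cases hi : Odd (inertiaDeg r ℓ)
    · rw [hφ, if_pos hi] at hv hsep
      refine apply_eq_zero_of_mem_block_prod _ hsep (fun j _ => ?_) v hv
      have := hsep.of_dvd (Finset.dvd_prod_of_mem (fun j => φ j * recip (φ j)) (Finset.mem_univ j))
      exact apply_eq_zero_of_mem_block_mul this.isCoprime (h1 j) (h2 j)
    · rw [hφ, if_neg hi] at hv hsep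
      exact apply_eq_zero_of_mem_block_prod _ hsep (fun j _ => h1 j) v hv
  refine Subtype.ext (Subtype.ext (LinearEquiv.ext fun v => ?_))
  exact sub_eq_zero.1 (h3 v)

variable [Module.Finite (ZMod ℓ) V]

include hm in
theorem isHomologyFactor_factorGroup (hr : r ≠ 2) (hBalt : B.IsAlt) (j : Fin t)
    (hdim : 4 ≤ Module.finrank (AdjoinRoot (φ j)) (block (ζ : V ≃ₗ[ZMod ℓ] V) (φ j)))
    {α : AdjoinRoot (φ j)} (hα : α ≠ 1) (hα0 : α ≠ 0) {g : Subgroup.centralizer {ζ}}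
    (hg : IsHomology α (proj ζ (φ j) g)) :
    IsHomologyFactor (factorGroup r B (ζ : V ≃ₗ[ZMod ℓ] V) (φ j)) (proj ζ (φ j) g) α := by
  by_cases hi : Odd (inertiaDeg r ℓ)
  · rw [factorGroup, if_pos hi]
    exact isHomologyFactor_commutator hdim hα hα0 hg
  · rw [factorGroup, if_neg hi]
    have hdvd := dvd_cyclotomic hφ j
    have hsep := cyclotomic_separable hrℓ
    obtain ⟨q, hq⟩ := id hdvd
    rw [hq] at hsep h0
    exact isHomologyFactor_unitaryBlockGroup hBalt ζ.2 (coeff_zero_ne_zero_of_dvd_cyclotomic hdvd)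
      (recip_eq_self hrℓ hi (hm j) hdvd) hBnd hsep.isCoprime h0 (root_inv_ne_root hr hrℓ hdvd)
      hdim hα hg (proj_mem_unitaryBlockGroup g)

include hm in
/-- The eigenvalues of `τ` on different blocks are not conjugate, even up to inversion. -/
theorem aeval_minpoly_ne_zero {τ : Subgroup.centralizer {ζ}} {m : ℕ}
    (hτ : LinearMap.charpoly (((τ : Sp B) : V ≃ₗ[ZMod ℓ] V) : V →ₗ[ZMod ℓ] V) =
      (X - 1) ^ m * cyclotomic r (ZMod ℓ)) {α : ∀ j, AdjoinRoot (φ j)}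
    (hα : ∀ j, orderOf (α j) = r) {v : ∀ j, block (ζ : V ≃ₗ[ZMod ℓ] V) (φ j)} (hv0 : ∀ j, v j ≠ 0)
    (hv : ∀ j, proj ζ (φ j) τ (v j) = α j • v j) {j k : Fin t} (hjk : j ≠ k) :
    aeval (α k) (minpoly (ZMod ℓ) (α j)) ≠ 0 ∧
      aeval (α k)⁻¹ (minpoly (ZMod ℓ) (α j)) ≠ 0 := by
  have hcomm := commute_of_mem_centralizer τ
  -- All roots of the minimal polynomial of `α j` are primitive `r`-th roots of unity, which are
  -- simple roots of the characteristic polynomial of `τ`.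
  have hdim := finrank_ker_aeval_le (((τ : Sp B) : V ≃ₗ[ZMod ℓ] V) : Module.End (ZMod ℓ) V)
    (minpoly.monic (Algebra.IsIntegral.isIntegral (R := ZMod ℓ) (α j))) (fun β hβ => by
      rw [hτ]
      refine rootMultiplicity_le_one hrℓ m ?_
      obtain ⟨c, hc⟩ := minpoly.dvd (ZMod ℓ) (α j) (aeval_cyclotomic_of_orderOf_eq (hα j))
      rw [hc, map_mul, hβ, zero_mul])
  have hcop := isCoprime_factor hrℓ hm hφ hjk
  have hvj := congrArg Subtype.val (hv j)
  refine ⟨fun h => ?_, fun h => ?_⟩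
  · refine hv0 k (Subtype.ext (eq_zero_of_aeval_minpoly_apply_eq_zero hcop.1 hcomm (hv0 j) hvj hdim
      (v k).2 ?_))
    rw [aeval_apply_of_apply_eq_smul hcomm (congrArg Subtype.val (hv k)), h, zero_smul,
      Submodule.coe_zero]
  · obtain ⟨q, hq⟩ := recip_dvd_cyclotomic hrℓ hm hφ k
    have hsep := cyclotomic_separable hrℓ
    rw [hq] at hsep h0
    have hαk : α k ≠ 0 := by
      intro h1
      have h2 := pow_orderOf_eq_one (α k)
      rw [hα, h1, zero_pow (Fact.out : r.Prime).ne_zero] at h2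
      exact zero_ne_one h2
    obtain ⟨w, hw, hw0, hτw⟩ := exists_mem_block_recip_aeval_eq_zero hBnd hsep.isCoprime h0 hαk
      (hv0 k) (hv k) h
    exact hw0 (eq_zero_of_aeval_minpoly_apply_eq_zero hcop.2 hcomm (hv0 j) hvj hdim hw hτw)

end Centraliser

/-- If every element of `S j` is the `j`-th coordinate of an element of `H` whose other coordinates
are trivial, then `H` maps onto the product of the `S j`. -/
theorem exists_forall_eq_of_forall_single {ι H : Type*} [Finite ι] [Group H] {M : ι → Type*}
    [∀ j, Group (M j)] {π : ∀ j, H →* M j} {S : ∀ j, Subgroup (M j)}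
    (h : ∀ j, ∀ s ∈ S j, ∃ x, π j x = s ∧ ∀ k, k ≠ j → π k x = 1) {s : ∀ j, M j}
    (hs : ∀ j, s j ∈ S j) : ∃ x, ∀ j, π j x = s j := by
  classical
  have := Fintype.ofFinite ι
  have key : ∀ T : Finset ι, ∃ x, ∀ j, π j x = if j ∈ T then s j else 1 := by
    intro T
    induction T using Finset.induction_on with
    | empty => exact ⟨1, by simp⟩
    | insert i T hi ih =>
      obtain ⟨x, hx⟩ := ih
      obtain ⟨y, hy, hy'⟩ := h i (s i) (hs i)
      refine ⟨y * x, fun j => ?_⟩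
      rw [map_mul, hx]
      rcases eq_or_ne j i with rfl | hji
      · simp [hy, hi]
      · simp [hy' j hji, hji]
  obtain ⟨x, hx⟩ := key Finset.univ
  exact ⟨x, fun j => by simpa using hx j⟩

end SympCentraliser

open Polynomial SympCentraliser in
theorem mainTheorem9
    (r ℓ n t : ℕ) [Fact r.Prime] [Fact ℓ.Prime] (hr : r ≠ 2) (hrℓ : r ≠ ℓ) (hn : 4 ≤ n)
    {V : Type*} [AddCommGroup V] [Module (ZMod ℓ) V] [Module.Finite (ZMod ℓ) V]
    (B : LinearMap.BilinForm (ZMod ℓ) V) (hBalt : B.IsAlt) (hBnd : B.Nondegenerate)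
    (ζ : Sp B) (hζord : orderOf ζ = r)
    (hζ : LinearMap.charpoly ((ζ : V ≃ₗ[ZMod ℓ] V) : V →ₗ[ZMod ℓ] V) =
      (cyclotomic r (ZMod ℓ)) ^ n)
    (φ : Fin t → (ZMod ℓ)[X]) [∀ j, Fact (Irreducible (φ j))] (hφmonic : ∀ j, (φ j).Monic)
    (hφ : cyclotomic r (ZMod ℓ) =
      if Odd (inertiaDeg r ℓ) then ∏ j, φ j * recip (φ j) else ∏ j, φ j)
    (H : Subgroup (Subgroup.centralizer {ζ}))
    (hH : ∀ j, factorCommutator r B (ζ : V ≃ₗ[ZMod ℓ] V) (φ j) ≤ H.map (proj ζ (φ j)))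
    (τ : Subgroup.centralizer {ζ}) (hτH : τ ∈ H)
    (hτproj : ∀ j, ∃ α : AdjoinRoot (φ j), orderOf α = r ∧
      LinearMap.charpoly (proj ζ (φ j) τ : block (ζ : V ≃ₗ[ZMod ℓ] V) (φ j) →ₗ[AdjoinRoot (φ j)]
        block (ζ : V ≃ₗ[ZMod ℓ] V) (φ j)) = (X - 1) ^ (n - 1) * (X - C α))
    (hτ : LinearMap.charpoly (((τ : Sp B) : V ≃ₗ[ZMod ℓ] V) : V →ₗ[ZMod ℓ] V) =
      (X - 1) ^ ((n - 1) * (r - 1)) * cyclotomic r (ZMod ℓ)) :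
    (Subgroup.pi Set.univ (fun j => factorCommutator r B (ζ : V ≃ₗ[ZMod ℓ] V) (φ j))).comap
        (MonoidHom.pi (fun j => proj ζ (φ j))) ≤ H ∧
      Subgroup.pi Set.univ (fun j => factorCommutator r B (ζ : V ≃ₗ[ZMod ℓ] V) (φ j)) ≤
        H.map (MonoidHom.pi (fun j => proj ζ (φ j))) := by
  choose α hα hchar using hτproj
  have hr1 := (Fact.out : r.Prime).one_lt
  have hα1 : ∀ j, α j ≠ 1 := fun j h => by
    have := hα j
    rw [h, orderOf_one] at this
    omega
  have hα0 : ∀ j, α j ≠ 0 := fun j h => by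
    have h2 := pow_orderOf_eq_one (α j)
    rw [hα, h, zero_pow (by omega)] at h2
    exact zero_ne_one h2
  have h0 := aeval_cyclotomic_eq_zero hrℓ (z := (ζ : V ≃ₗ[ZMod ℓ] V))
    (by
      have := pow_orderOf_eq_one ζ
      rw [hζord] at this
      exact congrArg Subtype.val this) hζ
  have hdim : ∀ j, Module.finrank (AdjoinRoot (φ j)) (block (ζ : V ≃ₗ[ZMod ℓ] V) (φ j)) = n := by
    intro j
    rw [← LinearMap.charpoly_natDegree (proj ζ (φ j) τ :
      block (ζ : V ≃ₗ[ZMod ℓ] V) (φ j) →ₗ[AdjoinRoot (φ j)] block (ζ : V ≃ₗ[ZMod ℓ] V) (φ j)),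
      hchar, ← C_1, Monic.natDegree_mul ((monic_X_sub_C _).pow _) (monic_X_sub_C _),
      (monic_X_sub_C _).natDegree_pow, natDegree_X_sub_C, natDegree_X_sub_C]
    omega
  have heig : ∀ j, ∃ v, v ≠ 0 ∧ proj ζ (φ j) τ v = α j • v := by
    intro j
    have h1 : (LinearMap.charpoly (proj ζ (φ j) τ : block (ζ : V ≃ₗ[ZMod ℓ] V) (φ j)
        →ₗ[AdjoinRoot (φ j)] block (ζ : V ≃ₗ[ZMod ℓ] V) (φ j))).IsRoot (α j) := by
      rw [hchar, IsRoot.def, eval_mul, eval_sub, eval_X, eval_C, sub_self, mul_zero]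
    obtain ⟨v, hv⟩ :=
      ((Module.End.hasEigenvalue_iff_isRoot_charpoly _ _).2 h1).exists_hasEigenvector
    exact ⟨v, hv.2, hv.apply_eq_smul⟩
  choose v hv0 hv using heig
  -- The factor `r - 1` makes `ℓ ^ e ≡ 1` modulo `r`, which preserves each `α j`; the factor `n`
  -- gives `ℓ ^ e ≥ n - 1`, which kills the unipotent part.
  set e := (r - 1) * n with he
  have hhom : ∀ j, IsHomology (α j) (proj ζ (φ j) (τ ^ ℓ ^ e)) := by
    intro j
    have : CharP (AdjoinRoot (φ j)) ℓ :=
      charP_of_injective_algebraMap (algebraMap (ZMod ℓ) (AdjoinRoot (φ j))).injective ℓ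
    rw [map_pow]
    refine isHomology_pow ℓ (hα1 j) (hchar j) ?_ (pow_card_pow_eq_self hrℓ (hα j) n)
    refine le_trans ?_ (Nat.lt_pow_self (Fact.out : ℓ.Prime).one_lt).le
    exact (Nat.sub_le n 1).trans (Nat.le_mul_of_pos_left n (by omega))
  have hfin : ∀ j, Finite (AdjoinRoot (φ j)) := fun j => Module.finite_of_finite (ZMod ℓ)
  have hind := fun j k (hjk : j ≠ k) =>
    aeval_minpoly_ne_zero hrℓ hBnd h0 hφmonic hφ hτ hα hv0 hv hjk
  have hsingle := fun j => exists_of_isHomologyFactor (H := H)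
    (π := fun j => (proj ζ (φ j)).comp H.subtype) (τ := ⟨τ ^ ℓ ^ e, pow_mem hτH _⟩)
    (G := fun j => factorGroup r B (ζ : V ≃ₗ[ZMod ℓ] V) (φ j))
    (fun j => isHomologyFactor_factorGroup hrℓ hBnd h0 hφmonic hφ hr hBalt j
      (by rw [hdim]; exact hn) (hα1 j) (hα0 j) (hhom j))
    (fun j x => proj_mem_factorGroup j _)
    (fun j s hs => by
      obtain ⟨x, hx, hxs⟩ := hH j hs
      exact ⟨⟨x, hx⟩, hxs⟩)
    hα1 hα0 hhom (fun j => by rw [hdim]; omega) (fun j k hjk => (hind j k hjk).1)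
    (fun j k hjk => (hind j k hjk).2) j
  have hall : ∀ s : ∀ j, block (ζ : V ≃ₗ[ZMod ℓ] V) (φ j) ≃ₗ[AdjoinRoot (φ j)]
      block (ζ : V ≃ₗ[ZMod ℓ] V) (φ j),
      (∀ j, s j ∈ factorCommutator r B (ζ : V ≃ₗ[ZMod ℓ] V) (φ j)) →
        ∃ x ∈ H, ∀ j, proj ζ (φ j) x = s j := by
    intro s hs
    obtain ⟨x, hx⟩ := exists_forall_eq_of_forall_single hsingle hs
    exact ⟨x, x.2, hx⟩
  refine ⟨fun c hc => ?_, fun s hs => ?_⟩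
  · obtain ⟨x, hxH, hx⟩ := hall (fun j => proj ζ (φ j) c) fun j => hc j (Set.mem_univ j)
    -- An element of `H` with the same projections as `c` equals `c`, since the projections are
    -- jointly injective on the centraliser.
    have h1 : x⁻¹ * c = 1 := eq_one_of_forall_proj_eq_one hrℓ hBnd h0 hφ fun j => by
      rw [map_mul, map_inv, hx, inv_mul_cancel]
    rwa [← inv_mul_eq_one.1 h1]
  · obtain ⟨x, hxH, hx⟩ := hall s fun j => hs j (Set.mem_univ j)
    exact ⟨x, hxH, funext hx⟩
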